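/- **Setting.** Fix $r_0>0$ and $\bar a>\bar b$ with $64r_0(2\bar a+\bar b)=1$, put $p=r_0^3$, and let $(a,b)$ be the corresponding complete member of the $\mathbb{B}_7$-family of $SU(2)^2\times U(1)$-invariant torsion-free $G_2$-structures on $S^3\times\mathbb{R}^4$: with $F(a,b)=4a^2(b-p)^2-(b^2-p^2)^2$, the functions $a,b$ of the arc length $t$ are smooth and even, satisfy $F(a,b)>0$ and the Hitchin flow $$\dot x_1=\frac{\partial_aF(y_1,y_2)}{4\sqrt{F(y_1,y_2)}},\quad \dot x_2=\frac{\partial_bF(y_1,y_2)}{2\sqrt{F(y_1,y_2)}},\quad \dot y_1=\frac{x_1x_2}{\sqrt{x_1^2x_2}},\quad \dot y_2=\frac{x_1^2}{\sqrt{x_1^2x_2}}$$ for all $t>0$, where $x_1=\dot a\dot b$, $x_2=\dot a^2$, $y_1=a$, $y_2=b$, and $a=r_0^3+\frac14r_0t^2+\bar at^4+O(t^6)$, $b=r_0^3+\frac14r_0t^2+\bar bt^4+O(t^6)$ near the singular orbit $t=0$. Let $\ell=\lim_{t\to\infty}\sqrt[3]{2b^3/(3a^2)}$ be the size of the asymptotic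 circle. Put $$A_1=\sqrt{\tfrac{(b-p)(2a-b-p)}{\dot a\dot b}},\quad B_1=\sqrt{\tfrac{(b-p)(2a+b+p)}{\dot a\dot b}},\quad A_3=\frac{b-p}{\dot a},\quad B_3=\frac{2\dot a\dot b}{b-p},$$ and consider the $G_2$-instanton equations $$\dot f^++\frac12\Big(\frac{A_1^2+B_3^2+B_1^2}{A_1B_1B_3}-\frac{A_3^2+2A_1^2}{A_1^2A_3}\Big)f^+=-f^+g^+,\qquad \dot g^++\frac12\Big(\frac{A_3}{B_1^2}-\frac{A_3}{A_1^2}\Big)g^+=-(f^+)^2.\qquad(*)$$ An *end solution* with end data $(G_\infty,\lambda)\in\mathbb{R}^2$ is a solution of $(*)$ on some $(T,\infty)$, $T\ge 0$, with $g^+\to G_\infty$ and $f^+=e^{(\ell^{-1}-G_\infty)t}\big[\lambda t^{-5/2}+O(t^{-7/2})\big]$ as $t\to\infty$. A solution on $(0,\infty)$ *closes smoothly* over the singular orbit with initial data $(f_1^+,g_1^+)$ if near $t=0$ the functions $f^+,g^+$ are restrictions of smooth odd functions of $t$ with derivatives $f_1^+,g_1^+$ at $0$; in particular $f^+=f_1^+t+O(t^3)$,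 $g^+=g_1^+t+O(t^3)$. **Proposition.** 1. Suppose an end solution with end data $(G_\infty,\lambda)$, $G_\infty>\ell^{-1}$, extends to a solution of $(*)$ on $(0,\infty)$ that closes smoothly with initial data $(f_1^+,g_1^+)$. Then there are open neighbourhoods $U$ of $(G_\infty,\lambda)$ and $V$ of $(f_1^+,g_1^+)$ in $\mathbb{R}^2$, with $U\subset\{G>\ell^{-1}\}$, and a homeomorphism $\Phi:U\to V$ with $\Phi(G_\infty,\lambda)=(f_1^+,g_1^+)$, such that for every $e\in U$ an end solution with end data $e$ exists, and every end solution with end data $e$ extends to a solution on $(0,\infty)$ that closes smoothly with initial data $\Phi(e)$. 2. Consequently the set of initial data of bounded solutions on $(0,\infty)$ that close smoothly and have $\lim_{t\to\infty}g^+>\ell^{-1}$ is open in $\mathbb{R}^2$, and so is the set of end data $(G_\infty,\lambda)$ with $G_\infty>\ell^{-1}$ of solutions on $(0,\infty)$ that close smoothly. 3. Let $G>\ell^{-1}$. The abelian solution $f^+=0$, $g^+=G\ell^{-1}A_3$ closes smoothly with initial data $(0,\frac{G}{2\ell})$ and has end data $(G,0)$. There are $\varepsilon>0$ and a continuous injective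 curve $\gamma:(-\varepsilon,\varepsilon)\to\mathbb{R}^2$ with $\gamma(0)=(0,\frac{G}{2\ell})$ such that for each $\lambda\in(-\varepsilon,\varepsilon)$ there is a solution on $(0,\infty)$ that closes smoothly with initial data $\gamma(\lambda)$ and has end data $(G,\lambda)$; for $\lambda\neq0$ it is non-abelian, with $f^+(t)\neq0$ for all $t>0$. -/

import Mathlib

open Set Filter Topology Asymptotics
open scoped ContDiff

noncomputable section

namespace B7

/-- The polynomial `F(a,b) = 4a²(b-p)(b+q) - (b² + pq)²` of the Hitchin flow. -/
def hitchinF (p q a b : ℝ) : ℝ :=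
  4 * a ^ 2 * (b - p) * (b + q) - (b ^ 2 + p * q) ^ 2

/-- The pair `(a,b)` satisfies, at the time `t`, the Hitchin flow equations for
`x₁ = a' b'`, `x₂ = (a')²`, `y₁ = a`, `y₂ = b`; the radicand `F(a,b)` is required to be positive
(nondegeneracy of the `G₂`-structure). -/
structure HitchinFlowAt (p q : ℝ) (a b : ℝ → ℝ) (t : ℝ) : Prop where
  F_pos : 0 < hitchinF p q (a t) (b t)
  x₁_eq : HasDerivAt (fun s => deriv a s * deriv b s)
    (deriv (fun y => hitchinF p q y (b t)) (a t) / (4 * √(hitchinF p q (a t) (b t)))) t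
  x₂_eq : HasDerivAt (fun s => deriv a s ^ 2)
    (deriv (fun y => hitchinF p q (a t) y) (b t) / (2 * √(hitchinF p q (a t) (b t)))) t
  y₁_eq : HasDerivAt a
    ((deriv a t * deriv b t) * deriv a t ^ 2 /
      √((deriv a t * deriv b t) ^ 2 * deriv a t ^ 2)) t
  y₂_eq : HasDerivAt b
    ((deriv a t * deriv b t) ^ 2 /
      √((deriv a t * deriv b t) ^ 2 * deriv a t ^ 2)) t

/-- `(a,b)` are the coefficient functions of the complete member, with parameters
`r₀, abar, bbar`, of the `𝔹₇`-family of `SU(2)² × U(1)`-invariant torsion-free `G₂`-structures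
on `S³ × ℝ⁴`, parametrised by the arc length `t` of a geodesic orthogonal to the orbits.
Here `p = -q = r₀³`. Only the values at `t > 0` carry geometric information; smoothness of
the `G₂`-structure across the singular orbit `t = 0` is expressed by `a`, `b` being smooth
even functions of `t`. -/
structure IsB7Member (r₀ abar bbar : ℝ) (a b : ℝ → ℝ) : Prop where
  r₀_pos : 0 < r₀
  constraint : 64 * r₀ * (2 * abar + bbar) = 1
  bbar_lt_abar : bbar < abar
  smooth_a : ContDiff ℝ ∞ a
  smooth_b : ContDiff ℝ ∞ b
  even_a : Function.Even a
  even_b : Function.Even b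
  expansion_a : (fun t => a t - (r₀ ^ 3 + r₀ / 4 * t ^ 2 + abar * t ^ 4))
    =O[𝓝 0] (fun t : ℝ => t ^ 6)
  expansion_b : (fun t => b t - (r₀ ^ 3 + r₀ / 4 * t ^ 2 + bbar * t ^ 4))
    =O[𝓝 0] (fun t : ℝ => t ^ 6)
  flow : ∀ t, 0 < t → HitchinFlowAt (r₀ ^ 3) (-(r₀ ^ 3)) a b t

/-- `ℓ` is the size of the asymptotic circle fibre, the limit as `t → ∞` of the cube root
of `2b³/(3a²)`. -/
def IsCircleLength (a b : ℝ → ℝ) (ℓ : ℝ) : Prop :=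
  Tendsto (fun t => (2 * b t ^ 3 / (3 * a t ^ 2)) ^ ((1 : ℝ) / 3)) atTop (𝓝 ℓ)

/-- Metric coefficient `A₁ = A₂`. -/
def A₁ (p : ℝ) (a b : ℝ → ℝ) (t : ℝ) : ℝ :=
  √((b t - p) * (2 * a t - b t - p) / (deriv a t * deriv b t))

/-- Metric coefficient `B₁ = B₂`. -/
def B₁ (p : ℝ) (a b : ℝ → ℝ) (t : ℝ) : ℝ :=
  √((b t - p) * (2 * a t + b t + p) / (deriv a t * deriv b t))

/-- Metric coefficient `A₃`. -/
def A₃ (p : ℝ) (a b : ℝ → ℝ) (t : ℝ) : ℝ := (b t - p) / deriv a t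

/-- Metric coefficient `B₃`. -/
def B₃ (p : ℝ) (a b : ℝ → ℝ) (t : ℝ) : ℝ := 2 * deriv a t * deriv b t / (b t - p)

/-- The coefficient of `f⁺` in the `f⁺`-equation. -/
def coeffF (p : ℝ) (a b : ℝ → ℝ) (t : ℝ) : ℝ :=
  1 / 2 * ((A₁ p a b t ^ 2 + B₃ p a b t ^ 2 + B₁ p a b t ^ 2) /
      (A₁ p a b t * B₁ p a b t * B₃ p a b t)
    - (A₃ p a b t ^ 2 + 2 * A₁ p a b t ^ 2) / (A₁ p a b t ^ 2 * A₃ p a b t))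

/-- The coefficient of `g⁺` in the `g⁺`-equation. -/
def coeffG (p : ℝ) (a b : ℝ → ℝ) (t : ℝ) : ℝ :=
  1 / 2 * (A₃ p a b t / B₁ p a b t ^ 2 - A₃ p a b t / A₁ p a b t ^ 2)

/-- `(f,g) = (f⁺,g⁺)` solves on `S` the `G₂`-instanton equations
`f' + coeffF · f = - f g`, `g' + coeffG · g = - f²`. -/
def SolvesOn (p : ℝ) (a b : ℝ → ℝ) (S : Set ℝ) (f g : ℝ → ℝ) : Prop :=
  ∀ t ∈ S, HasDerivAt f (-(f t * g t) - coeffF p a b t * f t) t ∧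
    HasDerivAt g (-(f t) ^ 2 - coeffG p a b t * g t) t

/-- `h`, given for small `t > 0`, is near `t = 0` a smooth odd function of `t` with
derivative `h₁` at `0`; in particular `h = h₁ t + O(t³)`. -/
def IsSmoothOddAtZero (h : ℝ → ℝ) (h₁ : ℝ) : Prop :=
  ∃ φ : ℝ → ℝ, ContDiff ℝ ∞ φ ∧ Function.Odd φ ∧ deriv φ 0 = h₁ ∧ h =ᶠ[𝓝[>] 0] φ

/-- `(f,g)` closes smoothly over the singular orbit `t = 0` (on the bundle `P₁`) with initial
data `x = (f₁⁺, g₁⁺)`. The forms `t² eᵢ⁺` are smooth across the singular orbit and `A₁`, `A₃` are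
`t` times smooth positive even functions, so that the connection with components `A₁ f` along
`e₁⁺, e₂⁺` and `A₃ g` along `e₃⁺` extends smoothly iff `f` and `g` are smooth odd functions
of `t`. -/
def ClosesSmoothly (x : ℝ × ℝ) (f g : ℝ → ℝ) : Prop :=
  IsSmoothOddAtZero f x.1 ∧ IsSmoothOddAtZero g x.2

/-- `(f,g)` has end data `e = (G∞, lam)`: `g → G∞` and
`f = exp((ℓ⁻¹ - G∞) t) (lam t^(-5/2) + O(t^(-7/2)))` as `t → ∞`. -/
def HasEndData (ℓ : ℝ) (e : ℝ × ℝ) (f g : ℝ → ℝ) : Prop :=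
  Tendsto g atTop (𝓝 e.1) ∧
  (fun t => f t - Real.exp ((ℓ⁻¹ - e.1) * t) * (e.2 * t ^ (-(5 : ℝ) / 2)))
    =O[atTop] (fun t => Real.exp ((ℓ⁻¹ - e.1) * t) * t ^ (-(7 : ℝ) / 2))

/-- `(f,g)` is an end solution on `(T,∞)` with end data `e = (G∞, lam)`. -/
structure IsEndSolution (p ℓ : ℝ) (a b : ℝ → ℝ) (e : ℝ × ℝ) (T : ℝ) (f g : ℝ → ℝ) : Prop where
  T_nonneg : 0 ≤ T
  solves : SolvesOn p a b (Ioi T) f g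
  endData : HasEndData ℓ e f g

/-- `(f,g)` is a solution on `(0,∞)` that closes smoothly at `t = 0` with initial data `x` and
is an end solution with end data `e`. -/
structure IsCompleteSolution (p ℓ : ℝ) (a b : ℝ → ℝ) (x e : ℝ × ℝ) (f g : ℝ → ℝ) : Prop where
  solves : SolvesOn p a b (Ioi 0) f g
  closes : ClosesSmoothly x f g
  endData : HasEndData ℓ e f g

/-- The initial data of complete bounded solutions whose limit `G∞ = lim g⁺` exceeds `ℓ⁻¹`. -/
def completeInitialData (p ℓ : ℝ) (a b : ℝ → ℝ) : Set (ℝ × ℝ) :=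
  {x | ∃ f g : ℝ → ℝ, SolvesOn p a b (Ioi 0) f g ∧ ClosesSmoothly x f g ∧
    (∃ C, ∀ t, 0 < t → |f t| ≤ C ∧ |g t| ≤ C) ∧
    ∃ G, ℓ⁻¹ < G ∧ Tendsto g atTop (𝓝 G)}

/-- The end data `(G∞, lam)` with `G∞ > ℓ⁻¹` of solutions on `(0,∞)` that close smoothly. -/
def completeEndData (p ℓ : ℝ) (a b : ℝ → ℝ) : Set (ℝ × ℝ) :=
  {e | ℓ⁻¹ < e.1 ∧ ∃ (x : ℝ × ℝ) (f g : ℝ → ℝ), IsCompleteSolution p ℓ a b x e f g}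

end B7

end

/-!
The instanton equations are solved from `t = ∞` towards `t = 0`, in variables in which the end data
are the value at infinity and the initial data are, up to an explicit change of coordinates, the
value at the singular orbit.

**Normalised variables.** The linear parts of the two equations are removed by integrating factors:
`A₃` itself solves `g' + coeffG g = 0`, and there is a solution `φ` of `φ' + coeffF φ = 0` with
`φ ~ e^{t/ℓ} t^{-5/2}`. Let `θ` be the primitive of `A₃ / ℓ` with `θ - t → 0`. With
`g = A₃ h / ℓ` and `f = φ e^{-θ h} κ` the equations become

  `h' = -ω e^{-2 θ h} κ²`,  `κ' = -θ ω e^{-2 θ h} κ³`,  where `ω = ℓ φ² / A₃ ≥ 0`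

(`B7.field`). Hence `h` and `κ²` are nonincreasing, so that a solution with `h → G` has `h ≥ G`
throughout. Since `ω` grows like `e^{2t/ℓ} t^{-5}`, the right-hand side decays exponentially on
`h ≥ m` for every `m > ℓ⁻¹` (`B7.IsIntegratingFactors.exists_weight_le`). So `(h, κ)` has a
limit at infinity, which is exactly the end data `(G, λ)`
(`B7.IsIntegratingFactors.tendsto_stateOf`, `B7.IsIntegratingFactors.hasEndData_of_tendsto`). At
`t = 0` the field is smooth and odd in `t`, so solutions regular at `0` extend to even smooth curves
and the instanton closes smoothly; its initial data are read off from `(h, κ)(0)`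
(`B7.IsIntegratingFactors.closesSmoothly_of_hasDerivWithinAt`).

**The local homeomorphism.** By monotonicity a complete solution keeps `(h, κ)` in a box
`[m, M] × [-M, M]` with `m > ℓ⁻¹`. Clamping the field outside this box makes it globally Lipschitz
with constant `c / (1 + t)³`; after the substitution `s = 1 / (1 + t)` its flow from `t = ∞` to
`t = 0` is the flow of a Lipschitz field on a compact interval, thus a homeomorphism
(`exists_flow_from_infinity`). Grönwall's inequality keeps solutions with nearby end data inside the
box, where they solve the original equations
(`B7.IsIntegratingFactors.exists_openPartialHomeomorph`). Openness of the two sets of data and the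
deformation of the abelian solutions, which are the constant solutions `(h, κ) = (G, 0)`, follow.

**The geometry.** The asymptotics of `φ`, `A₃` and `θ` come from the Hitchin flow. With `p = r₀³` and
`D = √(4a² - (b+p)²)` the conserved Hamiltonian reads `2 a'² b' = (b-p) D`
(`B7.IsB7Member.hamiltonian`), which makes `A₃ = (b-p)/a'` nondecreasing. From `abar > bbar` one
gets `a > b`, and a Wronskian argument gives `(a-b)/(b-p) → ∞` (`B7.IsB7Member.tendsto_ratio`).
Successive differential inequalities then bound `A₃` and yield its convergence, the identification
of the limit with `ℓ`, and `coeffF = -1/ℓ + 5/(2t) + O(t⁻²)`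
(`B7.IsB7Member.exists_asymptotics`, `B7.IsB7Member.coeffF_asymptotics`). Smoothness and parity at
`t = 0` follow from Hadamard's lemma. The outcome is `B7.IsB7Member.exists_integratingFactors`.
-/

/-! ### Flows of time-dependent vector fields decaying at infinity -/

section Flow

variable {E : Type*} [NormedAddCommGroup E] [NormedSpace ℝ E]

/-- Grönwall's estimate for two integral curves of a Lipschitz field on an open interval which
extend continuously to the end points. -/
theorem dist_right_le_of_hasDerivAt_Ioo {v : ℝ → E → E} {K : NNReal} {X Y : ℝ → E} {a b : ℝ}
    (hab : a < b) (hv : ∀ t ∈ Ioo a b, LipschitzWith K (v t))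
    (hX : ContinuousOn X (Icc a b)) (hX' : ∀ t ∈ Ioo a b, HasDerivAt X (v t (X t)) t)
    (hY : ContinuousOn Y (Icc a b)) (hY' : ∀ t ∈ Ioo a b, HasDerivAt Y (v t (Y t)) t) :
    dist (X b) (Y b) ≤ dist (X a) (Y a) * Real.exp (K * (b - a)) := by
  have key : ∀ t ∈ Ioo a b, dist (X b) (Y b) ≤ dist (X t) (Y t) * Real.exp (K * (b - t)) := by
    intro t ht
    have hsub : Icc t b ⊆ Icc a b := Icc_subset_Icc ht.1.le le_rfl
    have hsub' : ∀ s ∈ Ico t b, s ∈ Ioo a b := fun s hs => ⟨ht.1.trans_le hs.1, hs.2⟩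
    exact dist_le_of_trajectories_ODE_of_mem (s := fun _ => univ)
      (fun s hs => (hv s (hsub' s hs)).lipschitzOnWith)
      (hX.mono hsub) (fun s hs => (hX' s (hsub' s hs)).hasDerivWithinAt) (fun _ _ => trivial)
      (hY.mono hsub) (fun s hs => (hY' s (hsub' s hs)).hasDerivWithinAt) (fun _ _ => trivial)
      le_rfl b ⟨ht.2.le, le_rfl⟩
  have hcont : ContinuousOn (fun t => dist (X t) (Y t) * Real.exp (K * (b - t))) (Icc a b) :=
    (continuous_dist.comp_continuousOn (hX.prodMk hY)).mul (by fun_prop)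
  have hlim := (hcont a ⟨le_rfl, hab.le⟩).mono_left (nhdsWithin_mono a Ioo_subset_Icc_self)
  have : (𝓝[Ioo a b] a).NeBot := by
    rw [nhdsWithin_Ioo_eq_nhdsGT hab]; infer_instance
  exact ge_of_tendsto hlim (eventually_of_mem self_mem_nhdsWithin key)

theorem dist_left_le_of_hasDerivAt_Ioo {v : ℝ → E → E} {K : NNReal} {X Y : ℝ → E} {a b : ℝ}
    (hab : a < b) (hv : ∀ t ∈ Ioo a b, LipschitzWith K (v t))
    (hX : ContinuousOn X (Icc a b)) (hX' : ∀ t ∈ Ioo a b, HasDerivAt X (v t (X t)) t)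
    (hY : ContinuousOn Y (Icc a b)) (hY' : ∀ t ∈ Ioo a b, HasDerivAt Y (v t (Y t)) t) :
    dist (X a) (Y a) ≤ dist (X b) (Y b) * Real.exp (K * (b - a)) := by
  have hmem : ∀ t ∈ Ioo (-b) (-a), -t ∈ Ioo a b := fun t ht =>
    ⟨by linarith [ht.2], by linarith [ht.1]⟩
  have hmaps : MapsTo (fun t : ℝ => -t) (Icc (-b) (-a)) (Icc a b) := fun t ht =>
    ⟨by linarith [ht.2], by linarith [ht.1]⟩
  have := dist_right_le_of_hasDerivAt_Ioo (v := fun t x => -v (-t) x) (K := K)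
    (X := fun t => X (-t)) (Y := fun t => Y (-t)) (neg_lt_neg hab)
    (fun t ht => (hv _ (hmem t ht)).neg)
    (hX.comp continuous_neg.continuousOn hmaps)
    (fun t ht => by
      have := (hX' _ (hmem t ht)).scomp t (hasDerivAt_neg t)
      rw [neg_one_smul] at this
      exact this)
    (hY.comp continuous_neg.continuousOn hmaps)
    (fun t ht => by
      have := (hY' _ (hmem t ht)).scomp t (hasDerivAt_neg t)
      rw [neg_one_smul] at this
      exact this)
  simp only [neg_neg] at this
  convert this using 3
  ring

/-- A bounded, globally Lipschitz field on `[0,1]` has integral curves on all of `[0,1]`. -/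
theorem exists_hasDerivWithinAt_Icc_of_lipschitz [CompleteSpace E] {v : ℝ → E → E} {K : NNReal}
    (hc : ∀ x, ContinuousOn (fun t => v t x) (Icc 0 1))
    (hb : ∀ t ∈ Icc (0 : ℝ) 1, ∀ x, ‖v t x‖ ≤ K)
    (hl : ∀ t ∈ Icc (0 : ℝ) 1, LipschitzWith K (v t)) {t₀ : ℝ} (ht₀ : t₀ ∈ Icc (0 : ℝ) 1) (x : E) :
    ∃ X : ℝ → E, X t₀ = x ∧
      ∀ t ∈ Icc (0 : ℝ) 1, HasDerivWithinAt X (v t (X t)) (Icc 0 1) t := by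
  have h : IsPicardLindelof v (⟨t₀, ht₀⟩ : Icc (0 : ℝ) 1) x K 0 K K :=
    { lipschitzOnWith := fun t ht => (hl t ht).lipschitzOnWith
      continuousOn := fun x _ => hc x
      norm_le := fun t ht x _ => hb t ht x
      mul_max_le := by
        have : max (1 - t₀) (t₀ - 0) ≤ 1 := max_le (by linarith [ht₀.1]) (by linarith [ht₀.2])
        simpa using mul_le_mul_of_nonneg_left this K.2 }
  exact h.exists_eq_forall_mem_Icc_hasDerivWithinAt₀

/-- A vector field `V` on `[0,∞) × E` which is bounded and Lipschitz with constants
`c / (1 + t)³` has a flow from `t = ∞` to `t = 0`: every `e : E` is the limit at infinity of exactly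
one integral curve, and its value at `0` depends on `e` by a homeomorphism. In the time variable
`s = 1 / (1 + t)` the field is bounded and Lipschitz on `[0,1]`, so that this is the flow between
the times `0` and `1`. -/
theorem exists_flow_from_infinity [CompleteSpace E] {V : ℝ → E → E} {c : NNReal}
    (hcont : ∀ x, ContinuousOn (fun t => V t x) (Ici 0))
    (hb : ∀ t, 0 ≤ t → ∀ x, ‖V t x‖ ≤ c / (1 + t) ^ 3)
    (hl : ∀ t, 0 ≤ t → ∀ x y, ‖V t x - V t y‖ ≤ c / (1 + t) ^ 3 * ‖x - y‖) :
    ∃ (Ψ : E ≃ₜ E) (X : E → ℝ → E), (∀ e, X e 0 = Ψ e) ∧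
      (∀ e t, 0 ≤ t → HasDerivWithinAt (X e) (V t (X e t)) (Ici 0) t) ∧
      (∀ e, Tendsto (X e) atTop (𝓝 e)) ∧
      (∀ e e' t, 0 ≤ t → dist (X e t) (X e' t) ≤ dist e e' * Real.exp c) ∧
      ∀ S, 0 ≤ S → ∀ (e : E) (Y : ℝ → E), (∀ t, S < t → HasDerivAt Y (V t (Y t)) t) →
        Tendsto Y atTop (𝓝 e) → EqOn Y (X e) (Ioi S) := by
  -- the field in the time variable `s`, with the value `0` at `s = 0` since `0⁻¹ = 0`
  set U : ℝ → E → E := fun s x => -(s⁻¹ ^ 2 • V (s⁻¹ - 1) x) with hU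
  have ht : ∀ s ∈ Ioc (0 : ℝ) 1, 0 ≤ s⁻¹ - 1 := fun s hs => by
    have := (one_le_inv₀ hs.1).2 hs.2
    linarith
  have hUb : ∀ s ∈ Icc (0 : ℝ) 1, ∀ x, ‖U s x‖ ≤ c * s := by
    intro s hs x
    rcases hs.1.eq_or_lt with rfl | h0
    · simp [hU]
    · have h := hb _ (ht s ⟨h0, hs.2⟩) x
      rw [hU, norm_neg, norm_smul, Real.norm_of_nonneg (by positivity)]
      calc _ ≤ s⁻¹ ^ 2 * (c / (1 + (s⁻¹ - 1)) ^ 3) := by gcongr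
        _ = c * s := by field_simp; ring
  have hUl : ∀ s ∈ Icc (0 : ℝ) 1, LipschitzWith c (U s) := by
    intro s hs
    refine LipschitzWith.of_dist_le_mul fun x y => ?_
    rw [dist_eq_norm, dist_eq_norm]
    rcases hs.1.eq_or_lt with rfl | h0
    · simp [hU]; positivity
    · have h := hl _ (ht s ⟨h0, hs.2⟩) x y
      have : U s x - U s y = -(s⁻¹ ^ 2 • (V (s⁻¹ - 1) x - V (s⁻¹ - 1) y)) := by
        simp only [hU, smul_sub]; abel
      rw [this, norm_neg, norm_smul, Real.norm_of_nonneg (by positivity)]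
      calc _ ≤ s⁻¹ ^ 2 * (c / (1 + (s⁻¹ - 1)) ^ 3 * ‖x - y‖) := by gcongr
        _ = (c * ‖x - y‖) * s := by field_simp; ring
        _ ≤ (c * ‖x - y‖) * 1 := by gcongr; exact hs.2
        _ = _ := by ring
  have hUb' : ∀ s ∈ Icc (0 : ℝ) 1, ∀ x, ‖U s x‖ ≤ c := fun s hs x =>
    (hUb s hs x).trans (by nlinarith [hs.2, c.2, NNReal.coe_nonneg c])
  have hUc : ∀ x, ContinuousOn (fun s => U s x) (Icc 0 1) := by
    intro x s hs
    rcases hs.1.eq_or_lt with rfl | h0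
    · have h0 : U 0 x = 0 := by simp [hU]
      rw [ContinuousWithinAt, h0]
      refine squeeze_zero_norm' (eventually_of_mem self_mem_nhdsWithin fun s hs => hUb s hs x) ?_
      have : Tendsto (fun s : ℝ => (c : ℝ) * s) (𝓝 0) (𝓝 (c * 0)) := by
        exact (continuous_const.mul continuous_id).tendsto 0
      rw [mul_zero] at this
      exact this.mono_left nhdsWithin_le_nhds
    · have hc1 : ContinuousAt (fun s : ℝ => s⁻¹ - 1) s := by fun_prop (disch := exact h0.ne')
      have hc2 : ContinuousWithinAt (fun s : ℝ => V (s⁻¹ - 1) x) (Ioc 0 1) s :=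
        ContinuousWithinAt.comp (g := fun t => V t x) (f := fun s : ℝ => s⁻¹ - 1)
          (hcont x _ (ht s ⟨h0, hs.2⟩)) hc1.continuousWithinAt (fun s hs => ht s hs)
      have hc3 : ContinuousWithinAt (fun s => U s x) (Ioc 0 1) s := by
        refine ContinuousWithinAt.neg (ContinuousWithinAt.smul ?_ hc2)
        exact ContinuousAt.continuousWithinAt (by fun_prop (disch := exact h0.ne'))
      refine hc3.mono_of_mem_nhdsWithin ?_
      have := inter_mem_nhdsWithin (Icc (0 : ℝ) 1) (Ioi_mem_nhds h0)
      exact mem_of_superset this fun r hr => ⟨hr.2, hr.1.2⟩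
  have hint : ∀ {Z : ℝ → E}, (∀ s ∈ Icc (0 : ℝ) 1, HasDerivWithinAt Z (U s (Z s)) (Icc 0 1) s) →
      ContinuousOn Z (Icc 0 1) ∧ ∀ s ∈ Ioo (0 : ℝ) 1, HasDerivAt Z (U s (Z s)) s := fun h =>
    ⟨fun s hs => (h s hs).continuousWithinAt, fun s hs =>
      (h s (Ioo_subset_Icc_self hs)).hasDerivAt (Icc_mem_nhds hs.1 hs.2)⟩
  -- `Z e` starts at `e` at infinity, `B e` ends at `e` at `t = 0`
  choose Z hZ0 hZ' using fun e : E => exists_hasDerivWithinAt_Icc_of_lipschitz hUc hUb' hUl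
    (left_mem_Icc.2 zero_le_one) e
  choose B hB1 hB' using fun e : E => exists_hasDerivWithinAt_Icc_of_lipschitz hUc hUb' hUl
    (right_mem_Icc.2 zero_le_one) e
  have hUl' : ∀ s ∈ Ioo (0 : ℝ) 1, LipschitzWith c (U s) := fun s hs =>
    hUl s (Ioo_subset_Icc_self hs)
  have hfwd : ∀ {P Q : ℝ → E},
      (∀ s ∈ Icc (0 : ℝ) 1, HasDerivWithinAt P (U s (P s)) (Icc 0 1) s) →
      (∀ s ∈ Icc (0 : ℝ) 1, HasDerivWithinAt Q (U s (Q s)) (Icc 0 1) s) →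
      ∀ s ∈ Icc (0 : ℝ) 1, dist (P s) (Q s) ≤ dist (P 0) (Q 0) * Real.exp c := by
    intro P Q hP hQ s hs
    rcases hs.1.eq_or_lt with rfl | h0
    · exact le_mul_of_one_le_right dist_nonneg (Real.one_le_exp c.2)
    · have hs' : Icc 0 s ⊆ Icc (0 : ℝ) 1 := Icc_subset_Icc le_rfl hs.2
      have hs'' : Ioo 0 s ⊆ Ioo (0 : ℝ) 1 := Ioo_subset_Ioo le_rfl hs.2
      refine (dist_right_le_of_hasDerivAt_Ioo h0 (fun r hr => hUl' r (hs'' hr))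
        ((hint hP).1.mono hs') (fun r hr => (hint hP).2 r (hs'' hr))
        ((hint hQ).1.mono hs') (fun r hr => (hint hQ).2 r (hs'' hr))).trans ?_
      gcongr
      nlinarith [hs.2, NNReal.coe_nonneg c]
  have hbwd : ∀ {P Q : ℝ → E},
      (∀ s ∈ Icc (0 : ℝ) 1, HasDerivWithinAt P (U s (P s)) (Icc 0 1) s) →
      (∀ s ∈ Icc (0 : ℝ) 1, HasDerivWithinAt Q (U s (Q s)) (Icc 0 1) s) →
      dist (P 0) (Q 0) ≤ dist (P 1) (Q 1) * Real.exp c := by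
    intro P Q hP hQ
    have := dist_left_le_of_hasDerivAt_Ioo zero_lt_one hUl' (hint hP).1 (hint hP).2
      (hint hQ).1 (hint hQ).2
    simpa using this
  have hLip1 : LipschitzWith (Real.toNNReal (Real.exp c)) fun e => Z e 1 :=
    LipschitzWith.of_dist_le_mul fun e e' => by
      rw [Real.coe_toNNReal _ (Real.exp_pos _).le, mul_comm]
      simpa only [hZ0] using hfwd (hZ' e) (hZ' e') 1 (right_mem_Icc.2 zero_le_one)
  have hLip2 : LipschitzWith (Real.toNNReal (Real.exp c)) fun e => B e 0 :=
    LipschitzWith.of_dist_le_mul fun e e' => by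
      rw [Real.coe_toNNReal _ (Real.exp_pos _).le, mul_comm]
      simpa only [hB1] using hbwd (hB' e) (hB' e')
  let Ψ : E ≃ₜ E :=
    { toFun := fun e => Z e 1
      invFun := fun e => B e 0
      left_inv := fun e => by
        have := hbwd (hB' (Z e 1)) (hZ' e)
        rw [hB1, dist_self, zero_mul, hZ0] at this
        exact dist_le_zero.1 this
      right_inv := fun e => by
        have := hfwd (hZ' (B e 0)) (hB' e) 1 (right_mem_Icc.2 zero_le_one)
        rw [hZ0, dist_self, zero_mul, hB1] at this
        exact dist_le_zero.1 this
      continuous_toFun := hLip1.continuous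
      continuous_invFun := hLip2.continuous }
  have hsm : ∀ t : ℝ, 0 ≤ t → (1 + t)⁻¹ ∈ Icc (0 : ℝ) 1 := fun t ht =>
    ⟨by positivity, inv_le_one_of_one_le₀ (by linarith)⟩
  have hs0 : Tendsto (fun t : ℝ => (1 + t)⁻¹) atTop (𝓝[>] 0) :=
    tendsto_inv_atTop_nhdsGT_zero.comp (tendsto_atTop_add_const_left _ _ tendsto_id)
  refine ⟨Ψ, fun e t => Z e (1 + t)⁻¹, fun e => by simp [Ψ], fun e t ht0 => ?_, fun e => ?_,
    fun e e' t ht0 => ?_, ?_⟩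
  · have h1 := hZ' e _ (hsm t ht0)
    have hne : 1 + t ≠ 0 := by positivity
    have h2 : HasDerivWithinAt (fun t : ℝ => (1 + t)⁻¹) (-1 / (1 + t) ^ 2) (Ici 0) t :=
      (((hasDerivAt_id t).const_add 1).fun_inv hne).hasDerivWithinAt
    have h3 := h1.scomp t h2 (fun r hr => hsm r hr)
    refine h3.congr_deriv ?_
    simp only [hU, inv_inv, add_sub_cancel_left, smul_neg, smul_smul]
    rw [neg_div, neg_mul, neg_smul, neg_neg, one_div, inv_mul_cancel₀ (by positivity), one_smul]
  · have h : Tendsto (Z e) (𝓝[>] 0) (𝓝 (Z e 0)) :=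
      ((hint (hZ' e)).1 0 (left_mem_Icc.2 zero_le_one)).mono_left (by
        rw [← nhdsWithin_Ioc_eq_nhdsGT (zero_lt_one' ℝ)]
        exact nhdsWithin_mono _ Ioc_subset_Icc_self)
    rw [hZ0] at h
    exact h.comp hs0
  · simpa only [hZ0] using hfwd (hZ' e) (hZ' e') _ (hsm t ht0)
  · intro S hS e Y hY hYe t ht0
    have htS : S < t := ht0
    set s₁ := (1 + t)⁻¹ with hs₁
    have hs₁0 : 0 < s₁ := by have : 0 < 1 + t := by linarith
                             positivity
    have hYd : ∀ s ∈ Ioc 0 s₁, HasDerivAt (fun s => Y (s⁻¹ - 1)) (U s (Y (s⁻¹ - 1))) s := by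
      intro s hs
      have h1 : S < s⁻¹ - 1 := by
        have : s₁⁻¹ ≤ s⁻¹ := inv_anti₀ hs.1 hs.2
        rw [hs₁, inv_inv] at this
        linarith
      have h2 : HasDerivAt (fun s : ℝ => s⁻¹ - 1) (-(s ^ 2)⁻¹) s :=
        (hasDerivAt_inv hs.1.ne').sub_const 1
      have h3 := (hY _ h1).scomp s h2
      refine h3.congr_deriv ?_
      simp only [hU, inv_pow, neg_smul]
    have hs₁1 : s₁ ≤ 1 := (hsm t (hS.trans htS.le)).2
    -- `Y` need not reach down to `t = 0`, so it is compared with `X e` on `(0, s₁]` only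
    have hdist : ∀ s ∈ Ioo 0 s₁, dist (Y t) (Z e s₁) ≤
        dist (Y (s⁻¹ - 1)) (Z e s) * Real.exp c := by
      intro s hs
      have := dist_right_le_of_hasDerivAt_Ioo (v := U) (K := c) (X := fun s => Y (s⁻¹ - 1))
        (Y := Z e) hs.2 (fun r hr => hUl' r ⟨hs.1.trans hr.1, hr.2.trans_le hs₁1⟩)
        (fun r hr => (hYd r ⟨hs.1.trans_le hr.1, hr.2⟩).continuousAt.continuousWithinAt)
        (fun r hr => hYd r ⟨hs.1.trans hr.1, hr.2.le⟩)
        ((hint (hZ' e)).1.mono (Icc_subset_Icc hs.1.le hs₁1))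
        (fun r hr => (hint (hZ' e)).2 r ⟨hs.1.trans hr.1, hr.2.trans_le hs₁1⟩)
      have e1 : s₁⁻¹ - 1 = t := by rw [hs₁, inv_inv]; ring
      simp only [e1] at this
      refine this.trans ?_
      gcongr
      nlinarith [hs.1, NNReal.coe_nonneg c]
    have hl1 : Tendsto (fun s : ℝ => Y (s⁻¹ - 1)) (𝓝[>] 0) (𝓝 e) :=
      hYe.comp (tendsto_atTop_add_const_right _ _ tendsto_inv_nhdsGT_zero)
    have hl2 : Tendsto (Z e) (𝓝[>] 0) (𝓝 (Z e 0)) :=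
      ((hint (hZ' e)).1 0 (left_mem_Icc.2 zero_le_one)).mono_left (by
        rw [← nhdsWithin_Ioc_eq_nhdsGT (zero_lt_one' ℝ)]
        exact nhdsWithin_mono _ Ioc_subset_Icc_self)
    rw [hZ0] at hl2
    have hl3 := (hl1.dist hl2).mul_const (Real.exp c)
    rw [dist_self, zero_mul] at hl3
    have := ge_of_tendsto hl3 (eventually_of_mem (Ioo_mem_nhdsGT hs₁0) hdist)
    exact dist_le_zero.1 this

end Flow

/-! ### Calculus of smooth functions on the line -/

section Calculus

theorem hasDerivAt_integral_pow_mul_comp_mul {f f' : ℝ → ℝ} (hf : ∀ x, HasDerivAt f (f' x) x)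
    (hf' : Continuous f') (k : ℕ) (t : ℝ) :
    HasDerivAt (fun t => ∫ s in (0 : ℝ)..1, s ^ k * f (s * t))
      (∫ s in (0 : ℝ)..1, s ^ (k + 1) * f' (s * t)) t := by
  have hfc : Continuous f := continuous_iff_continuousAt.2 fun x => (hf x).continuousAt
  obtain ⟨C, hC⟩ := ((isCompact_Icc (a := (0 : ℝ)) (b := 1)).prod
    (isCompact_closedBall t 1)).exists_bound_of_continuousOn
    (f := fun q : ℝ × ℝ => q.1 ^ (k + 1) * f' (q.1 * q.2))
    (Continuous.continuousOn (by fun_prop))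
  refine (intervalIntegral.hasDerivAt_integral_of_dominated_loc_of_deriv_le
    (F := fun t s => s ^ k * f (s * t)) (F' := fun t s => s ^ (k + 1) * f' (s * t))
    (bound := fun _ => C) (s := Metric.closedBall t 1)
    (Metric.closedBall_mem_nhds t one_pos) (Eventually.of_forall fun x => ?_) ?_ ?_ ?_ ?_ ?_).2
  · exact Continuous.aestronglyMeasurable (by fun_prop)
  · exact Continuous.intervalIntegrable (by fun_prop) _ _
  · exact Continuous.aestronglyMeasurable (by fun_prop)
  · refine Eventually.of_forall fun s hs x hx => hC (s, x) ⟨?_, hx⟩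
    rw [uIoc_of_le zero_le_one] at hs
    exact Ioc_subset_Icc_self hs
  · exact intervalIntegrable_const
  · refine Eventually.of_forall fun s _ x _ => ?_
    have h1 : HasDerivAt (fun x => s * x) s x := by simpa using (hasDerivAt_id x).const_mul s
    have h2 := ((hf (s * x)).comp x h1).const_mul (s ^ k)
    refine h2.congr_deriv ?_
    ring

theorem contDiff_integral_pow_mul_comp_mul (n : ℕ) :
    ∀ {f : ℝ → ℝ}, ContDiff ℝ ∞ f → ∀ k : ℕ,
      ContDiff ℝ n (fun t => ∫ s in (0 : ℝ)..1, s ^ k * f (s * t)) := by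
  have hd : ∀ {f : ℝ → ℝ}, ContDiff ℝ ∞ f → ∀ (k : ℕ) (t : ℝ),
      HasDerivAt (fun t => ∫ s in (0 : ℝ)..1, s ^ k * f (s * t))
        (∫ s in (0 : ℝ)..1, s ^ (k + 1) * deriv f (s * t)) t := fun hf k t =>
    hasDerivAt_integral_pow_mul_comp_mul
      (fun x => (hf.differentiable (by simp) x).hasDerivAt)
      (hf.continuous_deriv (by simp)) k t
  induction n with
  | zero =>
    intro f hf k
    exact contDiff_zero.2 (continuous_iff_continuousAt.2 fun t => (hd hf k t).continuousAt)
  | succ n ih =>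
    intro f hf k
    push_cast
    refine contDiff_succ_iff_deriv.2 ⟨fun t => (hd hf k t).differentiableAt, by simp, ?_⟩
    rw [show deriv (fun t => ∫ s in (0 : ℝ)..1, s ^ k * f (s * t)) = _ from
      funext fun t => (hd hf k t).deriv]
    exact ih (contDiff_infty_iff_deriv.1 hf).2 (k + 1)

/-- Hadamard's lemma on the line: a smooth function vanishing at `0` is divisible by `t`. -/
theorem ContDiff.exists_eq_mul_of_apply_zero {f : ℝ → ℝ} (hf : ContDiff ℝ ∞ f) (h0 : f 0 = 0) :
    ∃ g : ℝ → ℝ, ContDiff ℝ ∞ g ∧ ∀ t, f t = t * g t := by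
  have hf' := (contDiff_infty_iff_deriv.1 hf).2
  refine ⟨fun t => ∫ s in (0 : ℝ)..1, s ^ 0 * deriv f (s * t),
    contDiff_infty.2 fun n => contDiff_integral_pow_mul_comp_mul n hf' 0, fun t => ?_⟩
  have h : ∀ s ∈ uIcc (0 : ℝ) 1,
      HasDerivAt (fun s => f (s * t)) (t * (s ^ 0 * deriv f (s * t))) s := by
    intro s _
    have h1 : HasDerivAt (fun s => s * t) t s := by simpa using (hasDerivAt_id s).mul_const t
    refine (((hf.differentiable (by simp) (s * t)).hasDerivAt).comp s h1).congr_deriv ?_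
    ring
  have hc : Continuous (deriv f) := hf'.continuous
  have := intervalIntegral.integral_eq_sub_of_hasDerivAt h
    (Continuous.intervalIntegrable (by fun_prop) _ _)
  rw [intervalIntegral.integral_const_mul] at this
  simp [h0] at this
  simpa using this.symm

/-- The division in `ContDiff.exists_eq_mul_of_apply_zero` exchanges even and odd functions. -/
theorem Function.Even.odd_of_eq_mul {f g : ℝ → ℝ} (hf : Function.Even f)
    (hg : Continuous g) (h : ∀ t, f t = t * g t) : Function.Odd g := by
  have hne : ∀ t, t ≠ 0 → g (-t) = -g t := by
    intro t ht
    have h1 := hf t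
    rw [h, h] at h1
    apply mul_left_cancel₀ ht
    linarith
  intro t
  rcases eq_or_ne t 0 with rfl | ht
  · have h1 : Tendsto (fun t => g (-t)) (𝓝[≠] 0) (𝓝 (g (-0))) :=
      (hg.comp continuous_neg).continuousAt.tendsto.mono_left nhdsWithin_le_nhds
    have h2 : Tendsto (fun t => -g t) (𝓝[≠] 0) (𝓝 (-g 0)) :=
      hg.neg.continuousAt.tendsto.mono_left nhdsWithin_le_nhds
    exact tendsto_nhds_unique (l := 𝓝[≠] (0 : ℝ))
      (h1.congr' (eventually_of_mem self_mem_nhdsWithin hne)) h2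
  · exact hne t ht

theorem Function.Odd.even_of_eq_mul {f g : ℝ → ℝ} (hf : Function.Odd f)
    (h : ∀ t, f t = t * g t) : Function.Even g := by
  intro t
  rcases eq_or_ne t 0 with rfl | ht
  · simp
  · have h1 := hf t
    rw [h, h] at h1
    apply mul_left_cancel₀ ht
    linarith

theorem Function.Even.odd_deriv {f : ℝ → ℝ} (hf : Function.Even f) : Function.Odd (deriv f) := by
  intro t
  have : (fun s => f (-s)) = f := funext hf
  have h := deriv_comp_neg f t
  rw [this] at h
  linarith

theorem Function.Odd.even_integral {f : ℝ → ℝ} (hf : Function.Odd f) :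
    Function.Even fun t => ∫ s in (0 : ℝ)..t, f s := by
  intro t
  have h := intervalIntegral.integral_comp_neg (f := f) (a := 0) (b := t)
  simp only [hf _, neg_zero, intervalIntegral.integral_neg] at h
  have h' := intervalIntegral.integral_symm (f := f) (μ := MeasureTheory.volume) (-t) 0
  simp only
  linarith

theorem ContDiff.contDiff_integral {f : ℝ → ℝ} (hf : ContDiff ℝ ∞ f) :
    ContDiff ℝ ∞ fun t => ∫ s in (0 : ℝ)..t, f s := by
  have hd : ∀ t, HasDerivAt (fun t => ∫ s in (0 : ℝ)..t, f s) (f t) t := fun t =>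
    intervalIntegral.integral_hasDerivAt_right (hf.continuous.intervalIntegrable _ _)
      (hf.continuous.stronglyMeasurableAtFilter _ _) hf.continuous.continuousAt
  refine contDiff_infty_iff_deriv.2 ⟨fun t => (hd t).differentiableAt, ?_⟩
  rwa [show deriv (fun t => ∫ s in (0 : ℝ)..t, f s) = f from funext fun t => (hd t).deriv]

variable {E : Type*} [NormedAddCommGroup E] [NormedSpace ℝ E]

/-- Integral curves of smooth time-dependent vector fields are smooth. -/
theorem contDiff_of_hasDerivAt {V : ℝ → E → E} (hV : ContDiff ℝ ∞ (Function.uncurry V))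
    {X : ℝ → E} (hX : ∀ t, HasDerivAt X (V t (X t)) t) : ContDiff ℝ ∞ X := by
  refine contDiff_infty.2 fun n => ?_
  induction n with
  | zero => exact contDiff_zero.2 (continuous_iff_continuousAt.2 fun t => (hX t).continuousAt)
  | succ n ih =>
    push_cast
    refine contDiff_succ_iff_deriv.2 ⟨fun t => (hX t).differentiableAt, by simp, ?_⟩
    rw [show deriv X = fun t => Function.uncurry V (t, X t) from funext fun t => (hX t).deriv]
    exact (hV.of_le (by exact_mod_cast le_top)).comp (contDiff_id.prodMk ih)

/-- If the smooth field `V t x` is odd in `t`, then its integral curves on `[0,∞)` are restrictions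
of smooth even curves: the reflected curve is again an integral curve. -/
theorem contDiff_comp_abs_of_hasDerivWithinAt {V : ℝ → E → E}
    (hV : ContDiff ℝ ∞ (Function.uncurry V)) (hodd : ∀ t x, V (-t) x = -V t x) {X : ℝ → E}
    (hX : ∀ t, 0 ≤ t → HasDerivWithinAt X (V t (X t)) (Ici 0) t) :
    ContDiff ℝ ∞ fun t => X |t| := by
  have hpos : ∀ t, 0 < t → HasDerivAt X (V t (X t)) t := fun t ht =>
    (hX t ht.le).hasDerivAt (Ici_mem_nhds ht)
  refine contDiff_of_hasDerivAt hV fun t => ?_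
  rcases lt_trichotomy t 0 with ht | rfl | ht
  · rw [abs_of_neg ht]
    have h := (hpos (-t) (by linarith)).scomp t (hasDerivAt_neg t)
    rw [neg_one_smul, hodd, neg_neg] at h
    refine h.congr_of_eventuallyEq ?_
    filter_upwards [Iio_mem_nhds ht] with s hs
    rw [abs_of_neg hs]; rfl
  · have h0 : V 0 (X 0) = 0 := by
      have := hodd 0 (X 0)
      rw [neg_zero] at this
      have h2 : (2 : ℝ) • V 0 (X 0) = 0 := by
        rw [two_smul]; nth_rewrite 1 [this]; exact neg_add_cancel _
      exact (smul_eq_zero.1 h2).resolve_left two_ne_zero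
    have h := hX 0 le_rfl
    rw [h0] at h
    rw [abs_zero, h0, ← hasDerivWithinAt_univ, ← Ici_union_Iic (a := (0 : ℝ))]
    refine HasDerivWithinAt.union (h.congr_of_mem (fun s hs => by rw [abs_of_nonneg hs])
      self_mem_Ici) ?_
    have h' : HasDerivWithinAt (X ∘ fun s : ℝ => -s) ((-1 : ℝ) • (0 : E)) (Iic 0) 0 :=
      HasDerivWithinAt.scomp 0 (t' := Ici 0) (by simpa using h)
        (hasDerivAt_neg (0 : ℝ)).hasDerivWithinAt (fun s hs => by simpa using hs)
    rw [smul_zero] at h'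
    exact h'.congr_of_mem (fun s hs => by rw [abs_of_nonpos hs]; rfl) self_mem_Iic
  · rw [abs_of_pos ht]
    refine (hpos t ht).congr_of_eventuallyEq ?_
    filter_upwards [Ioi_mem_nhds ht] with s hs
    rw [abs_of_pos hs]

/-- A function whose derivative is `O(t^{-(n+1)})` converges at infinity with rate `O(t^{-n})`. -/
theorem exists_sub_isBigO_of_hasDerivAt_isBigO {n : ℕ} (hn : n ≠ 0) {r r' : ℝ → ℝ}
    (h : ∀ᶠ t in atTop, HasDerivAt r (r' t) t)
    (hO : r' =O[atTop] fun t : ℝ => (t ^ (n + 1))⁻¹) :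
    ∃ L, (fun t => r t - L) =O[atTop] fun t : ℝ => (t ^ n)⁻¹ := by
  obtain ⟨C, hC0, hC⟩ := hO.exists_pos
  obtain ⟨T, hT⟩ := eventually_atTop.1 ((h.and hC.bound).and (eventually_ge_atTop 1))
  have hpos : ∀ t, T ≤ t → 0 < t := fun t ht => zero_lt_one.trans_le (hT t ht).2
  have hpow : ∀ t, T ≤ t → HasDerivAt (fun t : ℝ => C * (t ^ n)⁻¹)
      (-(n * C * (t ^ (n + 1))⁻¹)) t := by
    intro t ht
    have h0 := (hpos t ht).ne'
    refine (((hasDerivAt_pow n t).inv (pow_ne_zero _ h0)).const_mul C).congr_deriv ?_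
    obtain ⟨m, rfl⟩ := Nat.exists_eq_succ_of_ne_zero hn
    simp only [Nat.succ_eq_add_one, Nat.add_sub_cancel]
    field_simp
    ring
  have hbd : ∀ t, T ≤ t → |r' t| ≤ C * (t ^ (n + 1))⁻¹ := by
    intro t ht
    have h1 := (hT t ht).1.2
    have := hpos t ht
    rwa [Real.norm_eq_abs, Real.norm_of_nonneg (by positivity)] at h1
  have hn1 : (1 : ℝ) ≤ n := by exact_mod_cast Nat.one_le_iff_ne_zero.2 hn
  have hCn : ∀ t, T ≤ t → C * (t ^ (n + 1))⁻¹ ≤ n * C * (t ^ (n + 1))⁻¹ := by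
    intro t ht
    have := hpos t ht
    gcongr
    nlinarith
  have hp : AntitoneOn (fun t => r t + C * (t ^ n)⁻¹) (Ici T) := by
    refine antitoneOn_of_hasDerivWithinAt_nonpos (convex_Ici T)
      (f' := fun t => r' t + -(n * C * (t ^ (n + 1))⁻¹)) (fun t ht =>
      (((hT t ht).1.1).add (hpow t ht)).continuousAt.continuousWithinAt)
      (fun t ht => ((hT t (interior_subset ht)).1.1.add
        (hpow t (interior_subset ht))).hasDerivWithinAt) (fun t ht => ?_)
    have h1 := abs_le.1 (hbd t (interior_subset ht))
    have h2 := hCn t (interior_subset ht)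
    linarith [h1.2]
  have hq : MonotoneOn (fun t => r t - C * (t ^ n)⁻¹) (Ici T) := by
    refine monotoneOn_of_hasDerivWithinAt_nonneg (convex_Ici T)
      (f' := fun t => r' t - -(n * C * (t ^ (n + 1))⁻¹)) (fun t ht =>
      (((hT t ht).1.1).sub (hpow t ht)).continuousAt.continuousWithinAt)
      (fun t ht => ((hT t (interior_subset ht)).1.1.sub
        (hpow t (interior_subset ht))).hasDerivWithinAt) (fun t ht => ?_)
    have h1 := abs_le.1 (hbd t (interior_subset ht))
    have h2 := hCn t (interior_subset ht)
    linarith [h1.1]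
  have hqp : ∀ t, T ≤ t → ∀ s, T ≤ s → r t - C * (t ^ n)⁻¹ ≤ r s + C * (s ^ n)⁻¹ := by
    intro t ht s hs
    have hm : T ≤ max t s := ht.trans (le_max_left _ _)
    have h1 := hq ht hm (le_max_left _ _)
    have h2 := hp hs hm (le_max_right _ _)
    have h3 : 0 ≤ C * (max t s ^ n)⁻¹ := by have := hpos _ hm; positivity
    simp only at h1 h2
    linarith
  set L := sSup ((fun t => r t - C * (t ^ n)⁻¹) '' Ici T) with hL
  have hne : ((fun t => r t - C * (t ^ n)⁻¹) '' Ici T).Nonempty := ⟨_, T, self_mem_Ici, rfl⟩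
  refine ⟨L, IsBigO.of_bound C ?_⟩
  filter_upwards [eventually_ge_atTop T] with t ht
  have h1 : r t - C * (t ^ n)⁻¹ ≤ L :=
    le_csSup ⟨_, by rintro _ ⟨s, hs, rfl⟩; exact hqp s hs T le_rfl⟩ ⟨t, ht, rfl⟩
  have h2 : L ≤ r t + C * (t ^ n)⁻¹ :=
    csSup_le hne (by rintro _ ⟨s, hs, rfl⟩; exact hqp s hs t ht)
  have h3 := hpos t ht
  rw [Real.norm_eq_abs, Real.norm_of_nonneg (by positivity), abs_le]
  constructor <;> linarith

end Calculus

/-! ### First integrals and monotonicity of the Hitchin flow -/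

namespace B7

theorem hitchinF_neg_right (p x y : ℝ) :
    hitchinF p (-p) x y = (y - p) ^ 2 * (4 * x ^ 2 - (y + p) ^ 2) := by
  unfold hitchinF; ring

theorem deriv_hitchinF_left (p x y : ℝ) :
    deriv (fun z => hitchinF p (-p) z y) x = 8 * x * (y - p) ^ 2 := by
  have h : HasDerivAt (fun z => hitchinF p (-p) z y)
      ((y - p) ^ 2 * (4 * ((2 : ℕ) * x ^ (2 - 1)))) x := by
    simp only [hitchinF_neg_right]
    exact (((hasDerivAt_pow 2 x).const_mul 4).sub_const _).const_mul _
  rw [h.deriv]; push_cast; ring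

theorem deriv_hitchinF_right (p x y : ℝ) :
    deriv (fun z => hitchinF p (-p) x z) y =
      2 * (y - p) * (4 * x ^ 2 - (y + p) ^ 2) - 2 * (y - p) ^ 2 * (y + p) := by
  have h1 : HasDerivAt (fun z : ℝ => (z - p) ^ 2) (2 * (y - p)) y := by
    refine (((hasDerivAt_id y).sub_const p).fun_pow 2).congr_deriv ?_
    simp
  have h2 : HasDerivAt (fun z : ℝ => 4 * x ^ 2 - (z + p) ^ 2) (-(2 * (y + p))) y := by
    refine ((((hasDerivAt_id y).add_const p).fun_pow 2).const_sub (4 * x ^ 2)).congr_deriv ?_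
    simp
  simp only [hitchinF_neg_right]
  rw [(h1.fun_mul h2).deriv]
  ring

/-- The factor `√(4a² - (b+p)²)` in `√F = (b-p) √(4a² - (b+p)²)`. -/
noncomputable def rootF (p : ℝ) (a b : ℝ → ℝ) (t : ℝ) : ℝ := √(4 * a t ^ 2 - (b t + p) ^ 2)

/-- A smooth even function without constant term is `t²` times a smooth even function. -/
theorem exists_eq_sq_mul {g : ℝ → ℝ} (hg : ContDiff ℝ ∞ g) (he : Function.Even g) {c d : ℝ}
    (hO : (fun t => g t - (c * t ^ 2 + d * t ^ 4)) =O[𝓝 0] fun t : ℝ => t ^ 6) :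
    ∃ g₁ : ℝ → ℝ, ContDiff ℝ ∞ g₁ ∧ Function.Even g₁ ∧ (∀ t, g t = t ^ 2 * g₁ t) ∧ g₁ 0 = c := by
  obtain ⟨C, hC⟩ := hO.bound
  have h0 : g 0 = 0 := by
    have := hC.self_of_nhds
    simpa using this
  obtain ⟨h, hh, hgh⟩ := hg.exists_eq_mul_of_apply_zero h0
  have hodd : Function.Odd h := he.odd_of_eq_mul hh.continuous hgh
  obtain ⟨g₁, hg₁, hhg⟩ := hh.exists_eq_mul_of_apply_zero hodd.map_zero
  have hsq : ∀ t, g t = t ^ 2 * g₁ t := fun t => by rw [hgh, hhg]; ring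
  refine ⟨g₁, hg₁, hodd.even_of_eq_mul hhg, hsq, ?_⟩
  have h1 : Tendsto (fun t => g₁ t - c) (𝓝[≠] 0) (𝓝 (g₁ 0 - c)) :=
    (hg₁.continuous.sub continuous_const).continuousAt.tendsto.mono_left nhdsWithin_le_nhds
  have h2 : Tendsto (fun t : ℝ => |d| * t ^ 2 + C * t ^ 4) (𝓝[≠] 0) (𝓝 0) := by
    have : Tendsto (fun t : ℝ => |d| * t ^ 2 + C * t ^ 4) (𝓝 0) (𝓝 (|d| * 0 ^ 2 + C * 0 ^ 4)) :=
      Continuous.tendsto (by fun_prop) 0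
    simp only [ne_eq, OfNat.ofNat_ne_zero, not_false_eq_true, zero_pow, mul_zero, add_zero] at this
    exact this.mono_left nhdsWithin_le_nhds
  have h3 : Tendsto (fun t => g₁ t - c) (𝓝[≠] 0) (𝓝 0) := by
    refine squeeze_zero_norm' ?_ h2
    filter_upwards [nhdsWithin_le_nhds hC, self_mem_nhdsWithin] with t ht ht0
    have ht0 : t ≠ 0 := ht0
    have ht2 : 0 < t ^ 2 := by positivity
    rw [hsq, Real.norm_eq_abs, Real.norm_of_nonneg (by positivity)] at ht
    rw [Real.norm_eq_abs]
    have e1 : t ^ 2 * (g₁ t - c) =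
        (t ^ 2 * g₁ t - (c * t ^ 2 + d * t ^ 4)) + d * t ^ 4 := by ring
    have e2 : t ^ 2 * |g₁ t - c| ≤ t ^ 2 * (|d| * t ^ 2 + C * t ^ 4) := by
      rw [← abs_of_pos ht2, ← abs_mul, abs_of_pos ht2, e1]
      refine (abs_add_le _ _).trans ?_
      rw [abs_mul, abs_of_nonneg (show (0 : ℝ) ≤ t ^ 4 by positivity)]
      linarith
    exact le_of_mul_le_mul_left e2 ht2
  have := tendsto_nhds_unique (l := 𝓝[≠] (0 : ℝ)) h1 h3
  linarith

variable {r₀ abar bbar : ℝ} {a b : ℝ → ℝ}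

namespace IsB7Member

theorem p_pos (hM : IsB7Member r₀ abar bbar a b) : 0 < r₀ ^ 3 := pow_pos hM.r₀_pos 3

theorem hasDerivAt_a (hM : IsB7Member r₀ abar bbar a b) (t : ℝ) : HasDerivAt a (deriv a t) t :=
  (hM.smooth_a.differentiable (by simp) t).hasDerivAt

theorem hasDerivAt_b (hM : IsB7Member r₀ abar bbar a b) (t : ℝ) : HasDerivAt b (deriv b t) t :=
  (hM.smooth_b.differentiable (by simp) t).hasDerivAt

theorem smooth_deriv_a (hM : IsB7Member r₀ abar bbar a b) : ContDiff ℝ ∞ (deriv a) :=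
  (contDiff_infty_iff_deriv.1 hM.smooth_a).2

theorem smooth_deriv_b (hM : IsB7Member r₀ abar bbar a b) : ContDiff ℝ ∞ (deriv b) :=
  (contDiff_infty_iff_deriv.1 hM.smooth_b).2

theorem exists_a_factor (hM : IsB7Member r₀ abar bbar a b) :
    ∃ α : ℝ → ℝ, ContDiff ℝ ∞ α ∧ Function.Even α ∧ (∀ t, a t - r₀ ^ 3 = t ^ 2 * α t) ∧
      α 0 = r₀ / 4 :=
  exists_eq_sq_mul (d := abar) (hM.smooth_a.sub contDiff_const)
    (fun t => by simp only [hM.even_a t]) (hM.expansion_a.congr_left fun t => by ring)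

theorem exists_b_factor (hM : IsB7Member r₀ abar bbar a b) :
    ∃ β : ℝ → ℝ, ContDiff ℝ ∞ β ∧ Function.Even β ∧ (∀ t, b t - r₀ ^ 3 = t ^ 2 * β t) ∧
      β 0 = r₀ / 4 :=
  exists_eq_sq_mul (d := bbar) (hM.smooth_b.sub contDiff_const)
    (fun t => by simp only [hM.even_b t]) (hM.expansion_b.congr_left fun t => by ring)

theorem a_zero (hM : IsB7Member r₀ abar bbar a b) : a 0 = r₀ ^ 3 := by
  obtain ⟨α, -, -, h, -⟩ := hM.exists_a_factor
  have := h 0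
  simp only [ne_eq, OfNat.ofNat_ne_zero, not_false_eq_true, zero_pow, zero_mul] at this
  linarith

theorem b_zero (hM : IsB7Member r₀ abar bbar a b) : b 0 = r₀ ^ 3 := by
  obtain ⟨α, -, -, h, -⟩ := hM.exists_b_factor
  have := h 0
  simp only [ne_eq, OfNat.ofNat_ne_zero, not_false_eq_true, zero_pow, zero_mul] at this
  linarith

theorem deriv_a_zero (hM : IsB7Member r₀ abar bbar a b) : deriv a 0 = 0 :=
  hM.even_a.odd_deriv.map_zero

/-- `b` increases from its value `p` on the singular orbit, because the flow equation for `b` has a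
nonnegative right-hand side and `b - p ~ r₀ t² / 4`. -/
theorem p_lt_b (hM : IsB7Member r₀ abar bbar a b) {t : ℝ} (ht : 0 < t) : r₀ ^ 3 < b t := by
  have hmono : MonotoneOn b (Ici 0) := by
    refine monotoneOn_of_deriv_nonneg (convex_Ici 0) hM.smooth_b.continuous.continuousOn
      (fun s _ => (hM.hasDerivAt_b s).differentiableAt.differentiableWithinAt) fun s hs => ?_
    rw [interior_Ici] at hs
    rw [(hM.flow s hs).y₂_eq.deriv]
    positivity
  obtain ⟨β, hβ, -, hb, h0⟩ := hM.exists_b_factor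
  have hev : ∀ᶠ s in 𝓝[>] 0, r₀ ^ 3 < b s := by
    have h1 : ∀ᶠ s in 𝓝 0, 0 < β s :=
      hβ.continuous.continuousAt.eventually_const_lt (by rw [h0]; have := hM.r₀_pos; positivity)
    filter_upwards [nhdsWithin_le_nhds h1, self_mem_nhdsWithin] with s hs hs0
    have hs0 : 0 < s := hs0
    have := hb s
    have h2 : 0 < s ^ 2 * β s := by positivity
    linarith
  obtain ⟨s, hs, hst⟩ := (hev.and (Ioo_mem_nhdsGT ht)).exists
  exact hs.trans_le (hmono hst.1.le ht.le hst.2.le)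

/-- The condition `F > 0` amounts to `4a² > (b+p)²`. -/
theorem sq_lt (hM : IsB7Member r₀ abar bbar a b) {t : ℝ} (ht : 0 < t) :
    (b t + r₀ ^ 3) ^ 2 < 4 * a t ^ 2 := by
  have h := (hM.flow t ht).F_pos
  rw [hitchinF_neg_right] at h
  have := hM.p_lt_b ht
  have h2 := pos_of_mul_pos_right h (sq_nonneg _)
  linarith

theorem a_pos (hM : IsB7Member r₀ abar bbar a b) {t : ℝ} (ht : 0 < t) : 0 < a t := by
  by_contra hneg
  have hp := hM.p_pos
  obtain ⟨s, hs, hs0⟩ := intermediate_value_Icc' ht.le hM.smooth_a.continuous.continuousOn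
    (show (0 : ℝ) ∈ Icc (a t) (a 0) from ⟨not_lt.1 hneg, by rw [hM.a_zero]; exact hp.le⟩)
  rcases hs.1.eq_or_lt with rfl | h0
  · rw [hM.a_zero] at hs0; linarith
  · have := hM.sq_lt h0
    rw [hs0] at this
    nlinarith [sq_nonneg (b s + r₀ ^ 3)]

theorem b_add_lt (hM : IsB7Member r₀ abar bbar a b) {t : ℝ} (ht : 0 < t) :
    b t + r₀ ^ 3 < 2 * a t := by
  have h1 := hM.sq_lt ht
  have h2 := hM.a_pos ht
  by_contra h
  nlinarith

theorem rootF_pos (hM : IsB7Member r₀ abar bbar a b) {t : ℝ} (ht : 0 < t) :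
    0 < rootF (r₀ ^ 3) a b t := Real.sqrt_pos.2 (by linarith [hM.sq_lt ht])

theorem rootF_sq (hM : IsB7Member r₀ abar bbar a b) {t : ℝ} (ht : 0 < t) :
    rootF (r₀ ^ 3) a b t ^ 2 = 4 * a t ^ 2 - (b t + r₀ ^ 3) ^ 2 :=
  Real.sq_sqrt (by linarith [hM.sq_lt ht])

theorem rootF_lt (hM : IsB7Member r₀ abar bbar a b) {t : ℝ} (ht : 0 < t) :
    rootF (r₀ ^ 3) a b t < 2 * a t := by
  have h1 := hM.rootF_sq ht
  have h2 := hM.a_pos ht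
  have h3 := hM.rootF_pos ht
  have h4 := hM.p_lt_b ht
  have h5 := hM.p_pos
  have h6 : 0 < (b t + r₀ ^ 3) ^ 2 := pow_pos (by linarith) 2
  by_contra h
  nlinarith

theorem sqrt_hitchinF (hM : IsB7Member r₀ abar bbar a b) {t : ℝ} (ht : 0 < t) :
    √(hitchinF (r₀ ^ 3) (-(r₀ ^ 3)) (a t) (b t)) =
      (b t - r₀ ^ 3) * rootF (r₀ ^ 3) a b t := by
  have := hM.p_lt_b ht
  rw [hitchinF_neg_right, Real.sqrt_mul (sq_nonneg _), Real.sqrt_sq (by linarith), rootF]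

theorem hasDerivAt_x₁ (hM : IsB7Member r₀ abar bbar a b) {t : ℝ} (ht : 0 < t) :
    HasDerivAt (fun s => deriv a s * deriv b s)
      (2 * a t * (b t - r₀ ^ 3) / rootF (r₀ ^ 3) a b t) t := by
  refine (hM.flow t ht).x₁_eq.congr_deriv ?_
  have h1 := hM.p_lt_b ht
  have h2 := hM.rootF_pos ht
  have h3 : b t - r₀ ^ 3 ≠ 0 := by linarith
  rw [deriv_hitchinF_left, hM.sqrt_hitchinF ht]
  field_simp
  ring

theorem hasDerivAt_x₂ (hM : IsB7Member r₀ abar bbar a b) {t : ℝ} (ht : 0 < t) :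
    HasDerivAt (fun s => deriv a s ^ 2)
      ((4 * a t ^ 2 - 2 * b t * (b t + r₀ ^ 3)) / rootF (r₀ ^ 3) a b t) t := by
  refine (hM.flow t ht).x₂_eq.congr_deriv ?_
  have h1 := hM.p_lt_b ht
  have h2 := hM.rootF_pos ht
  have h3 : b t - r₀ ^ 3 ≠ 0 := by linarith
  rw [deriv_hitchinF_right, hM.sqrt_hitchinF ht]
  field_simp
  ring

theorem x₁_pos (hM : IsB7Member r₀ abar bbar a b) {t : ℝ} (ht : 0 < t) :
    0 < deriv a t * deriv b t := by
  have hmono : StrictMonoOn (fun s => deriv a s * deriv b s) (Ici 0) := by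
    refine strictMonoOn_of_deriv_pos (convex_Ici 0)
      (hM.smooth_deriv_a.continuous.mul hM.smooth_deriv_b.continuous).continuousOn fun s hs => ?_
    rw [interior_Ici] at hs
    rw [(hM.hasDerivAt_x₁ hs).deriv]
    have h1 := hM.p_lt_b hs
    have h2 := hM.rootF_pos hs
    have h3 := hM.a_pos hs
    have h4 : 0 < b s - r₀ ^ 3 := by linarith
    positivity
  have := hmono self_mem_Ici ht.le ht
  simpa [hM.deriv_a_zero] using this

theorem deriv_b_pos (hM : IsB7Member r₀ abar bbar a b) {t : ℝ} (ht : 0 < t) : 0 < deriv b t := by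
  have h0 : 0 ≤ deriv b t := by
    rw [(hM.flow t ht).y₂_eq.deriv]; positivity
  rcases h0.eq_or_lt with h | h
  · have := hM.x₁_pos ht
    rw [← h, mul_zero] at this
    exact absurd this (lt_irrefl _)
  · exact h

theorem deriv_a_pos (hM : IsB7Member r₀ abar bbar a b) {t : ℝ} (ht : 0 < t) : 0 < deriv a t :=
  pos_of_mul_pos_left (hM.x₁_pos ht) (hM.deriv_b_pos ht).le

theorem hasDerivAt_deriv_a (hM : IsB7Member r₀ abar bbar a b) {t : ℝ} (ht : 0 < t) :
    HasDerivAt (deriv a) ((4 * a t ^ 2 - 2 * b t * (b t + r₀ ^ 3)) /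
      (2 * deriv a t * rootF (r₀ ^ 3) a b t)) t := by
  have h1 : HasDerivAt (deriv a) (deriv (deriv a) t) t :=
    (hM.smooth_deriv_a.differentiable (by simp) t).hasDerivAt
  have h2 := (h1.pow 2).unique (hM.hasDerivAt_x₂ ht)
  refine h1.congr_deriv ?_
  have h3 := hM.deriv_a_pos ht
  have h4 := hM.rootF_pos ht
  have h5 : deriv (deriv a) t = (2 * deriv a t * deriv (deriv a) t) / (2 * deriv a t) := by
    field_simp
  have h6 : 2 * deriv a t * deriv (deriv a) t =
    (4 * a t ^ 2 - 2 * b t * (b t + r₀ ^ 3)) / rootF (r₀ ^ 3) a b t := by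
      rw [← h2]; push_cast; ring
  rw [h5, h6]
  field_simp

theorem hasDerivAt_rootF (hM : IsB7Member r₀ abar bbar a b) {t : ℝ} (ht : 0 < t) :
    HasDerivAt (rootF (r₀ ^ 3) a b)
      ((4 * a t * deriv a t - (b t + r₀ ^ 3) * deriv b t) / rootF (r₀ ^ 3) a b t) t := by
  have h1 : HasDerivAt (fun s => 4 * a s ^ 2 - (b s + r₀ ^ 3) ^ 2)
      (4 * (2 * a t * deriv a t) - 2 * (b t + r₀ ^ 3) * deriv b t) t := by
    refine ((((hM.hasDerivAt_a t).pow 2).const_mul 4).sub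
      (((hM.hasDerivAt_b t).add_const (r₀ ^ 3)).pow 2)).congr_deriv ?_
    push_cast; ring
  have h2 := h1.sqrt (by linarith [hM.sq_lt ht])
  refine h2.congr_deriv ?_
  have h3 := hM.rootF_pos ht
  rw [rootF] at h3 ⊢
  field_simp

/-- Conservation of the Hamiltonian of the Hitchin flow; its value is `0` because it vanishes on
the singular orbit. -/
theorem hamiltonian (hM : IsB7Member r₀ abar bbar a b) {t : ℝ} (ht : 0 < t) :
    2 * deriv a t ^ 2 * deriv b t = (b t - r₀ ^ 3) * rootF (r₀ ^ 3) a b t := by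
  set E : ℝ → ℝ := fun s => 2 * (deriv a s * (deriv a s * deriv b s)) -
    (b s - r₀ ^ 3) * rootF (r₀ ^ 3) a b s with hE
  have hderiv : ∀ s ∈ Ioo 0 t, HasDerivAt E 0 s := by
    intro s hs
    have h := (((hM.hasDerivAt_deriv_a hs.1).mul (hM.hasDerivAt_x₁ hs.1)).const_mul 2).sub
      (((hM.hasDerivAt_b s).sub_const (r₀ ^ 3)).mul (hM.hasDerivAt_rootF hs.1))
    refine h.congr_deriv ?_
    have h1 := hM.deriv_a_pos hs.1
    have h2 := hM.rootF_pos hs.1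
    have h3 := hM.rootF_sq hs.1
    field_simp
    rw [h3]
    ring
  have hcont : ContinuousOn E (Icc 0 t) := by
    have c1 := hM.smooth_deriv_a.continuous
    have c2 := hM.smooth_deriv_b.continuous
    have c3 := hM.smooth_a.continuous
    have c4 := hM.smooth_b.continuous
    have : Continuous E := by
      rw [hE]; unfold rootF; fun_prop
    exact this.continuousOn
  obtain ⟨c, hc, hc'⟩ := exists_hasDerivAt_eq_slope E (fun _ => 0) ht hcont hderiv
  have h0 : E 0 = 0 := by simp [hE, hM.deriv_a_zero, hM.b_zero]
  have h1 : E t - E 0 = 0 := by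
    rw [eq_comm, div_eq_zero_iff] at hc'
    rcases hc' with h | h
    · exact h
    · linarith
  have h2 : E t = 0 := by linarith
  simp only [hE] at h2
  linarith

theorem A₃_pos (hM : IsB7Member r₀ abar bbar a b) {t : ℝ} (ht : 0 < t) :
    0 < A₃ (r₀ ^ 3) a b t :=
  div_pos (by linarith [hM.p_lt_b ht]) (hM.deriv_a_pos ht)

theorem deriv_a_eq (hM : IsB7Member r₀ abar bbar a b) {t : ℝ} (ht : 0 < t) :
    deriv a t = (b t - r₀ ^ 3) / A₃ (r₀ ^ 3) a b t := by
  have h1 := hM.p_lt_b ht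
  have h2 := hM.deriv_a_pos ht
  have h3 : b t - r₀ ^ 3 ≠ 0 := by linarith
  unfold A₃
  field_simp

theorem deriv_b_eq (hM : IsB7Member r₀ abar bbar a b) {t : ℝ} (ht : 0 < t) :
    deriv b t = A₃ (r₀ ^ 3) a b t ^ 2 * rootF (r₀ ^ 3) a b t / (2 * (b t - r₀ ^ 3)) := by
  have h1 := hM.p_lt_b ht
  have h2 := hM.deriv_a_pos ht
  have h3 : b t - r₀ ^ 3 ≠ 0 := by linarith
  have h4 := hM.hamiltonian ht
  unfold A₃
  field_simp
  linarith

theorem hasDerivAt_A₃ (hM : IsB7Member r₀ abar bbar a b) {t : ℝ} (ht : 0 < t) :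
    HasDerivAt (A₃ (r₀ ^ 3) a b) (A₃ (r₀ ^ 3) a b t ^ 3 * (b t + r₀ ^ 3) /
      (2 * (b t - r₀ ^ 3) * rootF (r₀ ^ 3) a b t)) t := by
  have h1 := hM.p_lt_b ht
  have h2 := hM.deriv_a_pos ht
  have h3 : b t - r₀ ^ 3 ≠ 0 := by linarith
  have h4 := hM.hamiltonian ht
  have h5 := hM.rootF_pos ht
  have h6 := hM.rootF_sq ht
  have h := ((hM.hasDerivAt_b t).sub_const (r₀ ^ 3)).div (hM.hasDerivAt_deriv_a ht) h2.ne'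
  refine h.congr_deriv ?_
  have h7 : deriv b t = (b t - r₀ ^ 3) * rootF (r₀ ^ 3) a b t / (2 * deriv a t ^ 2) := by
    rw [← h4]; field_simp
  rw [h7]
  unfold A₃
  field_simp
  rw [h6]
  ring

end IsB7Member

end B7

/-! ### The comparison of `a` and `b` along the Hitchin flow -/

theorem le_of_hasDerivAt_nonneg {f f' : ℝ → ℝ} {T : ℝ} (h : ∀ t, T ≤ t → HasDerivAt f (f' t) t)
    (h0 : ∀ t, T ≤ t → 0 ≤ f' t) {s t : ℝ} (hs : T ≤ s) (hst : s ≤ t) : f s ≤ f t :=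
  monotoneOn_of_hasDerivWithinAt_nonneg (convex_Ici T)
    (fun t ht => (h t ht).continuousAt.continuousWithinAt)
    (fun t ht => (h t (interior_subset ht)).hasDerivWithinAt)
    (fun t ht => h0 t (interior_subset ht)) hs (hs.trans hst) hst

theorem lt_of_hasDerivAt_pos_of_continuous {f f' : ℝ → ℝ} (hc : Continuous f)
    (h : ∀ t, 0 < t → HasDerivAt f (f' t) t) (h0 : ∀ t, 0 < t → 0 < f' t) {t : ℝ} (ht : 0 < t) :
    f 0 < f t := by
  have : StrictMonoOn f (Ici 0) := by
    refine strictMonoOn_of_deriv_pos (convex_Ici 0) hc.continuousOn fun s hs => ?_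
    rw [interior_Ici] at hs
    rw [(h s hs).deriv]
    exact h0 s hs
  exact this self_mem_Ici ht.le ht

theorem le_of_hasDerivAt_nonneg_of_continuous {f f' : ℝ → ℝ} (hc : Continuous f)
    (h : ∀ t, 0 < t → HasDerivAt f (f' t) t) (h0 : ∀ t, 0 < t → 0 ≤ f' t) {s t : ℝ} (hs : 0 ≤ s)
    (hst : s ≤ t) : f s ≤ f t := by
  have : MonotoneOn f (Ici 0) := by
    refine monotoneOn_of_hasDerivWithinAt_nonneg (convex_Ici 0) hc.continuousOn
      (f' := f') (fun s hs => ?_) fun s hs => ?_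
    · rw [interior_Ici] at hs
      exact (h s hs).hasDerivWithinAt
    · rw [interior_Ici] at hs
      exact h0 s hs
  exact this hs (hs.trans hst) hst

namespace B7

variable {r₀ abar bbar : ℝ} {a b : ℝ → ℝ}

namespace IsB7Member

theorem hasDerivAt_x₂_sub_x₁ (hM : IsB7Member r₀ abar bbar a b) {t : ℝ} (ht : 0 < t) :
    HasDerivAt (fun s => deriv a s ^ 2 - deriv a s * deriv b s)
      (2 * (a t - b t) * (2 * a t + b t + r₀ ^ 3) / rootF (r₀ ^ 3) a b t) t := by
  refine ((hM.hasDerivAt_x₂ ht).sub (hM.hasDerivAt_x₁ ht)).congr_deriv ?_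
  rw [← sub_div]
  ring

/-- The only use of `abar > bbar`: `a - b ~ (abar - bbar) t⁴` is positive for small `t`. -/
theorem exists_b_lt_a (hM : IsB7Member r₀ abar bbar a b) {t : ℝ} (ht : 0 < t) :
    ∃ s ∈ Ioo 0 t, b s < a s := by
  have h1 : (fun t => (a t - b t) - (abar - bbar) * t ^ 4) =O[𝓝 0] fun t : ℝ => t ^ 6 :=
    (hM.expansion_a.sub hM.expansion_b).congr_left fun t => by ring
  obtain ⟨C, hC⟩ := h1.bound
  have h2 : ∀ᶠ s : ℝ in 𝓝 0, C * s ^ 2 < abar - bbar := by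
    have : Tendsto (fun s : ℝ => C * s ^ 2) (𝓝 0) (𝓝 (C * 0 ^ 2)) :=
      Continuous.tendsto (by fun_prop) 0
    refine this.eventually_lt_const ?_
    have := hM.bbar_lt_abar
    simp only [ne_eq, OfNat.ofNat_ne_zero, not_false_eq_true, zero_pow, mul_zero]
    linarith
  have h3 : ∀ᶠ s in 𝓝[>] (0 : ℝ), s ∈ Ioo 0 t := Ioo_mem_nhdsGT ht
  obtain ⟨s, ⟨hs1, hs2⟩, hs3⟩ :=
    ((eventually_nhdsWithin_of_eventually_nhds (hC.and h2)).and h3).exists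
  refine ⟨s, hs3, ?_⟩
  have hs0 := hs3.1
  rw [Real.norm_eq_abs, Real.norm_of_nonneg (by positivity)] at hs1
  have h4 := (abs_le.1 hs1).1
  have h5 : C * s ^ 6 < (abar - bbar) * s ^ 4 := by
    have : C * s ^ 6 = (C * s ^ 2) * s ^ 4 := by ring
    rw [this]
    exact mul_lt_mul_of_pos_right hs2 (by positivity)
  linarith

/-- The function `(a - b) · a'(a' - b')` is nondecreasing and vanishes at `0`. -/
theorem sub_mul_deriv_nonneg (hM : IsB7Member r₀ abar bbar a b) {t : ℝ} (ht : 0 < t) :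
    0 ≤ (a t - b t) * (deriv a t - deriv b t) := by
  have c1 := hM.smooth_deriv_a.continuous
  have c2 := hM.smooth_deriv_b.continuous
  have c3 := hM.smooth_a.continuous
  have c4 := hM.smooth_b.continuous
  have h := le_of_hasDerivAt_nonneg_of_continuous
    (f := fun s => (a s - b s) * (deriv a s ^ 2 - deriv a s * deriv b s)) (by fun_prop)
    (fun s hs => ((hM.hasDerivAt_a s).sub (hM.hasDerivAt_b s)).mul (hM.hasDerivAt_x₂_sub_x₁ hs))
    (fun s hs => ?_) le_rfl ht.le
  · simp only [hM.deriv_a_zero, hM.a_zero, hM.b_zero, sub_self, zero_mul] at h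
    have h1 := hM.deriv_a_pos ht
    refine nonneg_of_mul_nonneg_right (a := deriv a t) ?_ h1
    linarith
  · have h1 := hM.deriv_a_pos hs
    have h2 := hM.rootF_pos hs
    have h3 := hM.a_pos hs
    have h4 := hM.p_lt_b hs
    have h5 := hM.p_pos
    have h6 : 0 < 2 * a s + b s + r₀ ^ 3 := by linarith
    have e : (deriv a s - deriv b s) * (deriv a s ^ 2 - deriv a s * deriv b s) +
        (a s - b s) * (2 * (a s - b s) * (2 * a s + b s + r₀ ^ 3) / rootF (r₀ ^ 3) a b s) =
        deriv a s * (deriv a s - deriv b s) ^ 2 +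
        2 * (a s - b s) ^ 2 * (2 * a s + b s + r₀ ^ 3) / rootF (r₀ ^ 3) a b s := by ring
    simp only [Pi.sub_apply]
    rw [e]
    positivity

/-- Once positive, `a - b` cannot return to zero, since `(a - b)²` is nondecreasing. -/
theorem b_lt_a (hM : IsB7Member r₀ abar bbar a b) {t : ℝ} (ht : 0 < t) : b t < a t := by
  obtain ⟨s, hs, hab⟩ := hM.exists_b_lt_a ht
  have hsq : ∀ r, s ≤ r → (a s - b s) ^ 2 ≤ (a r - b r) ^ 2 := fun r hr =>
    le_of_hasDerivAt_nonneg (f := fun s => (a s - b s) ^ 2) (T := s)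
      (fun r _ => ((hM.hasDerivAt_a r).sub (hM.hasDerivAt_b r)).fun_pow 2)
      (fun r hr => by
        have := hM.sub_mul_deriv_nonneg (hs.1.trans_le hr)
        push_cast
        simp only [pow_one, Pi.sub_apply]
        linarith) le_rfl hr
  by_contra hneg
  have hc : ContinuousOn (fun r => a r - b r) (Icc s t) :=
    (hM.smooth_a.continuous.sub hM.smooth_b.continuous).continuousOn
  obtain ⟨r, hr, hr0⟩ := intermediate_value_Icc' hs.2.le hc
    (show (0 : ℝ) ∈ Icc (a t - b t) (a s - b s) from
      ⟨by linarith [not_lt.1 hneg], by linarith⟩)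
  have := hsq r hr.1
  simp only at hr0
  rw [hr0] at this
  nlinarith

/-- The derivative of the Wronskian of `a - b` and `b - p`, multiplied by `a'`. -/
theorem hasDerivAt_wronskian (hM : IsB7Member r₀ abar bbar a b) {t : ℝ} (ht : 0 < t) :
    HasDerivAt (fun s => (deriv a s ^ 2 - deriv a s * deriv b s) * (b s - r₀ ^ 3) -
      (a s - b s) * (deriv a s * deriv b s))
      (2 * (a t - b t) * (b t - r₀ ^ 3) * (a t + b t + r₀ ^ 3) / rootF (r₀ ^ 3) a b t) t := by
  refine (((hM.hasDerivAt_x₂_sub_x₁ ht).mul ((hM.hasDerivAt_b t).sub_const (r₀ ^ 3))).sub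
    (((hM.hasDerivAt_a t).sub (hM.hasDerivAt_b t)).mul (hM.hasDerivAt_x₁ ht))).congr_deriv ?_
  have h2 := hM.rootF_pos ht
  simp only [Pi.sub_apply]
  field_simp
  ring

theorem wronskian_pos (hM : IsB7Member r₀ abar bbar a b) {t : ℝ} (ht : 0 < t) :
    0 < (deriv a t ^ 2 - deriv a t * deriv b t) * (b t - r₀ ^ 3) -
      (a t - b t) * (deriv a t * deriv b t) := by
  have c1 := hM.smooth_deriv_a.continuous
  have c2 := hM.smooth_deriv_b.continuous
  have c3 := hM.smooth_a.continuous
  have c4 := hM.smooth_b.continuous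
  have h := lt_of_hasDerivAt_pos_of_continuous
    (f := fun s => (deriv a s ^ 2 - deriv a s * deriv b s) * (b s - r₀ ^ 3) -
      (a s - b s) * (deriv a s * deriv b s)) (by fun_prop)
    (fun s hs => hM.hasDerivAt_wronskian hs) (fun s hs => ?_) ht
  · simpa only [hM.deriv_a_zero, hM.a_zero, hM.b_zero, sub_self, zero_mul, mul_zero] using h
  · have h2 := hM.rootF_pos hs
    have h3 := hM.b_lt_a hs
    have h4 := hM.p_lt_b hs
    have h5 := hM.p_pos
    have h6 : 0 < a s - b s := by linarith
    have h7 : 0 < b s - r₀ ^ 3 := by linarith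
    have h8 : 0 < a s + b s + r₀ ^ 3 := by linarith
    positivity

theorem A₃_mono (hM : IsB7Member r₀ abar bbar a b) {s t : ℝ} (hs : 0 < s) (hst : s ≤ t) :
    A₃ (r₀ ^ 3) a b s ≤ A₃ (r₀ ^ 3) a b t := by
  refine le_of_hasDerivAt_nonneg (T := s) (fun t ht => hM.hasDerivAt_A₃ (hs.trans_le ht))
    (fun t ht => ?_) le_rfl hst
  have ht0 := hs.trans_le ht
  have h2 := hM.rootF_pos ht0
  have h4 := hM.p_lt_b ht0
  have h5 := hM.p_pos
  have h6 := hM.A₃_pos ht0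
  have h7 : 0 < b t - r₀ ^ 3 := by linarith
  have h8 : 0 < b t + r₀ ^ 3 := by linarith
  positivity

theorem x₁_eq (hM : IsB7Member r₀ abar bbar a b) {t : ℝ} (ht : 0 < t) :
    deriv a t * deriv b t = A₃ (r₀ ^ 3) a b t * rootF (r₀ ^ 3) a b t / 2 := by
  have h4 := hM.p_lt_b ht
  have h6 := hM.A₃_pos ht
  have h7 : b t - r₀ ^ 3 ≠ 0 := by linarith
  rw [hM.deriv_b_eq ht, hM.deriv_a_eq ht]
  field_simp

theorem x₁_mono (hM : IsB7Member r₀ abar bbar a b) {s t : ℝ} (hs : 0 < s) (hst : s ≤ t) :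
    deriv a s * deriv b s ≤ deriv a t * deriv b t := by
  refine le_of_hasDerivAt_nonneg (f := fun s => deriv a s * deriv b s) (T := s)
    (fun t ht => hM.hasDerivAt_x₁ (hs.trans_le ht)) (fun t ht => ?_) le_rfl hst
  have ht0 := hs.trans_le ht
  have h2 := hM.rootF_pos ht0
  have h4 := hM.p_lt_b ht0
  have h6 := hM.a_pos ht0
  have h7 : 0 < b t - r₀ ^ 3 := by linarith
  positivity

theorem b_mono (hM : IsB7Member r₀ abar bbar a b) {s t : ℝ} (hs : 0 < s) (hst : s ≤ t) :
    b s ≤ b t :=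
  le_of_hasDerivAt_nonneg (T := s) (fun t _ => hM.hasDerivAt_b t)
    (fun _ ht => (hM.deriv_b_pos (hs.trans_le ht)).le) le_rfl hst

/-- `((b-p)²)' = 2 A₃ a'b'` is bounded below, as `A₃` and `a'b'` are nondecreasing. -/
theorem tendsto_b (hM : IsB7Member r₀ abar bbar a b) :
    Tendsto (fun t => b t - r₀ ^ 3) atTop atTop := by
  set k := 2 * (A₃ (r₀ ^ 3) a b 1 * (deriv a 1 * deriv b 1)) with hk
  have hk0 : 0 < k := by
    have := hM.A₃_pos one_pos
    have := hM.x₁_pos one_pos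
    positivity
  have key : ∀ t, 1 ≤ t → (b 1 - r₀ ^ 3) ^ 2 - k * 1 ≤ (b t - r₀ ^ 3) ^ 2 - k * t := by
    intro t ht
    refine le_of_hasDerivAt_nonneg (f := fun t => (b t - r₀ ^ 3) ^ 2 - k * t) (T := 1)
      (fun s _ => (((hM.hasDerivAt_b s).sub_const (r₀ ^ 3)).fun_pow 2).sub
        ((hasDerivAt_id s).const_mul k)) (fun s hs => ?_) le_rfl ht
    have hs0 := one_pos.trans_le hs
    have h1 := mul_le_mul (hM.A₃_mono one_pos hs) (hM.x₁_mono one_pos hs)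
      (hM.x₁_pos one_pos).le (hM.A₃_pos hs0).le
    have h2 : (b s - r₀ ^ 3) * deriv b s =
        A₃ (r₀ ^ 3) a b s * (deriv a s * deriv b s) := by
      have h6 := hM.A₃_pos hs0
      rw [hM.deriv_a_eq hs0]
      field_simp
    push_cast
    simp only [pow_one, mul_one]
    rw [hk]
    linarith
  have h1 : Tendsto (fun t => (b t - r₀ ^ 3) ^ 2) atTop atTop := by
    refine tendsto_atTop_mono' _ (f₁ := fun t => k * t - k) ?_ ?_
    · filter_upwards [eventually_ge_atTop 1] with t ht
      have := key t ht
      nlinarith [sq_nonneg (b 1 - r₀ ^ 3)]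
    · exact tendsto_atTop_add_const_right _ _ (tendsto_id.const_mul_atTop hk0)
  refine (Real.tendsto_sqrt_atTop.comp h1).congr' ?_
  filter_upwards [eventually_gt_atTop 0] with t ht
  have := hM.p_lt_b ht
  exact Real.sqrt_sq (by linarith)

/-- `a` grows faster than `b`. Since the Wronskian `M` of `hasDerivAt_wronskian` satisfies
`M ≥ c (b-p) a'b'`, the ratio `(a-b)/(b-p)`, whose derivative is `M / (a' (b-p)²)`, grows at least
like `c log (b-p)`. -/
theorem tendsto_ratio (hM : IsB7Member r₀ abar bbar a b) :
    Tendsto (fun t => (a t - b t) / (b t - r₀ ^ 3)) atTop atTop := by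
  have hβ : ∀ t, 0 < t → 0 < b t - r₀ ^ 3 := fun t ht => by linarith [hM.p_lt_b ht]
  have hδ : ∀ t, 0 < t → 0 < a t - b t := fun t ht => by linarith [hM.b_lt_a ht]
  set M : ℝ → ℝ := fun s => (deriv a s ^ 2 - deriv a s * deriv b s) * (b s - r₀ ^ 3) -
      (a s - b s) * (deriv a s * deriv b s) with hMdef
  have hMpos : ∀ t, 0 < t → 0 < M t := fun t ht => hM.wronskian_pos ht
  have hPd : ∀ t, 0 < t → HasDerivAt (fun t => (a t - b t) / (b t - r₀ ^ 3))
      (M t / (deriv a t * (b t - r₀ ^ 3) ^ 2)) t := by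
    intro t ht
    refine (((hM.hasDerivAt_a t).sub (hM.hasDerivAt_b t)).div
      ((hM.hasDerivAt_b t).sub_const (r₀ ^ 3)) (hβ t ht).ne').congr_deriv ?_
    have h1 := hM.deriv_a_pos ht
    have h2 := hβ t ht
    simp only [hMdef, Pi.sub_apply]
    field_simp
  set P₁ := (a 1 - b 1) / (b 1 - r₀ ^ 3) with hP₁
  have hP₁0 : 0 < P₁ := div_pos (hδ 1 one_pos) (hβ 1 one_pos)
  have hPge : ∀ t, 1 ≤ t → P₁ * (b t - r₀ ^ 3) ≤ a t - b t := by
    intro t ht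
    have ht0 := one_pos.trans_le ht
    rw [← le_div_iff₀ (hβ t ht0)]
    refine le_of_hasDerivAt_nonneg (f := fun t => (a t - b t) / (b t - r₀ ^ 3)) (T := 1)
      (fun s hs => hPd s (one_pos.trans_le hs)) (fun s hs => ?_) le_rfl ht
    have hs0 := one_pos.trans_le hs
    have := hMpos s hs0
    have := hM.deriv_a_pos hs0
    have := hβ s hs0
    positivity
  set K := 1 + r₀ ^ 3 / (b 1 - r₀ ^ 3) with hK
  have hK1 : 1 ≤ K := by
    have := hM.p_pos
    have := hβ 1 one_pos
    rw [hK]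
    linarith [show 0 ≤ r₀ ^ 3 / (b 1 - r₀ ^ 3) by positivity]
  have hKa : ∀ t, 1 ≤ t → a t ≤ K * (a t - r₀ ^ 3) := by
    intro t ht
    have ht0 := one_pos.trans_le ht
    have h1 : b 1 - r₀ ^ 3 ≤ a t - r₀ ^ 3 := by
      linarith [hM.b_mono one_pos ht, hM.b_lt_a ht0]
    have h2 := hβ 1 one_pos
    have h3 : r₀ ^ 3 ≤ r₀ ^ 3 / (b 1 - r₀ ^ 3) * (a t - r₀ ^ 3) := by
      rw [div_mul_eq_mul_div, le_div_iff₀ h2]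
      exact mul_le_mul_of_nonneg_left h1 hM.p_pos.le
    rw [hK]; linarith
  -- the positivity of the Wronskian bounds `b' a'b'` by a multiple of `(b-p)(a'b')'`
  have hX : ∀ t, 1 ≤ t → deriv b t * (deriv a t * deriv b t) ≤
      K * (2 * a t * (b t - r₀ ^ 3) ^ 2 / rootF (r₀ ^ 3) a b t) := by
    intro t ht
    have ht0 := one_pos.trans_le ht
    have hD := hM.rootF_pos ht0
    have hD2 := hM.rootF_lt ht0
    have hx := hM.deriv_a_pos ht0
    have hy := hM.deriv_b_pos ht0
    have hb := hβ t ht0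
    have ha := hM.a_pos ht0
    have hH := hM.hamiltonian ht0
    have hW : (a t - r₀ ^ 3) * deriv b t ≤ deriv a t * (b t - r₀ ^ 3) := by
      have h := hMpos t ht0
      have e : M t = deriv a t * (deriv a t * (b t - r₀ ^ 3) - (a t - r₀ ^ 3) * deriv b t) := by
        simp only [hMdef]; ring
      rw [e] at h
      linarith [pos_of_mul_pos_right h hx.le]
    have hA : a t * deriv b t ≤ K * (deriv a t * (b t - r₀ ^ 3)) := by
      calc a t * deriv b t ≤ K * (a t - r₀ ^ 3) * deriv b t := by gcongr; exact hKa t ht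
        _ = K * ((a t - r₀ ^ 3) * deriv b t) := by ring
        _ ≤ _ := by gcongr
    have e1 : 2 * a t * (b t - r₀ ^ 3) ^ 2 / rootF (r₀ ^ 3) a b t =
        4 * a t * (b t - r₀ ^ 3) * deriv a t ^ 2 * deriv b t / rootF (r₀ ^ 3) a b t ^ 2 := by
      rw [div_eq_div_iff hD.ne' (by positivity)]
      linear_combination (-(2 * a t * (b t - r₀ ^ 3) * rootF (r₀ ^ 3) a b t)) * hH
    rw [e1, ← mul_div_assoc, le_div_iff₀ (by positivity)]
    have hD3 : rootF (r₀ ^ 3) a b t ^ 2 ≤ 4 * a t ^ 2 := by nlinarith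
    calc deriv b t * (deriv a t * deriv b t) * rootF (r₀ ^ 3) a b t ^ 2
        ≤ deriv b t * (deriv a t * deriv b t) * (4 * a t ^ 2) := by gcongr
      _ = 4 * a t * deriv a t * deriv b t * (a t * deriv b t) := by ring
      _ ≤ 4 * a t * deriv a t * deriv b t * (K * (deriv a t * (b t - r₀ ^ 3))) := by gcongr
      _ = _ := by ring
  set c := min (P₁ / (1 + K)) (M 1 / ((b 1 - r₀ ^ 3) * (deriv a 1 * deriv b 1))) with hc
  have hc0 : 0 < c := by
    have h1 := hMpos 1 one_pos
    have h2 := hβ 1 one_pos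
    have h3 := hM.x₁_pos one_pos
    exact lt_min (by positivity) (by positivity)
  have hMge : ∀ t, 1 ≤ t → c * ((b t - r₀ ^ 3) * (deriv a t * deriv b t)) ≤ M t := by
    intro t ht
    have h := le_of_hasDerivAt_nonneg (T := 1)
      (f := fun t => M t - c * ((b t - r₀ ^ 3) * (deriv a t * deriv b t)))
      (fun s hs => (hM.hasDerivAt_wronskian (one_pos.trans_le hs)).sub
        ((((hM.hasDerivAt_b s).sub_const (r₀ ^ 3)).mul
          (hM.hasDerivAt_x₁ (one_pos.trans_le hs))).const_mul c)) (fun s hs => ?_) le_rfl ht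
    · have h1 : c * ((b 1 - r₀ ^ 3) * (deriv a 1 * deriv b 1)) ≤ M 1 := by
        rw [← le_div_iff₀ (mul_pos (hβ 1 one_pos) (hM.x₁_pos one_pos))]
        exact min_le_right _ _
      linarith
    · have hs0 := one_pos.trans_le hs
      have hD := hM.rootF_pos hs0
      have hb := hβ s hs0
      have ha := hM.a_pos hs0
      have hp := hM.p_pos
      have hbp := hM.p_lt_b hs0
      have hcK : c * (1 + K) ≤ P₁ := by
        rw [← le_div_iff₀ (by linarith)]
        exact min_le_left _ _
      have h1 := mul_le_mul_of_nonneg_left (hX s hs) hc0.le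
      have h2 : c * (1 + K) * (2 * a s * (b s - r₀ ^ 3) ^ 2 / rootF (r₀ ^ 3) a b s) ≤
          2 * (a s - b s) * (b s - r₀ ^ 3) * (a s + b s + r₀ ^ 3) / rootF (r₀ ^ 3) a b s := by
        rw [← mul_div_assoc]
        refine div_le_div_of_nonneg_right ?_ hD.le
        calc c * (1 + K) * (2 * a s * (b s - r₀ ^ 3) ^ 2)
            ≤ P₁ * (2 * a s * (b s - r₀ ^ 3) ^ 2) := by gcongr
          _ = 2 * (P₁ * (b s - r₀ ^ 3)) * (b s - r₀ ^ 3) * a s := by ring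
          _ ≤ 2 * (a s - b s) * (b s - r₀ ^ 3) * (a s + b s + r₀ ^ 3) := by
              have := hPge s hs
              have := hδ s hs0
              refine mul_le_mul ?_ (by linarith) ha.le (by positivity)
              gcongr
      have e : (b s - r₀ ^ 3) * (2 * a s * (b s - r₀ ^ 3) / rootF (r₀ ^ 3) a b s) =
        2 * a s * (b s - r₀ ^ 3) ^ 2 / rootF (r₀ ^ 3) a b s := by ring
      rw [e]
      linarith
  have hlog : ∀ t, 1 ≤ t → P₁ - c * Real.log (b 1 - r₀ ^ 3) ≤
      (a t - b t) / (b t - r₀ ^ 3) - c * Real.log (b t - r₀ ^ 3) := by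
    intro t ht
    refine le_of_hasDerivAt_nonneg (T := 1)
      (f := fun t => (a t - b t) / (b t - r₀ ^ 3) - c * Real.log (b t - r₀ ^ 3))
      (fun s hs => (hPd s (one_pos.trans_le hs)).sub
        ((((hM.hasDerivAt_b s).sub_const (r₀ ^ 3)).log
          (hβ s (one_pos.trans_le hs)).ne').const_mul c)) (fun s hs => ?_) le_rfl ht
    have hs0 := one_pos.trans_le hs
    have hb := hβ s hs0
    have hx := hM.deriv_a_pos hs0
    rw [sub_nonneg, ← mul_div_assoc, div_le_div_iff₀ hb (by positivity)]
    have := mul_le_mul_of_nonneg_right (hMge s hs) hb.le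
    calc _ = c * ((b s - r₀ ^ 3) * (deriv a s * deriv b s)) * (b s - r₀ ^ 3) := by ring
      _ ≤ _ := this
  refine tendsto_atTop_mono' _ (f₁ := fun t => c * Real.log (b t - r₀ ^ 3) +
    (P₁ - c * Real.log (b 1 - r₀ ^ 3))) ?_ ?_
  · filter_upwards [eventually_ge_atTop 1] with t ht
    have := hlog t ht
    linarith
  · exact tendsto_atTop_add_const_right _ _
      ((Real.tendsto_log_atTop.comp hM.tendsto_b).const_mul_atTop hc0)

end IsB7Member

end B7

/-! ### Convergence of `A₃` and growth of `a` and `b` -/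

namespace B7

variable {r₀ abar bbar : ℝ} {a b : ℝ → ℝ}

namespace IsB7Member

/-- The consequences of `b → ∞` and `(a-b)/(b-p) → ∞` used to absorb lower order terms. -/
theorem exists_forall_ge_bounds (hM : IsB7Member r₀ abar bbar a b) :
    ∃ T, 1 ≤ T ∧ ∀ t, T ≤ t → b t + r₀ ^ 3 ≤ 2 * (b t - r₀ ^ 3) ∧ 3 * (b t - r₀ ^ 3) ≤ a t ∧
      a t ≤ rootF (r₀ ^ 3) a b t ∧ 32 * (b t - r₀ ^ 3) ^ 2 ≤ rootF (r₀ ^ 3) a b t ^ 2 := by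
  obtain ⟨T, hT⟩ := eventually_atTop.1 (((hM.tendsto_b.eventually_ge_atTop (2 * r₀ ^ 3)).and
    (hM.tendsto_ratio.eventually_ge_atTop 2)).and (eventually_ge_atTop 1))
  refine ⟨max T 1, le_max_right _ _, fun t ht => ?_⟩
  obtain ⟨⟨h1, h2⟩, h3⟩ := hT t ((le_max_left _ _).trans ht)
  have ht0 : 0 < t := by linarith
  have hb := hM.p_lt_b ht0
  have hp := hM.p_pos
  have hD := hM.rootF_sq ht0
  have hD0 := hM.rootF_pos ht0
  rw [le_div_iff₀ (by linarith)] at h2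
  have h4 : b t + r₀ ^ 3 ≤ 2 * (b t - r₀ ^ 3) := by linarith
  have h5 : 3 * (b t - r₀ ^ 3) ≤ a t := by linarith
  have h6 : (b t + r₀ ^ 3) ^ 2 ≤ (2 * (b t - r₀ ^ 3)) ^ 2 := by
    apply pow_le_pow_left₀ (by linarith) h4
  have h7 : (3 * (b t - r₀ ^ 3)) ^ 2 ≤ a t ^ 2 := by
    apply pow_le_pow_left₀ (by linarith) h5
  refine ⟨h4, h5, ?_, by nlinarith⟩
  exact abs_le_of_sq_le_sq' (by nlinarith) hD0.le |>.2

theorem hasDerivAt_log_A₃ (hM : IsB7Member r₀ abar bbar a b) {t : ℝ} (ht : 0 < t) :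
    HasDerivAt (fun t => Real.log (A₃ (r₀ ^ 3) a b t)) (A₃ (r₀ ^ 3) a b t ^ 2 * (b t + r₀ ^ 3) /
      (2 * (b t - r₀ ^ 3) * rootF (r₀ ^ 3) a b t)) t := by
  refine ((hM.hasDerivAt_A₃ ht).log (hM.A₃_pos ht).ne').congr_deriv ?_
  have h1 := hM.A₃_pos ht
  have h2 := hM.rootF_pos ht
  have h3 : b t - r₀ ^ 3 ≠ 0 := by linarith [hM.p_lt_b ht]
  field_simp

theorem hasDerivAt_a_sq (hM : IsB7Member r₀ abar bbar a b) {t : ℝ} (ht : 0 < t) :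
    HasDerivAt (fun t => a t ^ 2) (2 * a t * (b t - r₀ ^ 3) / A₃ (r₀ ^ 3) a b t) t := by
  refine ((hM.hasDerivAt_a t).fun_pow 2).congr_deriv ?_
  rw [hM.deriv_a_eq ht]
  push_cast
  ring

/-- Once `D² ≥ 12 (b-p)²`, where `D` is `rootF`, the function `A₃⁶ / (b-p)` is nonincreasing. -/
theorem exists_A₃_pow_le (hM : IsB7Member r₀ abar bbar a b) :
    ∃ C T, 0 < C ∧ 1 ≤ T ∧ ∀ t, T ≤ t → A₃ (r₀ ^ 3) a b t ^ 3 ≤ C * √(b t - r₀ ^ 3) := by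
  obtain ⟨T, hT1, hT⟩ := hM.exists_forall_ge_bounds
  have hβ : ∀ t, 0 < t → 0 < b t - r₀ ^ 3 := fun t ht => by linarith [hM.p_lt_b ht]
  have h0 : ∀ t, T ≤ t → 0 < t := fun t ht => by linarith
  have hT0 := h0 T le_rfl
  set K := 6 * Real.log (A₃ (r₀ ^ 3) a b T) - Real.log (b T - r₀ ^ 3) with hK
  have key : ∀ t, T ≤ t → 6 * Real.log (A₃ (r₀ ^ 3) a b t) - Real.log (b t - r₀ ^ 3) ≤ K := by
    intro t ht
    have := le_of_hasDerivAt_nonneg (T := T)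
      (f := fun t => Real.log (b t - r₀ ^ 3) - 6 * Real.log (A₃ (r₀ ^ 3) a b t))
      (fun s hs => (((hM.hasDerivAt_b s).sub_const (r₀ ^ 3)).log (hβ s (h0 s hs)).ne').sub
        ((hM.hasDerivAt_log_A₃ (h0 s hs)).const_mul 6)) (fun s hs => ?_) le_rfl ht
    · linarith
    · obtain ⟨h1, h2, h3, h4⟩ := hT s hs
      have hb := hβ s (h0 s hs)
      have hu := hM.A₃_pos (h0 s hs)
      have hD := hM.rootF_pos (h0 s hs)
      have hp := hM.p_pos
      rw [hM.deriv_b_eq (h0 s hs), sub_nonneg, div_div, ← mul_div_assoc,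
        div_le_div_iff₀ (by positivity) (by positivity)]
      have h5 : 6 * (b s + r₀ ^ 3) * (b s - r₀ ^ 3) ≤ rootF (r₀ ^ 3) a b s ^ 2 := by nlinarith
      calc _ = 6 * (b s + r₀ ^ 3) * (b s - r₀ ^ 3) *
            (2 * A₃ (r₀ ^ 3) a b s ^ 2 * (b s - r₀ ^ 3)) := by ring
        _ ≤ rootF (r₀ ^ 3) a b s ^ 2 * (2 * A₃ (r₀ ^ 3) a b s ^ 2 * (b s - r₀ ^ 3)) := by gcongr
        _ = _ := by ring
  refine ⟨Real.exp (K / 2), T, Real.exp_pos _, hT1, fun t ht => ?_⟩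
  have hb := hβ t (h0 t ht)
  have hu := hM.A₃_pos (h0 t ht)
  rw [← Real.log_le_log_iff (by positivity) (by positivity),
    Real.log_mul (Real.exp_pos _).ne' (by positivity), Real.log_exp, Real.log_sqrt hb.le,
    Real.log_pow]
  have := key t ht
  push_cast
  linarith

/-- A first lower bound for the growth of `a`, from `(a²)' = 2 a (b-p) / A₃` and
`exists_A₃_pow_le`. -/
theorem exists_a_sq_ge (hM : IsB7Member r₀ abar bbar a b) :
    ∃ c T, 0 < c ∧ 1 ≤ T ∧ ∀ t, T ≤ t → c * ((b t - r₀ ^ 3) ^ 2 * √(b t - r₀ ^ 3)) ≤ a t ^ 2 := by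
  obtain ⟨C, T, hC, hT1, hT⟩ := hM.exists_A₃_pow_le
  have hβ : ∀ t, 0 < t → 0 < b t - r₀ ^ 3 := fun t ht => by linarith [hM.p_lt_b ht]
  have h0 : ∀ t, T ≤ t → 0 < t := fun t ht => by linarith
  have hbT := hβ T (h0 T le_rfl)
  set c := min (4 / (5 * C)) (a T ^ 2 / ((b T - r₀ ^ 3) ^ 2 * √(b T - r₀ ^ 3))) with hc
  have hc0 : 0 < c := by
    have := hM.a_pos (h0 T le_rfl)
    exact lt_min (by positivity) (by positivity)
  refine ⟨c, T, hc0, hT1, fun t ht => ?_⟩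
  have h := le_of_hasDerivAt_nonneg (T := T)
    (f := fun t => a t ^ 2 - c * ((b t - r₀ ^ 3) ^ 2 * √(b t - r₀ ^ 3)))
    (fun s hs => (hM.hasDerivAt_a_sq (h0 s hs)).sub
      (((((hM.hasDerivAt_b s).sub_const (r₀ ^ 3)).fun_pow 2).mul
      (((hM.hasDerivAt_b s).sub_const (r₀ ^ 3)).sqrt (hβ s (h0 s hs)).ne')).const_mul c))
    (fun s hs => ?_) le_rfl ht
  · have h1 : c * ((b T - r₀ ^ 3) ^ 2 * √(b T - r₀ ^ 3)) ≤ a T ^ 2 := by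
      rw [← le_div_iff₀ (by positivity)]
      exact min_le_right _ _
    linarith
  · have hb := hβ s (h0 s hs)
    have hu := hM.A₃_pos (h0 s hs)
    have hD := hM.rootF_pos (h0 s hs)
    have hD2 := hM.rootF_lt (h0 s hs)
    have ha := hM.a_pos (h0 s hs)
    have h3 := hT s hs
    have hcC : c * (5 * C) ≤ 4 := by
      rw [← le_div_iff₀ (by positivity)]
      exact min_le_left _ _
    rw [hM.deriv_b_eq (h0 s hs)]
    set β := b s - r₀ ^ 3 with hβd
    set u := A₃ (r₀ ^ 3) a b s with hud
    set D := rootF (r₀ ^ 3) a b s with hDd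
    have hσ : 0 < √β := Real.sqrt_pos.2 hb
    have hσ2 : β = √β ^ 2 := (Real.sq_sqrt hb.le).symm
    generalize hσd : √β = σ at *
    push_cast
    have e : 2 * a s * β / u - c * (2 * β ^ (2 - 1) * (u ^ 2 * D / (2 * β)) * σ +
        β ^ 2 * (u ^ 2 * D / (2 * β) / (2 * σ))) =
        σ / u * (2 * a s * σ - (5 / 4) * c * u ^ 3 * D) := by
      rw [hσ2]
      field_simp
      ring
    rw [e]
    refine mul_nonneg (by positivity) (sub_nonneg.2 ?_)
    calc 5 / 4 * c * u ^ 3 * D ≤ 5 / 4 * c * (C * σ) * (2 * a s) := by gcongr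
      _ = (c * (5 * C)) * (a s * σ / 2) := by ring
      _ ≤ 4 * (a s * σ / 2) := by gcongr
      _ = _ := by ring

/-- `A₃` is bounded: by `exists_a_sq_ge`, the derivative of `log A₃` is dominated by that of a
multiple of `-(b-p)^{-1/2}`. -/
theorem exists_A₃_le (hM : IsB7Member r₀ abar bbar a b) :
    ∃ U, 0 < U ∧ ∀ t, 0 < t → A₃ (r₀ ^ 3) a b t ≤ U := by
  obtain ⟨T₁, hT₁1, hT₁⟩ := hM.exists_forall_ge_bounds
  obtain ⟨c, T₂, hc, hT₂1, hT₂⟩ := hM.exists_a_sq_ge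
  have hβ : ∀ t, 0 < t → 0 < b t - r₀ ^ 3 := fun t ht => by linarith [hM.p_lt_b ht]
  set T := max T₁ T₂ with hTd
  have h0 : ∀ t, T ≤ t → 0 < t := fun t ht => by linarith [le_max_left T₁ T₂]
  set K := Real.log (A₃ (r₀ ^ 3) a b T) + 4 / c * (√(b T - r₀ ^ 3))⁻¹ with hK
  have key : ∀ t, T ≤ t → Real.log (A₃ (r₀ ^ 3) a b t) ≤ K := by
    intro t ht
    have h := le_of_hasDerivAt_nonneg (T := T)
      (f := fun t => -Real.log (A₃ (r₀ ^ 3) a b t) - 4 / c * (√(b t - r₀ ^ 3))⁻¹)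
      (fun s hs => ((hM.hasDerivAt_log_A₃ (h0 s hs)).neg).sub
        ((((((hM.hasDerivAt_b s).sub_const (r₀ ^ 3)).sqrt (hβ s (h0 s hs)).ne').inv
          (Real.sqrt_pos.2 (hβ s (h0 s hs))).ne')).const_mul (4 / c)))
      (fun s hs => ?_) le_rfl ht
    · have : 0 ≤ 4 / c * (√(b t - r₀ ^ 3))⁻¹ := by positivity
      linarith
    · have hb := hβ s (h0 s hs)
      have hu := hM.A₃_pos (h0 s hs)
      have hD := hM.rootF_pos (h0 s hs)
      have ha := hM.a_pos (h0 s hs)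
      obtain ⟨h1, -, h3, -⟩ := hT₁ s ((le_max_left _ _).trans hs)
      have h4 := hT₂ s ((le_max_right _ _).trans hs)
      rw [hM.deriv_b_eq (h0 s hs)]
      have hp := hM.p_pos
      have hbp := hM.p_lt_b (h0 s hs)
      have hbp' : 0 < b s + r₀ ^ 3 := by linarith
      generalize b s + r₀ ^ 3 = q at *
      set β := b s - r₀ ^ 3 with hβd
      set u := A₃ (r₀ ^ 3) a b s with hud
      set D := rootF (r₀ ^ 3) a b s with hDd
      have hσ : 0 < √β := Real.sqrt_pos.2 hb
      have hσ2 : β = √β ^ 2 := (Real.sq_sqrt hb.le).symm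
      generalize hσd : √β = σ at *
      have e : -(u ^ 2 * q / (2 * β * D)) - 4 / c * (-(u ^ 2 * D / (2 * β) / (2 * σ)) / σ ^ 2) =
          u ^ 2 / (2 * c * β * D * σ ^ 3) * (2 * D ^ 2 - c * q * σ ^ 3) := by
        field_simp
        ring
      rw [e]
      refine mul_nonneg (by positivity) (sub_nonneg.2 ?_)
      have h5 : a s ^ 2 ≤ D ^ 2 := by gcongr
      calc c * q * σ ^ 3 ≤ c * (2 * β) * σ ^ 3 := by gcongr
        _ = 2 * (c * (β ^ 2 * σ)) := by rw [hσ2]; ring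
        _ ≤ 2 * D ^ 2 := by linarith
  refine ⟨Real.exp K, Real.exp_pos _, fun t ht => ?_⟩
  have hm : T ≤ max t T := le_max_right _ _
  refine (hM.A₃_mono ht (le_max_left t T)).trans ?_
  rw [← Real.log_le_iff_le_exp (hM.A₃_pos (h0 _ hm))]
  exact key _ hm

/-- The optimal growth `a² ≥ c (b-p)³`, as in `exists_a_sq_ge` but with `A₃` bounded. -/
theorem exists_a_sq_ge_cube (hM : IsB7Member r₀ abar bbar a b) :
    ∃ c, 0 < c ∧ ∀ t, 1 ≤ t → c * (b t - r₀ ^ 3) ^ 3 ≤ a t ^ 2 := by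
  obtain ⟨U, hU, hu⟩ := hM.exists_A₃_le
  have hβ : ∀ t, 0 < t → 0 < b t - r₀ ^ 3 := fun t ht => by linarith [hM.p_lt_b ht]
  have h0 : ∀ t : ℝ, 1 ≤ t → 0 < t := fun t ht => by linarith
  have hb1 := hβ 1 one_pos
  set c := min (2 / (3 * U ^ 3)) (a 1 ^ 2 / (b 1 - r₀ ^ 3) ^ 3) with hc
  have hc0 : 0 < c := by
    have := hM.a_pos one_pos
    exact lt_min (by positivity) (by positivity)
  refine ⟨c, hc0, fun t ht => ?_⟩
  have h := le_of_hasDerivAt_nonneg (T := 1)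
    (f := fun t => a t ^ 2 - c * (b t - r₀ ^ 3) ^ 3)
    (fun s hs => (hM.hasDerivAt_a_sq (h0 s hs)).sub
      ((((hM.hasDerivAt_b s).sub_const (r₀ ^ 3)).fun_pow 3).const_mul c))
    (fun s hs => ?_) le_rfl ht
  · have h1 : c * (b 1 - r₀ ^ 3) ^ 3 ≤ a 1 ^ 2 := by
      rw [← le_div_iff₀ (by positivity)]
      exact min_le_right _ _
    linarith
  · have hb := hβ s (h0 s hs)
    have hu' := hu s (h0 s hs)
    have hu0 := hM.A₃_pos (h0 s hs)
    have hD := hM.rootF_pos (h0 s hs)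
    have hD2 := hM.rootF_lt (h0 s hs)
    have ha := hM.a_pos (h0 s hs)
    have hcU : c * (3 * U ^ 3) ≤ 2 := by
      rw [← le_div_iff₀ (by positivity)]
      exact min_le_left _ _
    rw [hM.deriv_b_eq (h0 s hs)]
    set β := b s - r₀ ^ 3 with hβd
    set u := A₃ (r₀ ^ 3) a b s with hud
    set D := rootF (r₀ ^ 3) a b s with hDd
    push_cast
    have e : 2 * a s * β / u - c * (3 * β ^ (3 - 1) * (u ^ 2 * D / (2 * β))) =
        β / u * (2 * a s - (3 / 2) * c * u ^ 3 * D) := by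
      field_simp
      ring
    rw [e]
    refine mul_nonneg (by positivity) (sub_nonneg.2 ?_)
    calc 3 / 2 * c * u ^ 3 * D ≤ 3 / 2 * c * U ^ 3 * (2 * a s) := by gcongr
      _ = (c * (3 * U ^ 3)) * a s := by ring
      _ ≤ 2 * a s := by gcongr

/-- `A₃` increases to a positive limit `L`, with rate `O(1 / (b - p))`. -/
theorem exists_A₃_limit (hM : IsB7Member r₀ abar bbar a b) :
    ∃ L, 0 < L ∧ (∀ t, 0 < t → A₃ (r₀ ^ 3) a b t ≤ L) ∧ Tendsto (A₃ (r₀ ^ 3) a b) atTop (𝓝 L) ∧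
      (fun t => A₃ (r₀ ^ 3) a b t - L) =O[atTop] fun t => (b t - r₀ ^ 3)⁻¹ := by
  obtain ⟨U, hU, hu⟩ := hM.exists_A₃_le
  obtain ⟨T, hT1, hT⟩ := hM.exists_forall_ge_bounds
  obtain ⟨c, hc, hac⟩ := hM.exists_a_sq_ge_cube
  have hβ : ∀ t, 0 < t → 0 < b t - r₀ ^ 3 := fun t ht => by linarith [hM.p_lt_b ht]
  have h0 : ∀ t, T ≤ t → 0 < t := fun t ht => by linarith
  have hmono : Monotone fun t => A₃ (r₀ ^ 3) a b (max t 1) := fun s t hst =>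
    hM.A₃_mono (by positivity) (max_le_max_right 1 hst)
  have hbdd : BddAbove (range fun t => A₃ (r₀ ^ 3) a b (max t 1)) :=
    ⟨U, by rintro _ ⟨t, rfl⟩; exact hu _ (by positivity)⟩
  set L := ⨆ t, A₃ (r₀ ^ 3) a b (max t 1) with hL
  have hle : ∀ t, 0 < t → A₃ (r₀ ^ 3) a b t ≤ L := fun t ht =>
    (hM.A₃_mono ht (le_max_left t 1)).trans (le_ciSup hbdd t)
  have hlim : Tendsto (A₃ (r₀ ^ 3) a b) atTop (𝓝 L) := by
    refine (tendsto_atTop_ciSup hmono hbdd).congr' ?_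
    filter_upwards [eventually_ge_atTop 1] with t ht
    rw [max_eq_left ht]
  have hL0 : 0 < L := (hM.A₃_pos one_pos).trans_le (hle 1 one_pos)
  refine ⟨L, hL0, hle, hlim, ?_⟩
  have key : ∀ t, T ≤ t → Real.log L ≤ Real.log (A₃ (r₀ ^ 3) a b t) + 2 / c * (b t - r₀ ^ 3)⁻¹ := by
    intro t ht
    have hanti : ∀ s, t ≤ s → Real.log (A₃ (r₀ ^ 3) a b s) + 2 / c * (b s - r₀ ^ 3)⁻¹ ≤
        Real.log (A₃ (r₀ ^ 3) a b t) + 2 / c * (b t - r₀ ^ 3)⁻¹ := by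
      intro s hs
      have h := le_of_hasDerivAt_nonneg (T := T)
        (f := fun t => -Real.log (A₃ (r₀ ^ 3) a b t) - 2 / c * (b t - r₀ ^ 3)⁻¹)
        (fun s hs => ((hM.hasDerivAt_log_A₃ (h0 s hs)).neg).sub
          ((((hM.hasDerivAt_b s).sub_const (r₀ ^ 3)).inv (hβ s (h0 s hs)).ne').const_mul (2 / c)))
        (fun s hs => ?_) ht hs
      · linarith
      · have hb := hβ s (h0 s hs)
        have hu := hM.A₃_pos (h0 s hs)
        have hD := hM.rootF_pos (h0 s hs)
        have ha := hM.a_pos (h0 s hs)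
        obtain ⟨h1, -, h3, -⟩ := hT s hs
        have h4 := hac s (hT1.trans hs)
        have hp := hM.p_pos
        have hbp := hM.p_lt_b (h0 s hs)
        have hbp' : 0 < b s + r₀ ^ 3 := by linarith
        rw [hM.deriv_b_eq (h0 s hs)]
        generalize b s + r₀ ^ 3 = q at *
        set β := b s - r₀ ^ 3 with hβd
        set u := A₃ (r₀ ^ 3) a b s with hud
        set D := rootF (r₀ ^ 3) a b s with hDd
        have e : -(u ^ 2 * q / (2 * β * D)) - 2 / c * (-(u ^ 2 * D / (2 * β)) / β ^ 2) =
            u ^ 2 / (2 * c * β ^ 3 * D) * (2 * D ^ 2 - c * q * β ^ 2) := by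
          field_simp
          ring
        rw [e]
        refine mul_nonneg (by positivity) (sub_nonneg.2 ?_)
        have h5 : a s ^ 2 ≤ D ^ 2 := by gcongr
        calc c * q * β ^ 2 ≤ c * (2 * β) * β ^ 2 := by gcongr
          _ = 2 * (c * β ^ 3) := by ring
          _ ≤ 2 * D ^ 2 := by linarith
    refine le_of_tendsto (hlim.log hL0.ne') ?_
    filter_upwards [eventually_ge_atTop t] with s hs
    have h1 := hanti s hs
    have h2 : 0 ≤ 2 / c * (b s - r₀ ^ 3)⁻¹ := by
      have := hβ s ((h0 t ht).trans_le hs)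
      positivity
    linarith
  refine IsBigO.of_bound (L * (2 / c)) ?_
  filter_upwards [eventually_ge_atTop T] with t ht
  have hb := hβ t (h0 t ht)
  have hut := hM.A₃_pos (h0 t ht)
  have h1 := key t ht
  have h2 : L * Real.exp (-(2 / c * (b t - r₀ ^ 3)⁻¹)) ≤ A₃ (r₀ ^ 3) a b t := by
    rw [← Real.log_le_log_iff (by positivity) hut, Real.log_mul hL0.ne' (Real.exp_pos _).ne',
      Real.log_exp]
    linarith
  have h3 := mul_le_mul_of_nonneg_left
    (Real.add_one_le_exp (-(2 / c * (b t - r₀ ^ 3)⁻¹))) hL0.le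
  rw [Real.norm_eq_abs, Real.norm_of_nonneg (by positivity),
    abs_of_nonpos (by linarith [hle t (h0 t ht)])]
  linarith

end IsB7Member

end B7

/-! ### Asymptotics of the metric coefficients -/

namespace B7

variable {r₀ abar bbar : ℝ} {a b : ℝ → ℝ}

namespace IsB7Member

/-- If `A₃ → L` then `a² / (b-p)³ → 2 / (3 L³)`: the derivative of `a² - 2 (b-p)³ / (3 L³)` is at
most that of a multiple of `(b-p)²`. -/
theorem a_sq_div_cube_isBigO (hM : IsB7Member r₀ abar bbar a b) {L : ℝ} (hL : 0 < L)
    (hle : ∀ t, 0 < t → A₃ (r₀ ^ 3) a b t ≤ L)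
    (hO : (fun t => A₃ (r₀ ^ 3) a b t - L) =O[atTop] fun t => (b t - r₀ ^ 3)⁻¹) :
    (fun t => a t ^ 2 / (b t - r₀ ^ 3) ^ 3 - 2 / (3 * L ^ 3)) =O[atTop]
      fun t => (b t - r₀ ^ 3)⁻¹ := by
  obtain ⟨T₁, hT₁1, hT₁⟩ := hM.exists_forall_ge_bounds
  obtain ⟨c, hc, hac⟩ := hM.exists_a_sq_ge_cube
  obtain ⟨C, hC0, hC⟩ := hO.exists_pos
  obtain ⟨T₂, hT₂⟩ := eventually_atTop.1 hC.bound
  have hβ : ∀ t, 0 < t → 0 < b t - r₀ ^ 3 := fun t ht => by linarith [hM.p_lt_b ht]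
  set T := max T₁ T₂ with hTd
  have h1T : ∀ t, T ≤ t → 1 ≤ t := fun t ht => by linarith [le_max_left T₁ T₂]
  have h0 : ∀ t, T ≤ t → 0 < t := fun t ht => by linarith [h1T t ht]
  set u₁ := A₃ (r₀ ^ 3) a b 1 with hu₁
  have hu₁0 : 0 < u₁ := hM.A₃_pos one_pos
  set N := (6 * L ^ 2 * C + 2 * L ^ 3 / c) / (u₁ * L ^ 3) / u₁ ^ 2 with hN
  have hN0 : 0 < N := by positivity
  set E' : ℝ → ℝ := fun t => (b t - r₀ ^ 3) / (A₃ (r₀ ^ 3) a b t * L ^ 3) *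
    (2 * a t * L ^ 3 - A₃ (r₀ ^ 3) a b t ^ 3 * rootF (r₀ ^ 3) a b t) with hE'
  have hE : ∀ t, T ≤ t → HasDerivAt
      (fun t => a t ^ 2 - 2 / (3 * L ^ 3) * (b t - r₀ ^ 3) ^ 3) (E' t) t := by
    intro t ht
    refine ((hM.hasDerivAt_a_sq (h0 t ht)).sub ((((hM.hasDerivAt_b t).sub_const
      (r₀ ^ 3)).fun_pow 3).const_mul (2 / (3 * L ^ 3)))).congr_deriv ?_
    have hb := hβ t (h0 t ht)
    have hu := hM.A₃_pos (h0 t ht)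
    rw [hM.deriv_b_eq (h0 t ht)]
    simp only [hE']
    push_cast
    field_simp
  have hB : ∀ t, T ≤ t → HasDerivAt (fun t => N * (b t - r₀ ^ 3) ^ 2)
      (N * (A₃ (r₀ ^ 3) a b t ^ 2 * rootF (r₀ ^ 3) a b t)) t := by
    intro t ht
    refine ((((hM.hasDerivAt_b t).sub_const (r₀ ^ 3)).fun_pow 2).const_mul N).congr_deriv ?_
    have hb := hβ t (h0 t ht)
    rw [hM.deriv_b_eq (h0 t ht)]
    push_cast
    field_simp
  have hEB : ∀ t, T ≤ t → |E' t| ≤ N * (A₃ (r₀ ^ 3) a b t ^ 2 * rootF (r₀ ^ 3) a b t) := by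
    intro t ht
    have ht0 := h0 t ht
    have hb := hβ t ht0
    have hu := hM.A₃_pos ht0
    have huL := hle t ht0
    have hu1 : u₁ ≤ A₃ (r₀ ^ 3) a b t := hM.A₃_mono one_pos (h1T t ht)
    have ha := hM.a_pos ht0
    have hD := hM.rootF_pos ht0
    have hD2 := hM.rootF_lt ht0
    have hDsq := hM.rootF_sq ht0
    obtain ⟨h1, -, h3, -⟩ := hT₁ t ((le_max_left _ _).trans ht)
    have h4 := hac t (h1T t ht)
    have h5 := hT₂ t ((le_max_right _ _).trans ht)
    have hp := hM.p_pos
    have hbp := hM.p_lt_b ht0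
    have hq : 0 < b t + r₀ ^ 3 := by linarith
    rw [Real.norm_eq_abs, Real.norm_of_nonneg (by positivity), abs_of_nonpos (by linarith)] at h5
    simp only [hE']
    generalize b t + r₀ ^ 3 = q at *
    set β := b t - r₀ ^ 3 with hβd
    set u := A₃ (r₀ ^ 3) a b t with hud
    set D := rootF (r₀ ^ 3) a b t with hDd
    have h6 : β * (L - u) ≤ C := by
      rw [neg_sub, ← div_eq_mul_inv, le_div_iff₀ hb] at h5
      linarith
    have h7 : β * (L ^ 3 - u ^ 3) ≤ 3 * L ^ 2 * C := by
      have e : β * (L ^ 3 - u ^ 3) = (L ^ 2 + L * u + u ^ 2) * (β * (L - u)) := by ring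
      have e2 : L ^ 2 + L * u + u ^ 2 ≤ 3 * L ^ 2 := by nlinarith
      rw [e]
      exact mul_le_mul e2 h6 (mul_nonneg hb.le (by linarith)) (by positivity)
    have h8 : β * (2 * a t - D) ≤ 2 * a t / c := by
      rw [le_div_iff₀ hc]
      have e1 : (2 * a t - D) * (2 * a t) ≤ 4 * β ^ 2 := by nlinarith
      have e2 : β * (2 * a t - D) * c * (2 * a t) ≤ 2 * a t * (2 * a t) := by
        calc β * (2 * a t - D) * c * (2 * a t) = β * c * ((2 * a t - D) * (2 * a t)) := by ring
          _ ≤ β * c * (4 * β ^ 2) := by gcongr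
          _ = 4 * (c * β ^ 3) := by ring
          _ ≤ 4 * a t ^ 2 := by gcongr
          _ = _ := by ring
      exact le_of_mul_le_mul_right e2 (by positivity)
    have h9 : u ^ 3 ≤ L ^ 3 := by gcongr
    have h10 : 0 ≤ 2 * a t * L ^ 3 - u ^ 3 * D := by
      have := mul_le_mul h9 hD2.le hD.le (by positivity)
      linarith
    rw [abs_of_nonneg (by positivity)]
    calc β / (u * L ^ 3) * (2 * a t * L ^ 3 - u ^ 3 * D)
        = (2 * a t * (β * (L ^ 3 - u ^ 3)) + u ^ 3 * (β * (2 * a t - D))) / (u * L ^ 3) := by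
          ring
      _ ≤ (2 * a t * (3 * L ^ 2 * C) + L ^ 3 * (2 * a t / c)) / (u₁ * L ^ 3) := by
          gcongr
      _ = N * (u₁ ^ 2 * a t) := by
          rw [hN]; field_simp; ring
      _ ≤ N * (u ^ 2 * D) := by gcongr
  set K := |a T ^ 2 - 2 / (3 * L ^ 3) * (b T - r₀ ^ 3) ^ 3| with hK
  have hbd : ∀ t, T ≤ t → |a t ^ 2 - 2 / (3 * L ^ 3) * (b t - r₀ ^ 3) ^ 3| ≤
      N * (b t - r₀ ^ 3) ^ 2 + K := by
    intro t ht
    have h1 := le_of_hasDerivAt_nonneg (fun s hs => (hB s hs).sub (hE s hs))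
      (fun s hs => by linarith [(abs_le.1 (hEB s hs)).2]) le_rfl ht
    have h2 := le_of_hasDerivAt_nonneg (fun s hs => (hB s hs).add (hE s hs))
      (fun s hs => by linarith [(abs_le.1 (hEB s hs)).1]) le_rfl ht
    simp only [Pi.add_apply, Pi.sub_apply] at h1 h2
    have h3 : 0 ≤ N * (b T - r₀ ^ 3) ^ 2 := by positivity
    have h4 := abs_le.1 (le_refl K)
    rw [abs_le]
    constructor <;> linarith [neg_abs_le (a T ^ 2 - 2 / (3 * L ^ 3) * (b T - r₀ ^ 3) ^ 3),
      le_abs_self (a T ^ 2 - 2 / (3 * L ^ 3) * (b T - r₀ ^ 3) ^ 3)]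
  refine IsBigO.of_bound (N + K / (b 1 - r₀ ^ 3) ^ 2) ?_
  filter_upwards [eventually_ge_atTop T] with t ht
  have hb := hβ t (h0 t ht)
  have hb1 := hβ 1 one_pos
  have hb2 : b 1 - r₀ ^ 3 ≤ b t - r₀ ^ 3 := by linarith [hM.b_mono one_pos (h1T t ht)]
  have hK0 : 0 ≤ K := abs_nonneg _
  have e : a t ^ 2 / (b t - r₀ ^ 3) ^ 3 - 2 / (3 * L ^ 3) =
      (a t ^ 2 - 2 / (3 * L ^ 3) * (b t - r₀ ^ 3) ^ 3) / (b t - r₀ ^ 3) ^ 3 := by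
    field_simp
  rw [e, Real.norm_eq_abs, abs_div, abs_of_pos (show 0 < (b t - r₀ ^ 3) ^ 3 by positivity),
    Real.norm_of_nonneg (by positivity), div_le_iff₀ (by positivity)]
  refine (hbd t ht).trans ?_
  have h1 : K ≤ K / (b 1 - r₀ ^ 3) ^ 2 * (b t - r₀ ^ 3) ^ 2 := by
    rw [div_mul_eq_mul_div, le_div_iff₀ (by positivity)]
    gcongr
  calc N * (b t - r₀ ^ 3) ^ 2 + K
      ≤ N * (b t - r₀ ^ 3) ^ 2 + K / (b 1 - r₀ ^ 3) ^ 2 * (b t - r₀ ^ 3) ^ 2 := by gcongr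
    _ = _ := by field_simp

/-- The limit of `A₃` is the length `ℓ` of the asymptotic circle. -/
theorem exists_asymptotics (hM : IsB7Member r₀ abar bbar a b) {ℓ : ℝ}
    (hℓ : IsCircleLength a b ℓ) :
    0 < ℓ ∧ (∀ t, 0 < t → A₃ (r₀ ^ 3) a b t ≤ ℓ) ∧ Tendsto (A₃ (r₀ ^ 3) a b) atTop (𝓝 ℓ) ∧
      ((fun t => A₃ (r₀ ^ 3) a b t - ℓ) =O[atTop] fun t => (b t - r₀ ^ 3)⁻¹) ∧
      ((fun t => a t ^ 2 / (b t - r₀ ^ 3) ^ 3 - 2 / (3 * ℓ ^ 3)) =O[atTop]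
        fun t => (b t - r₀ ^ 3)⁻¹) := by
  obtain ⟨L, hL, hle, hlim, hO⟩ := hM.exists_A₃_limit
  have hA := hM.a_sq_div_cube_isBigO hL hle hO
  suffices h : L = ℓ by subst h; exact ⟨hL, hle, hlim, hO, hA⟩
  have hinv : Tendsto (fun t => (b t - r₀ ^ 3)⁻¹) atTop (𝓝 0) :=
    tendsto_inv_atTop_zero.comp hM.tendsto_b
  have hA1 : Tendsto (fun t => a t ^ 2 / (b t - r₀ ^ 3) ^ 3) atTop (𝓝 (2 / (3 * L ^ 3))) :=
    tendsto_sub_nhds_zero_iff.1 (hA.trans_tendsto hinv)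
  have hb1 : Tendsto (fun t => 1 + r₀ ^ 3 * (b t - r₀ ^ 3)⁻¹) atTop (𝓝 (1 + r₀ ^ 3 * 0)) :=
    (hinv.const_mul _).const_add 1
  have h1 : Tendsto (fun t => 2 * (1 + r₀ ^ 3 * (b t - r₀ ^ 3)⁻¹) ^ 3 /
      (3 * (a t ^ 2 / (b t - r₀ ^ 3) ^ 3))) atTop (𝓝 (2 * (1 + r₀ ^ 3 * 0) ^ 3 /
        (3 * (2 / (3 * L ^ 3))))) :=
    ((hb1.pow 3).const_mul 2).div (hA1.const_mul 3) (by positivity)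
  have e : 2 * (1 + r₀ ^ 3 * 0) ^ 3 / (3 * (2 / (3 * L ^ 3))) = L ^ 3 := by
    field_simp; ring
  rw [e] at h1
  have h2 := h1.rpow_const (p := 1 / 3) (Or.inr (by norm_num))
  have e2 : (L ^ 3) ^ ((1 : ℝ) / 3) = L := by
    rw [← Real.rpow_natCast, ← Real.rpow_mul hL.le]; norm_num
  rw [e2] at h2
  refine tendsto_nhds_unique (h2.congr' ?_) hℓ
  filter_upwards [eventually_gt_atTop 0] with t ht
  have h3 : b t - r₀ ^ 3 ≠ 0 := by linarith [hM.p_lt_b ht]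
  have h4 := hM.a_pos ht
  congr 1
  field_simp
  ring_nf

end IsB7Member

end B7

/-! ### The coefficients of the instanton equations -/

/-- Differentiable functions preserve rates of convergence. -/
theorem DifferentiableAt.isBigO_comp_sub {E : Type*} [NormedAddCommGroup E] [NormedSpace ℝ E]
    {Φ : E → ℝ} {x₀ : E} {X : ℝ → E} {g : ℝ → ℝ} (hΦ : DifferentiableAt ℝ Φ x₀)
    (hX : (fun t => X t - x₀) =O[atTop] g) (hg : Tendsto g atTop (𝓝 0)) :
    (fun t => Φ (X t) - Φ x₀) =O[atTop] g := by
  have h : Tendsto X atTop (𝓝 x₀) := tendsto_sub_nhds_zero_iff.1 (hX.trans_tendsto hg)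
  exact (hΦ.isBigO_sub.comp_tendsto h).trans hX

namespace B7

variable {r₀ abar bbar : ℝ} {a b : ℝ → ℝ}

namespace IsB7Member

theorem A₁_sq (hM : IsB7Member r₀ abar bbar a b) {t : ℝ} (ht : 0 < t) :
    A₁ (r₀ ^ 3) a b t ^ 2 =
      (b t - r₀ ^ 3) * (2 * a t - b t - r₀ ^ 3) / (deriv a t * deriv b t) := by
  have h1 := hM.p_lt_b ht
  have h2 := hM.b_add_lt ht
  exact Real.sq_sqrt (div_nonneg (mul_nonneg (by linarith) (by linarith)) (hM.x₁_pos ht).le)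

theorem B₁_sq (hM : IsB7Member r₀ abar bbar a b) {t : ℝ} (ht : 0 < t) :
    B₁ (r₀ ^ 3) a b t ^ 2 =
      (b t - r₀ ^ 3) * (2 * a t + b t + r₀ ^ 3) / (deriv a t * deriv b t) := by
  have h1 := hM.p_lt_b ht
  have h2 := hM.a_pos ht
  have h3 := hM.p_pos
  exact Real.sq_sqrt (div_nonneg (mul_nonneg (by linarith) (by linarith)) (hM.x₁_pos ht).le)

theorem A₁_mul_B₁ (hM : IsB7Member r₀ abar bbar a b) {t : ℝ} (ht : 0 < t) :
    A₁ (r₀ ^ 3) a b t * B₁ (r₀ ^ 3) a b t = 2 * deriv a t := by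
  have h1 := hM.deriv_a_pos ht
  have h2 := hM.x₁_pos ht
  have h3 := hM.hamiltonian ht
  have h4 := hM.rootF_sq ht
  have hy := hM.deriv_b_pos ht
  have h5 : 0 ≤ A₁ (r₀ ^ 3) a b t * B₁ (r₀ ^ 3) a b t :=
    mul_nonneg (Real.sqrt_nonneg _) (Real.sqrt_nonneg _)
  refine (pow_left_inj₀ h5 (by positivity) two_ne_zero).1 ?_
  rw [mul_pow, hM.A₁_sq ht, hM.B₁_sq ht, div_mul_div_comm, div_eq_iff (by positivity)]
  have e : (b t - r₀ ^ 3) * (2 * a t - b t - r₀ ^ 3) *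
      ((b t - r₀ ^ 3) * (2 * a t + b t + r₀ ^ 3)) =
      ((b t - r₀ ^ 3) * rootF (r₀ ^ 3) a b t) ^ 2 := by
    rw [mul_pow, h4]; ring
  rw [e, ← h3]
  ring

/-- `coeffF` in terms of `a`, `b`, `A₃` and `D = rootF`, free of derivatives and square roots of
quotients. -/
theorem coeffF_eq (hM : IsB7Member r₀ abar bbar a b) {t : ℝ} (ht : 0 < t) :
    coeffF (r₀ ^ 3) a b t = -(A₃ (r₀ ^ 3) a b t)⁻¹ +
      2 * a t * (b t - r₀ ^ 3) / (A₃ (r₀ ^ 3) a b t * rootF (r₀ ^ 3) a b t ^ 2) +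
      A₃ (r₀ ^ 3) a b t ^ 2 * rootF (r₀ ^ 3) a b t / (4 * (b t - r₀ ^ 3) ^ 2) -
      A₃ (r₀ ^ 3) a b t ^ 2 * rootF (r₀ ^ 3) a b t /
        (4 * (b t - r₀ ^ 3) * (2 * a t - b t - r₀ ^ 3)) := by
  have hb : b t - r₀ ^ 3 ≠ 0 := by linarith [hM.p_lt_b ht]
  have hc : 2 * a t - b t - r₀ ^ 3 ≠ 0 := by linarith [hM.b_add_lt ht]
  have hu := hM.A₃_pos ht
  have hD := hM.rootF_pos ht
  unfold coeffF
  rw [hM.A₁_mul_B₁ ht, hM.A₁_sq ht, hM.B₁_sq ht, B₃, mul_assoc 2 (deriv a t), hM.x₁_eq ht,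
    hM.deriv_a_eq ht]
  generalize rootF (r₀ ^ 3) a b t = D at *
  generalize A₃ (r₀ ^ 3) a b t = u at *
  generalize hβ : b t - r₀ ^ 3 = β at *
  generalize hγ : 2 * a t - b t - r₀ ^ 3 = γ at *
  have e : 2 * a t + b t + r₀ ^ 3 = 4 * a t - γ := by rw [← hγ]; ring
  rw [e]
  field_simp
  ring

theorem coeffG_eq (hM : IsB7Member r₀ abar bbar a b) {t : ℝ} (ht : 0 < t) :
    coeffG (r₀ ^ 3) a b t = -(A₃ (r₀ ^ 3) a b t ^ 2 * (b t + r₀ ^ 3) /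
      (2 * (b t - r₀ ^ 3) * rootF (r₀ ^ 3) a b t)) := by
  have hb : b t - r₀ ^ 3 ≠ 0 := by linarith [hM.p_lt_b ht]
  have hc : 2 * a t - b t - r₀ ^ 3 ≠ 0 := by linarith [hM.b_add_lt ht]
  have hc' : 2 * a t + b t + r₀ ^ 3 ≠ 0 := by
    linarith [hM.a_pos ht, hM.p_lt_b ht, hM.p_pos]
  have hu := hM.A₃_pos ht
  have hD := hM.rootF_pos ht
  have hD2 : rootF (r₀ ^ 3) a b t ^ 2 =
      (2 * a t - b t - r₀ ^ 3) * (2 * a t + b t + r₀ ^ 3) := by rw [hM.rootF_sq ht]; ring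
  unfold coeffG
  rw [hM.A₁_sq ht, hM.B₁_sq ht, hM.x₁_eq ht]
  generalize rootF (r₀ ^ 3) a b t = D at *
  generalize A₃ (r₀ ^ 3) a b t = u at *
  generalize hβ : b t - r₀ ^ 3 = β at *
  have e : b t + r₀ ^ 3 = ((2 * a t + b t + r₀ ^ 3) - (2 * a t - b t - r₀ ^ 3)) / 2 := by ring
  rw [e]
  generalize 2 * a t - b t - r₀ ^ 3 = γ at *
  generalize 2 * a t + b t + r₀ ^ 3 = γ' at *
  field_simp
  rw [hD2]
  ring

/-- `A₃` solves the abelian equation `g' + coeffG g = 0`. -/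
theorem hasDerivAt_A₃' (hM : IsB7Member r₀ abar bbar a b) {t : ℝ} (ht : 0 < t) :
    HasDerivAt (A₃ (r₀ ^ 3) a b) (-(coeffG (r₀ ^ 3) a b t * A₃ (r₀ ^ 3) a b t)) t := by
  refine (hM.hasDerivAt_A₃ ht).congr_deriv ?_
  rw [hM.coeffG_eq ht]
  ring

/-- `√(b-p)` grows linearly: its derivative converges to `√(ℓ/6)`. -/
theorem exists_sqrt_asymptotics (hM : IsB7Member r₀ abar bbar a b) {ℓ : ℝ}
    (hℓ : IsCircleLength a b ℓ) :
    ((fun t => (b t - r₀ ^ 3)⁻¹) =O[atTop] fun t : ℝ => (t ^ 2)⁻¹) ∧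
    ((fun t => (√(b t - r₀ ^ 3))⁻¹ - (√(ℓ / 6) * t)⁻¹) =O[atTop] fun t : ℝ => (t ^ 2)⁻¹) ∧
    ((fun t => rootF (r₀ ^ 3) a b t / √(b t - r₀ ^ 3) ^ 3 - 4 * √(ℓ / 6) / ℓ ^ 2) =O[atTop]
      fun t => (b t - r₀ ^ 3)⁻¹) := by
  obtain ⟨hℓ0, hle, hlim, hu, hA⟩ := hM.exists_asymptotics hℓ
  have hβ : ∀ t, 0 < t → 0 < b t - r₀ ^ 3 := fun t ht => by linarith [hM.p_lt_b ht]
  have hinv : Tendsto (fun t => (b t - r₀ ^ 3)⁻¹) atTop (𝓝 0) :=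
    tendsto_inv_atTop_zero.comp hM.tendsto_b
  set c := √(ℓ / 6) with hc
  have hc0 : 0 < c := Real.sqrt_pos.2 (by positivity)
  have hc2 : c ^ 2 = ℓ / 6 := Real.sq_sqrt (by positivity)
  have hd : (fun t => rootF (r₀ ^ 3) a b t / √(b t - r₀ ^ 3) ^ 3 - 4 * c / ℓ ^ 2) =O[atTop]
      fun t => (b t - r₀ ^ 3)⁻¹ := by
    have hdiff : DifferentiableAt ℝ
        (fun x : ℝ × ℝ => √(4 * x.1 - x.2 * (1 + 2 * r₀ ^ 3 * x.2) ^ 2))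
        (2 / (3 * ℓ ^ 3), 0) := by
      refine DifferentiableAt.sqrt (by fun_prop) ?_
      simp only [zero_mul, sub_zero]
      positivity
    have h := hdiff.isBigO_comp_sub
      (X := fun t => (a t ^ 2 / (b t - r₀ ^ 3) ^ 3, (b t - r₀ ^ 3)⁻¹))
      (hA.prod_left ((isBigO_refl _ _).congr_left fun t => (sub_zero _).symm)) hinv
    refine h.congr' ?_ EventuallyEq.rfl
    filter_upwards [eventually_gt_atTop 0] with t ht
    have hb := hβ t ht
    have e1 : √(4 * (2 / (3 * ℓ ^ 3)) - 0 * (1 + 2 * r₀ ^ 3 * 0) ^ 2) = 4 * c / ℓ ^ 2 := by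
      rw [Real.sqrt_eq_iff_mul_self_eq_of_pos (by positivity)]
      have : 4 * c / ℓ ^ 2 * (4 * c / ℓ ^ 2) = 16 * c ^ 2 / ℓ ^ 4 := by ring
      rw [this, hc2]
      field_simp
      ring
    have e2 : √(4 * (a t ^ 2 / (b t - r₀ ^ 3) ^ 3) -
        (b t - r₀ ^ 3)⁻¹ * (1 + 2 * r₀ ^ 3 * (b t - r₀ ^ 3)⁻¹) ^ 2) =
        rootF (r₀ ^ 3) a b t / √(b t - r₀ ^ 3) ^ 3 := by
      have e3 : 4 * (a t ^ 2 / (b t - r₀ ^ 3) ^ 3) -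
        (b t - r₀ ^ 3)⁻¹ * (1 + 2 * r₀ ^ 3 * (b t - r₀ ^ 3)⁻¹) ^ 2 =
          (4 * a t ^ 2 - (b t + r₀ ^ 3) ^ 2) / (b t - r₀ ^ 3) ^ 3 := by
        field_simp; ring
      have e4 : √((b t - r₀ ^ 3) ^ 3) = √(b t - r₀ ^ 3) ^ 3 := by
        rw [Real.sqrt_eq_iff_mul_self_eq_of_pos (by positivity)]
        have : √(b t - r₀ ^ 3) ^ 3 * √(b t - r₀ ^ 3) ^ 3 = (√(b t - r₀ ^ 3) ^ 2) ^ 3 := by ring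
        rw [this, Real.sq_sqrt hb.le]
      rw [e3, Real.sqrt_div' _ (by positivity), e4, rootF]
    simp only [e1, e2]
  have hσd : ∀ t, 0 < t → HasDerivAt (fun t => √(b t - r₀ ^ 3))
      (A₃ (r₀ ^ 3) a b t ^ 2 * (rootF (r₀ ^ 3) a b t / √(b t - r₀ ^ 3) ^ 3) / 4) t := by
    intro t ht
    refine (((hM.hasDerivAt_b t).sub_const (r₀ ^ 3)).sqrt (hβ t ht).ne').congr_deriv ?_
    rw [hM.deriv_b_eq ht]
    have hb := hβ t ht
    have hσ : 0 < √(b t - r₀ ^ 3) := Real.sqrt_pos.2 hb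
    have hσ2 : b t - r₀ ^ 3 = √(b t - r₀ ^ 3) ^ 2 := (Real.sq_sqrt hb.le).symm
    generalize √(b t - r₀ ^ 3) = σ at *
    rw [hσ2]
    field_simp
    norm_num
  have hσO : (fun t => A₃ (r₀ ^ 3) a b t ^ 2 * (rootF (r₀ ^ 3) a b t / √(b t - r₀ ^ 3) ^ 3) / 4 -
      c) =O[atTop] fun t => (b t - r₀ ^ 3)⁻¹ := by
    have hdiff : DifferentiableAt ℝ (fun x : ℝ × ℝ => x.1 ^ 2 * x.2 / 4) (ℓ, 4 * c / ℓ ^ 2) := by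
      fun_prop
    refine (hdiff.isBigO_comp_sub (X := fun t => (A₃ (r₀ ^ 3) a b t,
      rootF (r₀ ^ 3) a b t / √(b t - r₀ ^ 3) ^ 3)) (hu.prod_left hd) hinv).congr_left fun t => ?_
    simp only
    congr 1
    field_simp
  have hσlim := tendsto_sub_nhds_zero_iff.1 (hσO.trans_tendsto hinv)
  obtain ⟨T, hT⟩ := eventually_atTop.1 ((hσlim.eventually_const_le
    (show c / 2 < c by linarith)).and (eventually_ge_atTop 1))
  have hσge : ∀ᶠ t in atTop, c / 4 * t ≤ √(b t - r₀ ^ 3) := by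
    have h1 : ∀ t, T ≤ t → √(b T - r₀ ^ 3) - c / 2 * T ≤ √(b t - r₀ ^ 3) - c / 2 * t :=
      fun t ht => le_of_hasDerivAt_nonneg (T := T) (f := fun t => √(b t - r₀ ^ 3) - c / 2 * t)
        (fun s hs => (hσd s (by linarith [(hT s hs).2])).sub
          ((hasDerivAt_id s).const_mul (c / 2)))
        (fun s hs => by have := (hT s hs).1; linarith) le_rfl ht
    filter_upwards [eventually_ge_atTop T, eventually_ge_atTop (2 * T)] with t ht ht2
    have h2 := h1 t ht
    have h3 := Real.sqrt_nonneg (b T - r₀ ^ 3)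
    nlinarith
  have hβO : (fun t => (b t - r₀ ^ 3)⁻¹) =O[atTop] fun t : ℝ => (t ^ 2)⁻¹ := by
    refine IsBigO.of_bound ((c / 4) ^ 2)⁻¹ ?_
    filter_upwards [hσge, eventually_gt_atTop 0] with t ht ht0
    have hb := hβ t ht0
    rw [Real.norm_of_nonneg (by positivity), Real.norm_of_nonneg (by positivity), ← mul_inv,
      ← mul_pow]
    refine inv_anti₀ (by positivity) ?_
    calc (c / 4 * t) ^ 2 ≤ √(b t - r₀ ^ 3) ^ 2 := by gcongr
      _ = _ := Real.sq_sqrt hb.le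
  refine ⟨hβO, ?_, hd⟩
  obtain ⟨k, hk⟩ := exists_sub_isBigO_of_hasDerivAt_isBigO (n := 1) one_ne_zero
    (r := fun t => √(b t - r₀ ^ 3) - c * t)
    (r' := fun t => A₃ (r₀ ^ 3) a b t ^ 2 *
      (rootF (r₀ ^ 3) a b t / √(b t - r₀ ^ 3) ^ 3) / 4 - c)
    ((eventually_gt_atTop 0).mono fun t ht => by
      refine ((hσd t ht).sub ((hasDerivAt_id t).const_mul c)).congr_deriv ?_
      simp) (hσO.trans hβO)
  have hk1 : (fun t => c * t - √(b t - r₀ ^ 3)) =O[atTop] fun _ : ℝ => (1 : ℝ) := by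
    have h1 : Tendsto (fun t : ℝ => (t ^ 1)⁻¹) atTop (𝓝 0) := by
      simpa using tendsto_inv_atTop_zero (𝕜 := ℝ)
    have h2 := tendsto_sub_nhds_zero_iff.1 (hk.trans_tendsto h1)
    refine (h2.neg.isBigO_one ℝ).congr_left fun t => ?_
    ring
  have hk2 : (fun t => (c * t * √(b t - r₀ ^ 3))⁻¹) =O[atTop] fun t : ℝ => (t ^ 2)⁻¹ := by
    refine IsBigO.of_bound (c ^ 2 / 4)⁻¹ ?_
    filter_upwards [hσge, eventually_gt_atTop 0] with t ht ht0
    have hb := hβ t ht0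
    have hσ : 0 < √(b t - r₀ ^ 3) := Real.sqrt_pos.2 hb
    rw [Real.norm_of_nonneg (by positivity), Real.norm_of_nonneg (by positivity), ← mul_inv]
    refine inv_anti₀ (by positivity) ?_
    calc c ^ 2 / 4 * t ^ 2 = c * t * (c / 4 * t) := by ring
      _ ≤ _ := by gcongr
  have h3 := hk1.mul hk2
  simp only [one_mul] at h3
  refine h3.congr' ?_ EventuallyEq.rfl
  filter_upwards [eventually_gt_atTop 0] with t ht
  have hσ : 0 < √(b t - r₀ ^ 3) := Real.sqrt_pos.2 (hβ t ht)
  field_simp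

theorem coeffF_asymptotics (hM : IsB7Member r₀ abar bbar a b) {ℓ : ℝ}
    (hℓ : IsCircleLength a b ℓ) :
    (fun t => coeffF (r₀ ^ 3) a b t - (-ℓ⁻¹ + 5 / 2 * t⁻¹)) =O[atTop] fun t : ℝ => (t ^ 2)⁻¹ := by
  obtain ⟨hℓ0, hle, hlim, hu, hA⟩ := hM.exists_asymptotics hℓ
  obtain ⟨hβO, hσ, hd⟩ := hM.exists_sqrt_asymptotics hℓ
  obtain ⟨T, hT1, hT⟩ := hM.exists_forall_ge_bounds
  have hβ : ∀ t, 0 < t → 0 < b t - r₀ ^ 3 := fun t ht => by linarith [hM.p_lt_b ht]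
  have hinv : Tendsto (fun t => (b t - r₀ ^ 3)⁻¹) atTop (𝓝 0) :=
    tendsto_inv_atTop_zero.comp hM.tendsto_b
  set c := √(ℓ / 6) with hc
  have hc0 : 0 < c := Real.sqrt_pos.2 (by positivity)
  have hc2 : c ^ 2 = ℓ / 6 := Real.sq_sqrt (by positivity)
  -- the constant term
  have h1 : (fun t => -(A₃ (r₀ ^ 3) a b t)⁻¹ - -ℓ⁻¹) =O[atTop] fun t : ℝ => (t ^ 2)⁻¹ := by
    have hdiff : DifferentiableAt ℝ (fun x : ℝ => -x⁻¹) ℓ := by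
      fun_prop (disch := exact hℓ0.ne')
    exact (hdiff.isBigO_comp_sub hu hinv).trans hβO
  have hA2 : (fun t => a t / √(b t - r₀ ^ 3) ^ 3 - 2 * c / ℓ ^ 2) =O[atTop]
      fun t => (b t - r₀ ^ 3)⁻¹ := by
    have hdiff : DifferentiableAt ℝ (fun x : ℝ => √x) (2 / (3 * ℓ ^ 3)) :=
      (Real.hasDerivAt_sqrt (by positivity)).differentiableAt
    refine (hdiff.isBigO_comp_sub hA hinv).congr' ?_ EventuallyEq.rfl
    filter_upwards [eventually_gt_atTop 0] with t ht
    have hb := hβ t ht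
    have ha := hM.a_pos ht
    have hσ0 : 0 < √(b t - r₀ ^ 3) := Real.sqrt_pos.2 hb
    congr 1
    · rw [Real.sqrt_eq_iff_mul_self_eq_of_pos (by positivity)]
      have : a t / √(b t - r₀ ^ 3) ^ 3 * (a t / √(b t - r₀ ^ 3) ^ 3) =
        a t ^ 2 / (√(b t - r₀ ^ 3) ^ 2) ^ 3 := by ring
      rw [this, Real.sq_sqrt hb.le]
    · rw [Real.sqrt_eq_iff_mul_self_eq_of_pos (by positivity)]
      have : 2 * c / ℓ ^ 2 * (2 * c / ℓ ^ 2) = 4 * c ^ 2 / ℓ ^ 4 := by ring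
      rw [this, hc2]
      field_simp
      norm_num
  have h2 : (fun t => (2 * (a t / √(b t - r₀ ^ 3) ^ 3) / (A₃ (r₀ ^ 3) a b t *
      (rootF (r₀ ^ 3) a b t / √(b t - r₀ ^ 3) ^ 3) ^ 2) + A₃ (r₀ ^ 3) a b t ^ 2 *
      (rootF (r₀ ^ 3) a b t / √(b t - r₀ ^ 3) ^ 3) / 4) - 5 / 2 * c) =O[atTop]
      fun t => (b t - r₀ ^ 3)⁻¹ := by
    have hdiff : DifferentiableAt ℝ (fun x : ℝ × ℝ × ℝ => 2 * x.2.1 / (x.1 * x.2.2 ^ 2) +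
        x.1 ^ 2 * x.2.2 / 4) (ℓ, 2 * c / ℓ ^ 2, 4 * c / ℓ ^ 2) := by
      have h : (ℓ * (4 * c / ℓ ^ 2) ^ 2) ≠ 0 := by positivity
      fun_prop (disch := exact h)
    refine (hdiff.isBigO_comp_sub (X := fun t => (A₃ (r₀ ^ 3) a b t,
      a t / √(b t - r₀ ^ 3) ^ 3, rootF (r₀ ^ 3) a b t / √(b t - r₀ ^ 3) ^ 3))
      (hu.prod_left (hA2.prod_left hd)) hinv).congr_left fun t => ?_
    simp only
    congr 1
    have : ℓ = 6 * c ^ 2 := by rw [hc2]; ring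
    field_simp
    rw [this]
    ring
  have hσO : (fun t => (√(b t - r₀ ^ 3))⁻¹) =O[atTop] fun _ : ℝ => (1 : ℝ) := by
    have h : Tendsto (fun t => (√(b t - r₀ ^ 3))⁻¹) atTop (𝓝 0) :=
      tendsto_inv_atTop_zero.comp (Real.tendsto_sqrt_atTop.comp hM.tendsto_b)
    exact h.isBigO_one ℝ
  -- the terms of order `t⁻¹`: the two middle summands in `coeffF_eq`, each divided and multiplied
  -- by `√(b-p)`, with `√(b-p) ~ √(ℓ/6) t`
  have h3 : (fun t => (√(b t - r₀ ^ 3))⁻¹ * (2 * (a t / √(b t - r₀ ^ 3) ^ 3) /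
      (A₃ (r₀ ^ 3) a b t * (rootF (r₀ ^ 3) a b t / √(b t - r₀ ^ 3) ^ 3) ^ 2) +
      A₃ (r₀ ^ 3) a b t ^ 2 * (rootF (r₀ ^ 3) a b t / √(b t - r₀ ^ 3) ^ 3) / 4) -
      5 / 2 * t⁻¹) =O[atTop] fun t : ℝ => (t ^ 2)⁻¹ := by
    have h4 := hσO.mul (h2.trans hβO)
    simp only [one_mul] at h4
    refine (h4.add (hσ.const_mul_left (5 / 2 * c))).congr_left fun t => ?_
    rw [mul_inv]
    field_simp
    ring
  -- the last summand is of order `t⁻²`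
  have h5 : (fun t => A₃ (r₀ ^ 3) a b t ^ 2 * rootF (r₀ ^ 3) a b t /
      (4 * (b t - r₀ ^ 3) * (2 * a t - b t - r₀ ^ 3))) =O[atTop] fun t : ℝ => (t ^ 2)⁻¹ := by
    refine IsBigO.trans (IsBigO.of_bound (ℓ ^ 2) ?_) hβO
    filter_upwards [eventually_ge_atTop T] with t ht
    have ht0 : 0 < t := by linarith
    obtain ⟨g1, g2, -, -⟩ := hT t ht
    have hb := hβ t ht0
    have ha := hM.a_pos ht0
    have hD := hM.rootF_pos ht0
    have hD2 := hM.rootF_lt ht0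
    have hu0 := hM.A₃_pos ht0
    have hul := hle t ht0
    have hq : a t / 2 ≤ 2 * a t - b t - r₀ ^ 3 := by linarith
    have hq0 : 0 < 2 * a t - b t - r₀ ^ 3 := by linarith
    rw [Real.norm_of_nonneg (by positivity), Real.norm_of_nonneg (by positivity),
      div_le_iff₀ (by positivity)]
    calc A₃ (r₀ ^ 3) a b t ^ 2 * rootF (r₀ ^ 3) a b t ≤ ℓ ^ 2 * (2 * a t) := by gcongr
      _ = ℓ ^ 2 * (4 * (a t / 2)) := by ring
      _ ≤ ℓ ^ 2 * (4 * (2 * a t - b t - r₀ ^ 3)) := by gcongr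
      _ = _ := by field_simp
  refine ((h1.add h3).sub h5).congr' ?_ EventuallyEq.rfl
  filter_upwards [eventually_gt_atTop 0] with t ht
  rw [hM.coeffF_eq ht]
  have hb := hβ t ht
  have hu0 := hM.A₃_pos ht
  have hD := hM.rootF_pos ht
  have hσ0 : 0 < √(b t - r₀ ^ 3) := Real.sqrt_pos.2 hb
  have hσ2 : b t - r₀ ^ 3 = √(b t - r₀ ^ 3) ^ 2 := (Real.sq_sqrt hb.le).symm
  have e1 : (√(b t - r₀ ^ 3))⁻¹ * (2 * (a t / √(b t - r₀ ^ 3) ^ 3) / (A₃ (r₀ ^ 3) a b t *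
      (rootF (r₀ ^ 3) a b t / √(b t - r₀ ^ 3) ^ 3) ^ 2) + A₃ (r₀ ^ 3) a b t ^ 2 *
      (rootF (r₀ ^ 3) a b t / √(b t - r₀ ^ 3) ^ 3) / 4) =
      2 * a t * (b t - r₀ ^ 3) / (A₃ (r₀ ^ 3) a b t * rootF (r₀ ^ 3) a b t ^ 2) +
      A₃ (r₀ ^ 3) a b t ^ 2 * rootF (r₀ ^ 3) a b t / (4 * (b t - r₀ ^ 3) ^ 2) := by
    generalize √(b t - r₀ ^ 3) = σ at *
    rw [hσ2]
    field_simp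
  rw [e1]
  ring

end IsB7Member

end B7

/-! ### Integrating factors -/

theorem Function.Even.pos_of_pos {f : ℝ → ℝ} (hf : Function.Even f) (h0 : 0 < f 0)
    (h : ∀ t, 0 < t → 0 < f t) (t : ℝ) : 0 < f t := by
  rcases lt_trichotomy t 0 with ht | rfl | ht
  · rw [← hf]; exact h _ (by linarith)
  · exact h0
  · exact h t ht

namespace B7

/-- The integrating factors of the instanton equations. The function `t ψ(t)` solves
`φ' + coeffF φ = 0`, normalised by `φ ~ e^{t/ℓ} t^{-5/2}` at infinity; `A₃ = t u(t)` solves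
`g' + coeffG g = 0`; and `θ` is the primitive of `A₃ / ℓ` with `θ - t → 0`. -/
structure IsIntegratingFactors (p ℓ : ℝ) (a b ψ u θ : ℝ → ℝ) : Prop where
  ℓ_pos : 0 < ℓ
  smooth_ψ : ContDiff ℝ ∞ ψ
  smooth_u : ContDiff ℝ ∞ u
  smooth_θ : ContDiff ℝ ∞ θ
  even_ψ : Function.Even ψ
  even_u : Function.Even u
  even_θ : Function.Even θ
  ψ_pos : ∀ t, 0 < ψ t
  u_pos : ∀ t, 0 < u t
  u_zero : u 0 = 1 / 2
  A₃_eq : ∀ t, A₃ p a b t = t * u t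
  hasDerivAt_A₃ : ∀ t, 0 < t → HasDerivAt (A₃ p a b) (-(coeffG p a b t * A₃ p a b t)) t
  hasDerivAt_φ : ∀ t, 0 < t →
    HasDerivAt (fun t => t * ψ t) (-(coeffF p a b t * (t * ψ t))) t
  hasDerivAt_θ : ∀ t, HasDerivAt θ (t * u t / ℓ) t
  le_θ : ∀ t, 0 ≤ t → t ≤ θ t
  tendsto_A₃ : Tendsto (fun t => t * u t) atTop (𝓝 ℓ)
  θ_isBigO : (fun t => θ t - t) =O[atTop] fun t : ℝ => t⁻¹
  φ_isBigO : (fun t => t * ψ t * Real.exp (-(ℓ⁻¹ * t)) * t ^ ((5 : ℝ) / 2) - 1) =O[atTop]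
    fun t : ℝ => t⁻¹

variable {r₀ abar bbar : ℝ} {a b : ℝ → ℝ}

namespace IsB7Member

/-- Near the singular orbit `A₃ = t u` and `coeffF = -1/t + e` with `u` smooth, even and positive
and `e` smooth and odd. All functions involved are built from the smooth even functions `(a-p)/t²` and
`(b-p)/t²`. -/
theorem exists_smooth_factors (hM : IsB7Member r₀ abar bbar a b) :
    ∃ u e : ℝ → ℝ, ContDiff ℝ ∞ u ∧ Function.Even u ∧ (∀ t, 0 < u t) ∧ u 0 = 1 / 2 ∧
      (∀ t, A₃ (r₀ ^ 3) a b t = t * u t) ∧ ContDiff ℝ ∞ e ∧ Function.Odd e ∧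
      ∀ t, 0 < t → t * coeffF (r₀ ^ 3) a b t = -1 + t * e t := by
  obtain ⟨α, hα, hαe, hαa, hα0⟩ := hM.exists_a_factor
  obtain ⟨β, hβ, hβe, hβb, hβ0⟩ := hM.exists_b_factor
  have hr := hM.r₀_pos
  set a₁ : ℝ → ℝ := fun t => 2 * α t + t * deriv α t with ha₁
  have hα' := (contDiff_infty_iff_deriv.1 hα).2
  have ha₁s : ContDiff ℝ ∞ a₁ := by fun_prop
  have hda : ∀ t, deriv a t = t * a₁ t := by
    intro t
    have h1 : HasDerivAt (fun t => t ^ 2 * α t + r₀ ^ 3)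
        ((2 * t) * α t + t ^ 2 * deriv α t) t := by
      have h2 := (((hasDerivAt_pow 2 t).mul
        (hα.differentiable (by simp) t).hasDerivAt)).add_const (r₀ ^ 3)
      refine h2.congr_deriv ?_
      simp
    have h2 : (fun t => t ^ 2 * α t + r₀ ^ 3) = a := funext fun t => by rw [← hαa]; ring
    rw [h2] at h1
    rw [h1.deriv, ha₁]
    ring
  have ha₁e : Function.Even a₁ := hM.even_a.odd_deriv.even_of_eq_mul hda
  have ha₁0 : a₁ 0 = r₀ / 2 := by simp only [ha₁, hα0]; ring
  have ha₁p : ∀ t, 0 < a₁ t := ha₁e.pos_of_pos (by rw [ha₁0]; positivity) fun t ht => by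
    have := hM.deriv_a_pos ht
    rw [hda] at this
    exact pos_of_mul_pos_right this ht.le
  have hβp : ∀ t, 0 < β t := hβe.pos_of_pos (by rw [hβ0]; positivity) fun t ht => by
    have h1 := hM.p_lt_b ht
    have h2 := hβb t
    exact pos_of_mul_pos_right (by linarith : 0 < t ^ 2 * β t) (sq_nonneg t)
  set γ : ℝ → ℝ := fun t => 2 * α t - β t with hγ
  have hγe : Function.Even γ := fun t => by simp only [hγ, hαe t, hβe t]
  have hγa : ∀ t, 2 * a t - b t - r₀ ^ 3 = t ^ 2 * γ t := fun t => by
    have h1 := hαa t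
    have h2 := hβb t
    simp only [hγ]
    linarith
  have hγ0 : γ 0 = r₀ / 4 := by simp only [hγ, hα0, hβ0]; ring
  have hγp : ∀ t, 0 < γ t := hγe.pos_of_pos (by rw [hγ0]; positivity) fun t ht => by
    have h1 := hM.b_add_lt ht
    have h2 := hγa t
    exact pos_of_mul_pos_right (by linarith : 0 < t ^ 2 * γ t) (sq_nonneg t)
  set s : ℝ → ℝ := fun t => 2 * a t + b t + r₀ ^ 3 with hs
  have hse : Function.Even s := fun t => by simp only [hs, hM.even_a t, hM.even_b t]
  have hs0 : s 0 = 4 * r₀ ^ 3 := by simp only [hs, hM.a_zero, hM.b_zero]; ring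
  have hsp : ∀ t, 0 < s t := hse.pos_of_pos (by rw [hs0]; positivity) fun t ht => by
    have h1 := hM.a_pos ht
    have h2 := hM.p_lt_b ht
    have h3 := hM.p_pos
    simp only [hs]
    linarith
  have hαs := hM.smooth_a
  have hβs := hM.smooth_b
  have hss : ContDiff ℝ ∞ s := by fun_prop
  have hγs : ContDiff ℝ ∞ γ := by fun_prop
  set d : ℝ → ℝ := fun t => √(γ t * s t) with hd
  have hdp : ∀ t, 0 < d t := fun t => Real.sqrt_pos.2 (mul_pos (hγp t) (hsp t))
  have hds : ContDiff ℝ ∞ d := (hγs.mul hss).sqrt fun t => (mul_pos (hγp t) (hsp t)).ne'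
  have hde : Function.Even d := fun t => by simp only [hd, hγe t, hse t]
  have hd0 : d 0 = r₀ ^ 2 := by
    simp only [hd, hγ0, hs0]
    rw [Real.sqrt_eq_iff_mul_self_eq_of_pos (by positivity)]
    ring
  have hdD : ∀ t, 0 < t → rootF (r₀ ^ 3) a b t = t * d t := by
    intro t ht
    have : 4 * a t ^ 2 - (b t + r₀ ^ 3) ^ 2 = t ^ 2 * (γ t * s t) := by
      rw [← mul_assoc, ← hγa]
      simp only [hs]
      ring
    rw [rootF, this, Real.sqrt_mul (sq_nonneg t), Real.sqrt_sq ht.le]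
  set u : ℝ → ℝ := fun t => β t / a₁ t with hu
  have hup : ∀ t, 0 < u t := fun t => div_pos (hβp t) (ha₁p t)
  have hus : ContDiff ℝ ∞ u := hβ.div ha₁s fun t => (ha₁p t).ne'
  have hue : Function.Even u := fun t => by simp only [hu, hβe t, ha₁e t]
  have hu0 : u 0 = 1 / 2 := by
    simp only [hu, hβ0, ha₁0]
    field_simp
    norm_num
  have huA : ∀ t, A₃ (r₀ ^ 3) a b t = t * u t := by
    intro t
    rcases eq_or_ne t 0 with rfl | ht
    · simp [A₃, hM.deriv_a_zero]
    · have := (ha₁p t).ne'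
      simp only [A₃, hu, hda, hβb]
      field_simp
  set C : ℝ → ℝ := fun t => -(u t)⁻¹ + 2 * a t * β t / (u t * d t ^ 2) +
    u t ^ 2 * d t / (4 * β t ^ 2) - u t ^ 2 * d t / (4 * β t * γ t) with hC
  have hCe : Function.Even C := fun t => by
    simp only [hC, hue t, hde t, hβe t, hγe t, hM.even_a t]
  have hCs : ContDiff ℝ ∞ C := by
    refine (((hus.inv fun t => (hup t).ne').neg.add (ContDiff.div (by fun_prop) (by fun_prop)
      fun t => ?_)).add (ContDiff.div (by fun_prop) (by fun_prop) fun t => ?_)).sub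
      (ContDiff.div (by fun_prop) (by fun_prop) fun t => ?_)
    · have := hup t; have := hdp t; positivity
    · have := hβp t; positivity
    · have := hβp t; have := hγp t; positivity
  have hC0 : C 0 = -1 := by
    simp only [hC, hu0, hd0, hβ0, hγ0, hM.a_zero]
    field_simp
    norm_num
  have hCF : ∀ t, 0 < t → t * coeffF (r₀ ^ 3) a b t = C t := by
    intro t ht
    have h1 := hup t
    have h2 := hdp t
    have h3 := hβp t
    have h4 := hγp t
    rw [hM.coeffF_eq ht, huA, hdD t ht, hβb, hγa]
    simp only [hC]
    field_simp
  obtain ⟨e, he, hCe'⟩ := (hCs.add contDiff_const).exists_eq_mul_of_apply_zero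
    (f := fun t => C t + 1) (by rw [hC0]; ring)
  refine ⟨u, e, hus, hue, hup, hu0, huA, he, ?_, fun t ht => ?_⟩
  · exact Function.Even.odd_of_eq_mul (f := fun t => C t + 1) (fun t => by simp only [hCe t])
      he.continuous hCe'
  · have := hCe' t
    rw [hCF t ht]
    linarith

theorem exists_integratingFactors (hM : IsB7Member r₀ abar bbar a b) {ℓ : ℝ}
    (hℓ : IsCircleLength a b ℓ) :
    ∃ ψ u θ : ℝ → ℝ, IsIntegratingFactors (r₀ ^ 3) ℓ a b ψ u θ := by
  obtain ⟨hℓ0, hle, hlim, hu, -⟩ := hM.exists_asymptotics hℓ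
  obtain ⟨hβO, -, -⟩ := hM.exists_sqrt_asymptotics hℓ
  obtain ⟨u, e, hus, hue, hup, hu0, huA, hes, heo, hF⟩ := hM.exists_smooth_factors
  have hder : ∀ {f : ℝ → ℝ}, Continuous f → ∀ t,
      HasDerivAt (fun t => ∫ s in (0 : ℝ)..t, f s) (f t) t := fun hf t =>
    intervalIntegral.integral_hasDerivAt_right (hf.intervalIntegrable _ _)
      (hf.stronglyMeasurableAtFilter _ _) hf.continuousAt
  -- the solution of `φ' + coeffF φ = 0`
  set J : ℝ → ℝ := fun t => ∫ s in (0 : ℝ)..t, e s with hJ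
  have hJd : ∀ t, HasDerivAt J (e t) t := hder hes.continuous
  have hφd : ∀ t, 0 < t → HasDerivAt (fun t => t * Real.exp (-J t))
      (-(coeffF (r₀ ^ 3) a b t * (t * Real.exp (-J t)))) t := by
    intro t ht
    refine ((hasDerivAt_id t).mul ((hJd t).neg.exp)).congr_deriv ?_
    have := hF t ht
    have e1 : -(coeffF (r₀ ^ 3) a b t * (t * Real.exp (-J t))) =
      -(t * coeffF (r₀ ^ 3) a b t) * Real.exp (-J t) := by ring
    rw [e1, this]
    simp only [id, Pi.neg_apply]
    ring
  obtain ⟨R, hR⟩ := exists_sub_isBigO_of_hasDerivAt_isBigO (n := 1) one_ne_zero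
    (r := fun t => Real.log (t * Real.exp (-J t)) - ℓ⁻¹ * t + 5 / 2 * Real.log t)
    (r' := fun t => -(coeffF (r₀ ^ 3) a b t - (-ℓ⁻¹ + 5 / 2 * t⁻¹)))
    ((eventually_gt_atTop 0).mono fun t ht => by
      refine ((((hφd t ht).log (by positivity)).sub ((hasDerivAt_id t).const_mul ℓ⁻¹)).add
        ((Real.hasDerivAt_log ht.ne').const_mul (5 / 2))).congr_deriv ?_
      have := Real.exp_pos (-J t)
      field_simp
      ring) (hM.coeffF_asymptotics hℓ).neg_left
  -- the primitive of `A₃ / ℓ`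
  have hθc : ContDiff ℝ ∞ fun t => t * u t / ℓ := by fun_prop
  set Q : ℝ → ℝ := fun t => ∫ s in (0 : ℝ)..t, s * u s / ℓ with hQ
  have hQd : ∀ t, HasDerivAt Q (t * u t / ℓ) t := hder hθc.continuous
  have hQr : ∀ t, HasDerivAt (fun t => Q t - t) (t * u t / ℓ - 1) t := fun t =>
    (hQd t).sub (hasDerivAt_id t)
  obtain ⟨R', hR'⟩ := exists_sub_isBigO_of_hasDerivAt_isBigO (n := 1) one_ne_zero
    (Eventually.of_forall hQr) (by
      refine ((hu.trans hβO).const_mul_left ℓ⁻¹).congr_left fun t => ?_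
      rw [huA]
      field_simp)
  simp only [pow_one] at hR hR'
  refine ⟨fun t => Real.exp (-R) * Real.exp (-J t), u, fun t => Q t - R',
    { ℓ_pos := hℓ0
      smooth_ψ := contDiff_const.mul (hes.contDiff_integral.neg.exp)
      smooth_u := hus
      smooth_θ := hθc.contDiff_integral.sub contDiff_const
      even_ψ := fun t => ?_
      even_u := hue
      even_θ := fun t => ?_
      ψ_pos := fun t => by positivity
      u_pos := hup
      u_zero := hu0
      A₃_eq := huA
      hasDerivAt_A₃ := fun t ht => hM.hasDerivAt_A₃' ht
      hasDerivAt_φ := fun t ht => ?_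
      hasDerivAt_θ := fun t => (hQd t).sub_const R'
      le_θ := fun t ht => ?_
      tendsto_A₃ := by simpa only [funext huA] using hlim
      θ_isBigO := hR'.congr_left fun t => by ring
      φ_isBigO := ?_ }⟩
  · have h := heo.even_integral t
    simp only at h
    simp only [hJ, h]
  · have h := Function.Odd.even_integral (f := fun t => t * u t / ℓ)
      (fun t => by simp only [hue t]; ring) t
    simp only at h
    simp only [hQ, h]
  · have h := (hφd t ht).const_mul (Real.exp (-R))
    refine (h.congr_deriv (by ring)).congr_of_eventuallyEq (Eventually.of_forall fun s => ?_)
    simp only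
    ring
  · have hinv : Tendsto (fun t : ℝ => t⁻¹) atTop (𝓝 0) := tendsto_inv_atTop_zero
    have h1 := tendsto_sub_nhds_zero_iff.1 (hR'.trans_tendsto hinv)
    have h2 : R' ≤ Q t - t := by
      refine le_of_tendsto h1 ?_
      filter_upwards [eventually_ge_atTop t] with s hs
      have h3 := le_of_hasDerivAt_nonneg_of_continuous (f := fun t => -(Q t - t))
        (continuous_iff_continuousAt.2 fun t => (hQr t).neg.continuousAt)
        (fun t _ => (hQr t).neg) (fun t ht => by
          have := hle t ht
          rw [huA] at this
          have h4 : t * u t / ℓ ≤ 1 := (div_le_one hℓ0).2 this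
          linarith) ht hs
      linarith
    linarith
  · have hinv : Tendsto (fun t : ℝ => t⁻¹) atTop (𝓝 0) := tendsto_inv_atTop_zero
    have h := (Real.differentiable_exp (x := (0 : ℝ))).isBigO_comp_sub
      (X := fun t => Real.log (t * Real.exp (-J t)) - ℓ⁻¹ * t + 5 / 2 * Real.log t - R)
      (hR.congr_left fun t => (sub_zero _).symm) hinv
    refine h.congr' ?_ EventuallyEq.rfl
    filter_upwards [eventually_gt_atTop 0] with t ht
    rw [Real.exp_zero]
    congr 1
    have e1 : Real.log (t * Real.exp (-J t)) - ℓ⁻¹ * t + 5 / 2 * Real.log t - R =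
      Real.log (t * Real.exp (-J t)) + -R + -(ℓ⁻¹ * t) + Real.log t * (5 / 2) := by ring
    rw [e1, Real.exp_add, Real.exp_add, Real.exp_add, Real.exp_log (by positivity),
      ← Real.rpow_def_of_pos ht]
    ring

end IsB7Member

end B7

/-! ### The instanton equations in normalised variables -/

namespace B7

/-- The weight `ω = ℓ φ² / A₃`, where `φ = t ψ` and `A₃ = t u`; the quotient is written so that it
is smooth at `t = 0`. -/
noncomputable def weight (ℓ : ℝ) (ψ u : ℝ → ℝ) (t : ℝ) : ℝ := ℓ * t * ψ t ^ 2 / u t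

/-- The instanton equations in the variables `(h, κ)` with `g = A₃ h / ℓ` and
`f = φ e^{-θ h} κ`. -/
noncomputable def field (ℓ : ℝ) (ψ u θ : ℝ → ℝ) (t : ℝ) (x : ℝ × ℝ) : ℝ × ℝ :=
  (-(weight ℓ ψ u t * Real.exp (-(2 * θ t * x.1)) * x.2 ^ 2),
    -(θ t * weight ℓ ψ u t * Real.exp (-(2 * θ t * x.1)) * x.2 ^ 3))

/-- The component `f` of the instanton with normalised variables `X = (h, κ)`. -/
noncomputable def fOf (ψ θ : ℝ → ℝ) (X : ℝ → ℝ × ℝ) (t : ℝ) : ℝ :=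
  t * ψ t * Real.exp (-(θ t * (X t).1)) * (X t).2

/-- The component `g` of the instanton with normalised variables `X = (h, κ)`. -/
noncomputable def gOf (ℓ : ℝ) (u : ℝ → ℝ) (X : ℝ → ℝ × ℝ) (t : ℝ) : ℝ :=
  t * u t * (X t).1 / ℓ

/-- The normalised variables `(h, κ)` of an instanton `(f, g)`, the inverse of `fOf` and `gOf` for
`t > 0`. -/
noncomputable def stateOf (ℓ : ℝ) (ψ u θ f g : ℝ → ℝ) (t : ℝ) : ℝ × ℝ :=
  (ℓ * g t / (t * u t), f t * Real.exp (θ t * (ℓ * g t / (t * u t))) / (t * ψ t))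

namespace IsIntegratingFactors

variable {p ℓ : ℝ} {a b ψ u θ : ℝ → ℝ}

theorem weight_nonneg (hI : IsIntegratingFactors p ℓ a b ψ u θ) {t : ℝ} (ht : 0 ≤ t) :
    0 ≤ weight ℓ ψ u t := by
  have h1 := hI.ℓ_pos
  have h2 := hI.ψ_pos t
  have h3 := hI.u_pos t
  unfold weight
  positivity

theorem smooth_weight (hI : IsIntegratingFactors p ℓ a b ψ u θ) :
    ContDiff ℝ ∞ (weight ℓ ψ u) := by
  have h1 := hI.smooth_ψ
  have h2 := hI.smooth_u
  exact ContDiff.div (by fun_prop) h2 fun t => (hI.u_pos t).ne'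

theorem θ_nonneg (hI : IsIntegratingFactors p ℓ a b ψ u θ) {t : ℝ} (ht : 0 ≤ t) : 0 ≤ θ t :=
  ht.trans (hI.le_θ t ht)

theorem fOf_stateOf (hI : IsIntegratingFactors p ℓ a b ψ u θ) {f g : ℝ → ℝ} {t : ℝ}
    (ht : 0 < t) : fOf ψ θ (stateOf ℓ ψ u θ f g) t = f t := by
  have h2 := hI.ψ_pos t
  simp only [fOf, stateOf]
  rw [Real.exp_neg]
  have := Real.exp_pos (θ t * (ℓ * g t / (t * u t)))
  field_simp

theorem gOf_stateOf (hI : IsIntegratingFactors p ℓ a b ψ u θ) {f g : ℝ → ℝ} {t : ℝ}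
    (ht : 0 < t) : gOf ℓ u (stateOf ℓ ψ u θ f g) t = g t := by
  have h1 := hI.ℓ_pos
  have h2 := hI.u_pos t
  simp only [gOf, stateOf]
  field_simp

theorem hasDerivAt_stateOf (hI : IsIntegratingFactors p ℓ a b ψ u θ) {S : ℝ} (hS : 0 ≤ S)
    {f g : ℝ → ℝ} (h : SolvesOn p a b (Ioi S) f g) {t : ℝ} (ht : S < t) :
    HasDerivAt (stateOf ℓ ψ u θ f g) (field ℓ ψ u θ t (stateOf ℓ ψ u θ f g t)) t := by
  have ht0 : 0 < t := hS.trans_lt ht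
  have hℓ := hI.ℓ_pos
  have hu := hI.u_pos t
  have hψ := hI.ψ_pos t
  obtain ⟨hf, hg⟩ := h t ht
  have hA : HasDerivAt (fun t => t * u t) (-(coeffG p a b t * (t * u t))) t := by
    have := hI.hasDerivAt_A₃ t ht0
    rwa [show A₃ p a b = fun t => t * u t from funext hI.A₃_eq] at this
  have hh := (hg.const_mul ℓ).div hA (by positivity)
  have hκ := (hf.mul ((hI.hasDerivAt_θ t).mul hh).exp).div (hI.hasDerivAt_φ t ht0) (by positivity)
  refine HasDerivAt.congr_deriv (hh.prodMk hκ) ?_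
  have hE := Real.exp_pos (θ t * (ℓ * g t / (t * u t)))
  have hE2 : Real.exp (-(2 * θ t * (ℓ * g t / (t * u t)))) =
      (Real.exp (θ t * (ℓ * g t / (t * u t))) ^ 2)⁻¹ := by
    rw [← Real.exp_nat_mul, ← Real.exp_neg]
    congr 1
    push_cast
    ring
  simp only [field, stateOf, weight, Pi.mul_apply, Pi.div_apply, hE2]
  generalize Real.exp (θ t * (ℓ * g t / (t * u t))) = E at *
  refine Prod.ext ?_ ?_
  · simp only
    field_simp
    ring
  · simp only
    field_simp
    ring

theorem solvesOn_of_hasDerivAt (hI : IsIntegratingFactors p ℓ a b ψ u θ) {X : ℝ → ℝ × ℝ}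
    (hX : ∀ t, 0 < t → HasDerivAt X (field ℓ ψ u θ t (X t)) t) :
    SolvesOn p a b (Ioi 0) (fOf ψ θ X) (gOf ℓ u X) := by
  intro t ht
  have ht0 : 0 < t := ht
  have hℓ := hI.ℓ_pos
  have hu := hI.u_pos t
  have hψ := hI.ψ_pos t
  have hA : HasDerivAt (fun t => t * u t) (-(coeffG p a b t * (t * u t))) t := by
    have := hI.hasDerivAt_A₃ t ht0
    rwa [show A₃ p a b = fun t => t * u t from funext hI.A₃_eq] at this
  have h1 := (hX t ht0).fst
  have h2 := (hX t ht0).snd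
  have hE2 : Real.exp (-(2 * θ t * (X t).1)) = Real.exp (-(θ t * (X t).1)) ^ 2 := by
    rw [← Real.exp_nat_mul]
    congr 1
    push_cast
    ring
  constructor
  · refine (((hI.hasDerivAt_φ t ht0).mul ((hI.hasDerivAt_θ t).mul h1).neg.exp).mul
      h2).congr_deriv ?_
    simp only [field, fOf, gOf, Pi.mul_apply, Pi.neg_apply, weight, hE2]
    generalize Real.exp (-(θ t * (X t).1)) = E at *
    field_simp
    ring
  · refine ((hA.mul h1).div_const ℓ).congr_deriv ?_
    simp only [field, fOf, gOf, weight, hE2]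
    generalize Real.exp (-(θ t * (X t).1)) = E at *
    field_simp
    ring

end IsIntegratingFactors

end B7

/-! ### Behaviour of solutions at infinity -/

namespace B7

namespace IsIntegratingFactors

variable {p ℓ : ℝ} {a b ψ u θ : ℝ → ℝ}

/-- Above the threshold `ℓ⁻¹` the coefficients of the normalised system decay exponentially; a cubic
rate is all that is needed. -/
theorem exists_weight_le (hI : IsIntegratingFactors p ℓ a b ψ u θ) {m : ℝ} (hm : ℓ⁻¹ < m) :
    ∃ B, 0 < B ∧ ∀ t, 0 ≤ t →
      weight ℓ ψ u t * (1 + θ t) ^ 2 * Real.exp (-(2 * θ t * m)) ≤ B / (1 + t) ^ 3 := by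
  have hℓ := hI.ℓ_pos
  have hm0 : 0 < m := (inv_pos.2 hℓ).trans hm
  set q : ℝ → ℝ := fun t =>
    weight ℓ ψ u t * (1 + θ t) ^ 2 * Real.exp (-(2 * θ t * m)) * (1 + t) ^ 3 with hq
  have hqc : Continuous q := by
    have h1 := hI.smooth_weight.continuous
    have h2 := hI.smooth_θ.continuous
    fun_prop
  have hinv : Tendsto (fun t : ℝ => t⁻¹) atTop (𝓝 0) := tendsto_inv_atTop_zero
  have e1 := (tendsto_sub_nhds_zero_iff.1 (hI.φ_isBigO.trans_tendsto hinv)).eventually_le_const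
    (show (1 : ℝ) < 2 by norm_num)
  have e2 := (hI.θ_isBigO.trans_tendsto hinv).eventually_le_const (show (0 : ℝ) < 1 by norm_num)
  have e3 := hI.tendsto_A₃.eventually_const_le (show ℓ / 2 < ℓ by linarith)
  have e4 := (isLittleO_pow_exp_pos_mul_atTop 5 (show 0 < 2 * (m - ℓ⁻¹) by linarith)).bound
    one_pos
  have hev : ∀ᶠ t in atTop, q t ≤ 576 := by
    filter_upwards [e1, e2, e3, e4, eventually_ge_atTop 1] with t h1 h2 h3 h4 ht
    have ht0 : 0 < t := by linarith
    have hψ := hI.ψ_pos t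
    have hu := hI.u_pos t
    have hθ := hI.le_θ t ht0.le
    have hexp := Real.exp_pos (ℓ⁻¹ * t)
    have h5 : t * ψ t ≤ 2 * Real.exp (ℓ⁻¹ * t) := by
      have h6 : 1 ≤ t ^ ((5 : ℝ) / 2) := Real.one_le_rpow ht (by norm_num)
      rw [Real.exp_neg, mul_assoc, mul_assoc] at h1
      have h7 : t * ψ t * (Real.exp (ℓ⁻¹ * t))⁻¹ ≤ 2 := by
        refine le_trans ?_ h1
        rw [← mul_assoc, ← mul_assoc]
        exact le_mul_of_one_le_right (by positivity) h6
      rwa [← div_eq_mul_inv, div_le_iff₀ hexp] at h7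
    have h8 : weight ℓ ψ u t ≤ 8 * Real.exp (2 * (ℓ⁻¹ * t)) := by
      have h9 : weight ℓ ψ u t = ℓ * (t * ψ t) ^ 2 / (t * u t) := by
        unfold weight; field_simp
      have h10 : Real.exp (2 * (ℓ⁻¹ * t)) = Real.exp (ℓ⁻¹ * t) ^ 2 := by
        rw [← Real.exp_nat_mul]; norm_num
      rw [h9, h10, div_le_iff₀ (by positivity)]
      calc ℓ * (t * ψ t) ^ 2 ≤ ℓ * (2 * Real.exp (ℓ⁻¹ * t)) ^ 2 := by gcongr
        _ = 8 * Real.exp (ℓ⁻¹ * t) ^ 2 * (ℓ / 2) := by ring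
        _ ≤ _ := by gcongr
    have h11 : t ^ 5 ≤ Real.exp (2 * (m - ℓ⁻¹) * t) := by
      rwa [one_mul, Real.norm_of_nonneg (by positivity),
        Real.norm_of_nonneg (Real.exp_pos _).le] at h4
    have h12 : Real.exp (-(2 * θ t * m)) ≤ Real.exp (-(2 * t * m)) := by
      apply Real.exp_le_exp.2
      nlinarith
    have hθ0 : 0 ≤ θ t := ht0.le.trans hθ
    calc q t ≤ 8 * Real.exp (2 * (ℓ⁻¹ * t)) * (3 * t) ^ 2 * Real.exp (-(2 * t * m)) *
          (2 * t) ^ 3 := by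
          have := hI.weight_nonneg ht0.le
          simp only [hq]
          gcongr <;> linarith
      _ = 576 * t ^ 5 * (Real.exp (2 * (ℓ⁻¹ * t)) * Real.exp (-(2 * t * m))) := by ring
      _ ≤ 576 * Real.exp (2 * (m - ℓ⁻¹) * t) *
          (Real.exp (2 * (ℓ⁻¹ * t)) * Real.exp (-(2 * t * m))) := by gcongr
      _ = 576 := by
          rw [mul_assoc, ← Real.exp_add, ← Real.exp_add]
          have : 2 * (m - ℓ⁻¹) * t + (2 * (ℓ⁻¹ * t) + -(2 * t * m)) = 0 := by ring
          rw [this, Real.exp_zero, mul_one]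
  obtain ⟨T, hT⟩ := eventually_atTop.1 hev
  obtain ⟨C, hC⟩ := (isCompact_Icc (a := (0 : ℝ)) (b := T)).exists_bound_of_continuousOn
    hqc.continuousOn
  refine ⟨max C 576, by positivity, fun t ht => ?_⟩
  rw [le_div_iff₀ (by positivity)]
  rcases le_total T t with h | h
  · exact (hT t h).trans (le_max_right _ _)
  · exact ((le_abs_self _).trans (hC t ⟨ht, h⟩)).trans (le_max_left _ _)

section Solution

variable {S : ℝ} {X : ℝ → ℝ × ℝ}

theorem antitoneOn_fst (hI : IsIntegratingFactors p ℓ a b ψ u θ) (hS : 0 ≤ S)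
    (hX : ∀ t, S < t → HasDerivAt X (field ℓ ψ u θ t (X t)) t) :
    AntitoneOn (fun t => (X t).1) (Ioi S) := by
  have hd : ∀ t, S < t → HasDerivAt (fun t => (X t).1) (field ℓ ψ u θ t (X t)).1 t :=
    fun t ht => (hX t ht).fst
  refine antitoneOn_of_hasDerivWithinAt_nonpos (convex_Ioi S)
    (fun t ht => (hd t ht).continuousAt.continuousWithinAt)
    (fun t ht => (hd t (interior_subset ht)).hasDerivWithinAt) fun t ht => ?_
  have ht0 : S < t := interior_subset ht
  have := hI.weight_nonneg (hS.trans ht0.le)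
  simp only [field, neg_nonpos]
  positivity

theorem antitoneOn_snd_sq (hI : IsIntegratingFactors p ℓ a b ψ u θ) (hS : 0 ≤ S)
    (hX : ∀ t, S < t → HasDerivAt X (field ℓ ψ u θ t (X t)) t) :
    AntitoneOn (fun t => (X t).2 ^ 2) (Ioi S) := by
  have hd : ∀ t, S < t → HasDerivAt (fun t => (X t).2) (field ℓ ψ u θ t (X t)).2 t :=
    fun t ht => (hX t ht).snd
  refine antitoneOn_of_hasDerivWithinAt_nonpos (convex_Ioi S)
    (fun t ht => ((hd t ht).fun_pow 2).continuousAt.continuousWithinAt)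
    (fun t ht => ((hd t (interior_subset ht)).fun_pow 2).hasDerivWithinAt) fun t ht => ?_
  have ht0 : S < t := interior_subset ht
  have h1 := hI.weight_nonneg (hS.trans ht0.le)
  have h2 := hI.θ_nonneg (hS.trans ht0.le)
  have e : ((2 : ℕ) : ℝ) * (X t).2 ^ (2 - 1) * (field ℓ ψ u θ t (X t)).2 =
      -(2 * (θ t * weight ℓ ψ u t * Real.exp (-(2 * θ t * (X t).1)) * (X t).2 ^ 4)) := by
    simp only [field]
    push_cast
    ring
  rw [e, neg_nonpos]
  positivity

theorem le_fst (hI : IsIntegratingFactors p ℓ a b ψ u θ) (hS : 0 ≤ S)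
    (hX : ∀ t, S < t → HasDerivAt X (field ℓ ψ u θ t (X t)) t) {G : ℝ}
    (hG : Tendsto (fun t => (X t).1) atTop (𝓝 G)) {t : ℝ} (ht : S < t) : G ≤ (X t).1 := by
  refine le_of_tendsto hG ?_
  filter_upwards [eventually_ge_atTop t] with s hs
  exact hI.antitoneOn_fst hS hX ht (ht.trans_le hs) hs

/-- If `h` converges to a limit above the threshold `ℓ⁻¹` then `κ` converges, and both do so fast
enough to determine the end data. -/
theorem exists_snd_isBigO (hI : IsIntegratingFactors p ℓ a b ψ u θ) (hS : 0 ≤ S)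
    (hX : ∀ t, S < t → HasDerivAt X (field ℓ ψ u θ t (X t)) t) {G : ℝ}
    (hG : Tendsto (fun t => (X t).1) atTop (𝓝 G)) (hGℓ : ℓ⁻¹ < G) :
    ((fun t => (X t).1 - G) =O[atTop] fun t : ℝ => (t ^ 2)⁻¹) ∧
      ∃ lam, (fun t => (X t).2 - lam) =O[atTop] fun t : ℝ => t⁻¹ := by
  obtain ⟨B, hB, hw⟩ := hI.exists_weight_le hGℓ
  set κ := |(X (S + 1)).2| with hκ
  have hκ0 : 0 ≤ κ := abs_nonneg _
  have hκle : ∀ t, S + 1 ≤ t → |(X t).2| ≤ κ := fun t ht => by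
    have h := hI.antitoneOn_snd_sq hS hX (show S < S + 1 by linarith) (show S < t by linarith) ht
    exact sq_le_sq.1 h
  have hbd : ∀ t, S + 1 ≤ t → weight ℓ ψ u t * (1 + θ t) ^ 2 * Real.exp (-(2 * θ t * (X t).1)) ≤
      B * (t ^ 3)⁻¹ := by
    intro t ht
    have ht0 : 0 < t := by linarith
    have h1 := hI.weight_nonneg ht0.le
    have h2 := hI.θ_nonneg ht0.le
    have h3 := hI.le_fst hS hX hG (show S < t by linarith)
    calc _ ≤ weight ℓ ψ u t * (1 + θ t) ^ 2 * Real.exp (-(2 * θ t * G)) := by gcongr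
      _ ≤ B / (1 + t) ^ 3 := hw t ht0.le
      _ ≤ B / t ^ 3 := by gcongr; linarith
      _ = _ := div_eq_mul_inv _ _
  have hd1 : (fun t => (field ℓ ψ u θ t (X t)).1) =O[atTop] fun t : ℝ => (t ^ (2 + 1))⁻¹ := by
    refine IsBigO.of_bound (B * κ ^ 2) ?_
    filter_upwards [eventually_ge_atTop (S + 1)] with t ht
    have ht0 : 0 < t := by linarith
    have h1 := hI.weight_nonneg ht0.le
    have h2 := hI.θ_nonneg ht0.le
    have h3 : (X t).2 ^ 2 ≤ κ ^ 2 := by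
      rw [← sq_abs]; exact pow_le_pow_left₀ (abs_nonneg _) (hκle t ht) 2
    simp only [field, norm_neg]
    rw [Real.norm_of_nonneg (by positivity), Real.norm_of_nonneg (by positivity)]
    calc weight ℓ ψ u t * Real.exp (-(2 * θ t * (X t).1)) * (X t).2 ^ 2
        ≤ weight ℓ ψ u t * (1 + θ t) ^ 2 * Real.exp (-(2 * θ t * (X t).1)) * κ ^ 2 := by
          gcongr
          exact le_mul_of_one_le_right h1 (one_le_pow₀ (by linarith))
      _ ≤ B * (t ^ 3)⁻¹ * κ ^ 2 := by exact mul_le_mul_of_nonneg_right (hbd t ht) (by positivity)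
      _ = _ := by ring
  have hd2 : (fun t => (field ℓ ψ u θ t (X t)).2) =O[atTop] fun t : ℝ => (t ^ (1 + 1))⁻¹ := by
    refine IsBigO.of_bound (B * κ ^ 3) ?_
    filter_upwards [eventually_ge_atTop (S + 1)] with t ht
    have ht1 : 1 ≤ t := by linarith
    have ht0 : 0 < t := by linarith
    have h1 := hI.weight_nonneg ht0.le
    have h2 := hI.θ_nonneg ht0.le
    have h3 : |(X t).2| ^ 3 ≤ κ ^ 3 := pow_le_pow_left₀ (abs_nonneg _) (hκle t ht) 3
    simp only [field, norm_neg]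
    rw [Real.norm_eq_abs, abs_mul, abs_pow, abs_of_nonneg (show 0 ≤ θ t * weight ℓ ψ u t *
      Real.exp (-(2 * θ t * (X t).1)) by positivity), Real.norm_of_nonneg (by positivity)]
    calc θ t * weight ℓ ψ u t * Real.exp (-(2 * θ t * (X t).1)) * |(X t).2| ^ 3
        ≤ (1 + θ t) ^ 2 * weight ℓ ψ u t * Real.exp (-(2 * θ t * (X t).1)) * κ ^ 3 := by
          gcongr
          nlinarith
      _ = weight ℓ ψ u t * (1 + θ t) ^ 2 * Real.exp (-(2 * θ t * (X t).1)) * κ ^ 3 := by ring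
      _ ≤ B * (t ^ 3)⁻¹ * κ ^ 3 := by exact mul_le_mul_of_nonneg_right (hbd t ht) (by positivity)
      _ ≤ B * (t ^ (1 + 1))⁻¹ * κ ^ 3 := by
          gcongr
          norm_num
      _ = _ := by ring
  have hev : ∀ᶠ t in atTop, S < t := eventually_gt_atTop S
  obtain ⟨G', hG'⟩ := exists_sub_isBigO_of_hasDerivAt_isBigO two_ne_zero
    (hev.mono fun t ht => (hX t ht).fst) hd1
  obtain ⟨lam, hlam⟩ := exists_sub_isBigO_of_hasDerivAt_isBigO one_ne_zero
    (hev.mono fun t ht => (hX t ht).snd) hd2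
  have hsq : Tendsto (fun t : ℝ => (t ^ 2)⁻¹) atTop (𝓝 0) :=
    tendsto_inv_atTop_zero.comp (tendsto_pow_atTop two_ne_zero)
  have : G' = G := tendsto_nhds_unique (tendsto_sub_nhds_zero_iff.1 (hG'.trans_tendsto hsq)) hG
  subst this
  exact ⟨hG', lam, by simpa only [pow_one] using hlam⟩

/-- The rate for `h` makes `θ h - G t` of order `t⁻¹`, so that `e^{-θ h}` may be replaced by
`e^{-G t}` in `f = φ e^{-θ h} κ`. -/
theorem hasEndData_of_isBigO (hI : IsIntegratingFactors p ℓ a b ψ u θ) {G lam : ℝ}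
    (hG : (fun t => (X t).1 - G) =O[atTop] fun t : ℝ => (t ^ 2)⁻¹)
    (hlam : (fun t => (X t).2 - lam) =O[atTop] fun t : ℝ => t⁻¹) :
    HasEndData ℓ (G, lam) (fOf ψ θ X) (gOf ℓ u X) := by
  have hℓ := hI.ℓ_pos
  have hinv : Tendsto (fun t : ℝ => t⁻¹) atTop (𝓝 0) := tendsto_inv_atTop_zero
  have hsq : Tendsto (fun t : ℝ => (t ^ 2)⁻¹) atTop (𝓝 0) :=
    tendsto_inv_atTop_zero.comp (tendsto_pow_atTop two_ne_zero)
  have hlim := tendsto_sub_nhds_zero_iff.1 (hG.trans_tendsto hsq)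
  refine ⟨?_, ?_⟩
  · have h := (hI.tendsto_A₃.mul hlim).div_const ℓ
    have e : ℓ * G / ℓ = G := by field_simp
    rw [e] at h
    exact h
  -- the exponent `θ h - G t` tends to zero
  have h1 : (fun t => θ t * ((X t).1 - G)) =O[atTop] fun t : ℝ => t⁻¹ := by
    have h2 : θ =O[atTop] fun t : ℝ => t := by
      have h3 : (fun t => θ t - t) =O[atTop] fun t : ℝ => t := by
        refine hI.θ_isBigO.trans (IsBigO.of_bound 1 ?_)
        filter_upwards [eventually_ge_atTop 1] with t ht
        rw [one_mul, norm_inv]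
        rw [Real.norm_of_nonneg (by linarith)]
        exact (inv_le_one_of_one_le₀ ht).trans ht
      exact (h3.add (isBigO_refl _ _)).congr_left fun t => by ring
    refine (h2.mul hG).congr' EventuallyEq.rfl ?_
    filter_upwards [eventually_gt_atTop 0] with t ht
    field_simp
  have h4 : (fun t => θ t * (X t).1 - G * t) =O[atTop] fun t : ℝ => t⁻¹ :=
    (h1.add (hI.θ_isBigO.const_mul_left G)).congr_left fun t => by ring
  have h5 : (fun t => Real.exp (-(θ t * (X t).1 - G * t)) - 1) =O[atTop] fun t : ℝ => t⁻¹ := by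
    have h := (Real.differentiable_exp (x := (0 : ℝ))).isBigO_comp_sub
      (X := fun t => -(θ t * (X t).1 - G * t)) (h4.neg_left.congr_left fun t => (sub_zero _).symm)
      hinv
    simpa only [Real.exp_zero] using h
  have h6 : (fun t => t * ψ t * Real.exp (-(ℓ⁻¹ * t)) * t ^ ((5 : ℝ) / 2) *
      Real.exp (-(θ t * (X t).1 - G * t)) * (X t).2 - lam) =O[atTop] fun t : ℝ => t⁻¹ := by
    have hdiff : DifferentiableAt ℝ (fun x : ℝ × ℝ × ℝ => x.1 * x.2.1 * x.2.2) (1, 1, lam) := by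
      fun_prop
    have h := hdiff.isBigO_comp_sub (X := fun t => (t * ψ t * Real.exp (-(ℓ⁻¹ * t)) *
      t ^ ((5 : ℝ) / 2), Real.exp (-(θ t * (X t).1 - G * t)), (X t).2))
      (hI.φ_isBigO.prod_left (h5.prod_left hlam)) hinv
    simpa only [one_mul] using h
  have h7 := (isBigO_refl (fun t : ℝ => Real.exp ((ℓ⁻¹ - G) * t) * t ^ (-(5 : ℝ) / 2)) atTop).mul h6
  refine h7.congr' ?_ ?_
  · filter_upwards [eventually_gt_atTop 0] with t ht
    have e1 : t ^ (-(5 : ℝ) / 2) * t ^ ((5 : ℝ) / 2) = 1 := by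
      rw [← Real.rpow_add ht]; norm_num
    have e2 : Real.exp ((ℓ⁻¹ - G) * t) * (Real.exp (-(ℓ⁻¹ * t)) *
        Real.exp (-(θ t * (X t).1 - G * t))) = Real.exp (-(θ t * (X t).1)) := by
      rw [← Real.exp_add, ← Real.exp_add]
      congr 1
      ring
    simp only [fOf]
    rw [← e2]
    linear_combination (Real.exp ((ℓ⁻¹ - G) * t) * (Real.exp (-(ℓ⁻¹ * t)) *
        Real.exp (-(θ t * (X t).1 - G * t))) * (t * ψ t) * (X t).2) * e1
  · filter_upwards [eventually_gt_atTop 0] with t ht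
    rw [mul_assoc, ← Real.rpow_neg_one t, ← Real.rpow_add ht]
    norm_num

end Solution

end IsIntegratingFactors

theorem HasEndData.congr {ℓ : ℝ} {e : ℝ × ℝ} {f g f' g' : ℝ → ℝ} (h : HasEndData ℓ e f g)
    (hf : f =ᶠ[atTop] f') (hg : g =ᶠ[atTop] g') : HasEndData ℓ e f' g' :=
  ⟨h.1.congr' hg, h.2.congr' (hf.sub EventuallyEq.rfl) EventuallyEq.rfl⟩

theorem HasEndData.snd_unique {ℓ G lam lam' : ℝ} {f g : ℝ → ℝ} (h : HasEndData ℓ (G, lam) f g)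
    (h' : HasEndData ℓ (G, lam') f g) : lam = lam' := by
  have h1 := h'.2.sub h.2
  have h2 := (isBigO_refl (fun t : ℝ => (Real.exp ((ℓ⁻¹ - G) * t))⁻¹ * t ^ ((5 : ℝ) / 2)) atTop).mul
    h1
  have h3 : (fun _ : ℝ => lam - lam') =O[atTop] fun t : ℝ => t⁻¹ := by
    refine h2.congr' ?_ ?_
    · filter_upwards [eventually_gt_atTop 0] with t ht
      have e1 : t ^ ((5 : ℝ) / 2) * t ^ (-(5 : ℝ) / 2) = 1 := by
        rw [← Real.rpow_add ht]; norm_num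
      have e2 := inv_mul_cancel₀ (Real.exp_pos ((ℓ⁻¹ - G) * t)).ne'
      linear_combination (lam - lam') * (t ^ ((5 : ℝ) / 2) * t ^ (-(5 : ℝ) / 2)) * e2 +
        (lam - lam') * e1
    · filter_upwards [eventually_gt_atTop 0] with t ht
      have e1 : t ^ ((5 : ℝ) / 2) * t ^ (-(7 : ℝ) / 2) = t⁻¹ := by
        rw [← Real.rpow_add ht, ← Real.rpow_neg_one]; norm_num
      have e2 := inv_mul_cancel₀ (Real.exp_pos ((ℓ⁻¹ - G) * t)).ne'
      linear_combination (t ^ ((5 : ℝ) / 2) * t ^ (-(7 : ℝ) / 2)) * e2 + e1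
  have h4 := tendsto_nhds_unique (h3.trans_tendsto tendsto_inv_atTop_zero) tendsto_const_nhds
  linarith

namespace IsIntegratingFactors

variable {p ℓ : ℝ} {a b ψ u θ : ℝ → ℝ}

theorem stateOf_fst_tendsto (hI : IsIntegratingFactors p ℓ a b ψ u θ) {f g : ℝ → ℝ} {G : ℝ}
    (hg : Tendsto g atTop (𝓝 G)) :
    Tendsto (fun t => (stateOf ℓ ψ u θ f g t).1) atTop (𝓝 G) := by
  have hℓ := hI.ℓ_pos
  have h := (hg.const_mul ℓ).div hI.tendsto_A₃ hℓ.ne'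
  have e : ℓ * G / ℓ = G := by field_simp
  rwa [e] at h

theorem exists_hasEndData (hI : IsIntegratingFactors p ℓ a b ψ u θ) {S : ℝ} (hS : 0 ≤ S)
    {f g : ℝ → ℝ} (h : SolvesOn p a b (Ioi S) f g) {G : ℝ} (hG : Tendsto g atTop (𝓝 G))
    (hGℓ : ℓ⁻¹ < G) :
    ∃ lam, HasEndData ℓ (G, lam) f g ∧ Tendsto (stateOf ℓ ψ u θ f g) atTop (𝓝 (G, lam)) := by
  obtain ⟨h1, lam, h2⟩ := hI.exists_snd_isBigO hS (fun t ht => hI.hasDerivAt_stateOf hS h ht)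
    (hI.stateOf_fst_tendsto (f := f) hG) hGℓ
  refine ⟨lam, (hI.hasEndData_of_isBigO h1 h2).congr ?_ ?_,
    (hI.stateOf_fst_tendsto (f := f) hG).prodMk_nhds
      (tendsto_sub_nhds_zero_iff.1 (h2.trans_tendsto tendsto_inv_atTop_zero))⟩
  · filter_upwards [eventually_gt_atTop 0] with t ht
    exact hI.fOf_stateOf ht
  · filter_upwards [eventually_gt_atTop 0] with t ht
    exact hI.gOf_stateOf ht

/-- The end data of an end solution with `G > ℓ⁻¹` is the limit of its normalised variables. -/
theorem tendsto_stateOf (hI : IsIntegratingFactors p ℓ a b ψ u θ) {S : ℝ} (hS : 0 ≤ S)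
    {f g : ℝ → ℝ} (h : SolvesOn p a b (Ioi S) f g) {e : ℝ × ℝ} (he : HasEndData ℓ e f g)
    (heℓ : ℓ⁻¹ < e.1) : Tendsto (stateOf ℓ ψ u θ f g) atTop (𝓝 e) := by
  obtain ⟨lam, h1, h2⟩ := hI.exists_hasEndData hS h he.1 heℓ
  have h3 : e.2 = lam := HasEndData.snd_unique (G := e.1) he h1
  rw [← h3] at h2
  exact h2

theorem hasEndData_of_tendsto (hI : IsIntegratingFactors p ℓ a b ψ u θ) {X : ℝ → ℝ × ℝ}
    (hX : ∀ t, 0 < t → HasDerivAt X (field ℓ ψ u θ t (X t)) t) {e : ℝ × ℝ}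
    (he : Tendsto X atTop (𝓝 e)) (heℓ : ℓ⁻¹ < e.1) :
    HasEndData ℓ e (fOf ψ θ X) (gOf ℓ u X) := by
  obtain ⟨h1, lam, h2⟩ := hI.exists_snd_isBigO le_rfl hX he.fst_nhds heℓ
  have h3 : lam = e.2 := tendsto_nhds_unique
    (tendsto_sub_nhds_zero_iff.1 (h2.trans_tendsto tendsto_inv_atTop_zero)) he.snd_nhds
  subst h3
  exact hI.hasEndData_of_isBigO h1 h2

end IsIntegratingFactors

end B7

/-! ### The flow from infinity to the singular orbit -/

namespace B7

/-- Retraction of `ℝ` onto `[m, M]`. -/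
noncomputable def clamp (m M x : ℝ) : ℝ := max m (min M x)

theorem le_clamp (m M x : ℝ) : m ≤ clamp m M x := le_max_left _ _

theorem clamp_le {m M : ℝ} (h : m ≤ M) (x : ℝ) : clamp m M x ≤ M := max_le h (min_le_left _ _)

theorem clamp_of_mem {m M x : ℝ} (h : x ∈ Icc m M) : clamp m M x = x := by
  rw [clamp, min_eq_right h.2, max_eq_right h.1]

theorem abs_clamp_sub_clamp_le (m M x y : ℝ) : |clamp m M x - clamp m M y| ≤ |x - y| := by
  have h1 := abs_max_sub_max_le_abs (min M x) (min M y) m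
  have h2 := abs_min_sub_min_le_max M x M y
  rw [sub_self, abs_zero, max_eq_right (abs_nonneg _)] at h2
  rw [clamp, clamp, max_comm m, max_comm m]
  exact h1.trans h2

theorem abs_exp_neg_sub_exp_neg_le {θ m x y : ℝ} (hθ : 0 ≤ θ) (hx : m ≤ x) (hy : m ≤ y) :
    |Real.exp (-(2 * θ * x)) - Real.exp (-(2 * θ * y))| ≤
      2 * θ * Real.exp (-(2 * θ * m)) * |x - y| := by
  wlog hxy : x ≤ y generalizing x y
  · rw [abs_sub_comm, abs_sub_comm x y]
    exact this hy hx (le_of_not_ge hxy)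
  have h1 : Real.exp (-(2 * θ * y)) = Real.exp (-(2 * θ * x)) * Real.exp (-(2 * θ * (y - x))) := by
    rw [← Real.exp_add]; congr 1; ring
  have h2 := Real.add_one_le_exp (-(2 * θ * (y - x)))
  have h3 : Real.exp (-(2 * θ * x)) ≤ Real.exp (-(2 * θ * m)) := by
    apply Real.exp_le_exp.2; nlinarith
  have h4 : 0 ≤ 2 * θ * (y - x) := mul_nonneg (by linarith) (by linarith)
  have h5 : Real.exp (-(2 * θ * (y - x))) ≤ 1 := Real.exp_le_one_iff.2 (by linarith)
  rw [abs_sub_comm x y, abs_of_nonneg (sub_nonneg.2 hxy), h1]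
  have e : Real.exp (-(2 * θ * x)) - Real.exp (-(2 * θ * x)) * Real.exp (-(2 * θ * (y - x))) =
    Real.exp (-(2 * θ * x)) * (1 - Real.exp (-(2 * θ * (y - x)))) := by ring
  rw [e, abs_of_nonneg (mul_nonneg (Real.exp_pos _).le (by linarith))]
  calc _ ≤ Real.exp (-(2 * θ * m)) * (2 * θ * (y - x)) := by gcongr; linarith
    _ = _ := by ring

/-- The normalised field, made constant in each variable outside the box `[m, M] × [-M, M]`. -/
noncomputable def clampedField (ℓ : ℝ) (ψ u θ : ℝ → ℝ) (m M t : ℝ) (x : ℝ × ℝ) : ℝ × ℝ :=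
  field ℓ ψ u θ t (clamp m M x.1, clamp (-M) M x.2)

namespace IsIntegratingFactors

variable {p ℓ : ℝ} {a b ψ u θ : ℝ → ℝ}

theorem norm_field_le (hI : IsIntegratingFactors p ℓ a b ψ u θ) {m M t : ℝ} (hM : 1 ≤ M)
    (ht : 0 ≤ t) {x : ℝ × ℝ} (hx : m ≤ x.1) (hx2 : |x.2| ≤ M) :
    ‖field ℓ ψ u θ t x‖ ≤
      weight ℓ ψ u t * (1 + θ t) ^ 2 * Real.exp (-(2 * θ t * m)) * (5 * M ^ 3) := by
  have hw := hI.weight_nonneg ht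
  have hθ := hI.θ_nonneg ht
  have hE : Real.exp (-(2 * θ t * x.1)) ≤ Real.exp (-(2 * θ t * m)) := by
    apply Real.exp_le_exp.2; nlinarith
  have h1 : (1 : ℝ) ≤ (1 + θ t) ^ 2 := one_le_pow₀ (by linarith)
  have h2 : θ t ≤ (1 + θ t) ^ 2 := by nlinarith
  have hM3 : 0 < M ^ 3 := by positivity
  rw [Prod.norm_def]
  refine max_le ?_ ?_
  · simp only [field, norm_neg]
    rw [Real.norm_of_nonneg (by positivity)]
    have h3 : x.2 ^ 2 ≤ 5 * M ^ 3 := by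
      have h4 : x.2 ^ 2 ≤ M ^ 2 := by rw [← sq_abs]; gcongr
      nlinarith [sq_nonneg M]
    gcongr
    exact le_mul_of_one_le_right hw h1
  · simp only [field, norm_neg]
    rw [Real.norm_eq_abs, abs_mul, abs_pow, abs_of_nonneg (show 0 ≤ θ t * weight ℓ ψ u t *
      Real.exp (-(2 * θ t * x.1)) by positivity)]
    have h3 : |x.2| ^ 3 ≤ 5 * M ^ 3 := by
      have h4 : |x.2| ^ 3 ≤ M ^ 3 := by gcongr
      linarith
    rw [mul_comm (weight ℓ ψ u t)]
    gcongr

theorem norm_field_sub_field_le (hI : IsIntegratingFactors p ℓ a b ψ u θ) {m M t : ℝ}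
    (hM : 1 ≤ M) (ht : 0 ≤ t) {x y : ℝ × ℝ} (hx : m ≤ x.1) (hx2 : |x.2| ≤ M) (hy : m ≤ y.1)
    (hy2 : |y.2| ≤ M) :
    ‖field ℓ ψ u θ t x - field ℓ ψ u θ t y‖ ≤
      weight ℓ ψ u t * (1 + θ t) ^ 2 * Real.exp (-(2 * θ t * m)) * (5 * M ^ 3) * ‖x - y‖ := by
  have hw := hI.weight_nonneg ht
  have hθ := hI.θ_nonneg ht
  have hN : 0 ≤ ‖x - y‖ := norm_nonneg _
  have hd1 : |x.1 - y.1| ≤ ‖x - y‖ := norm_fst_le (x - y)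
  have hd2 : |x.2 - y.2| ≤ ‖x - y‖ := norm_snd_le (x - y)
  have hE : Real.exp (-(2 * θ t * y.1)) ≤ Real.exp (-(2 * θ t * m)) := by
    apply Real.exp_le_exp.2; nlinarith
  have hEE := abs_exp_neg_sub_exp_neg_le hθ hx hy
  have hE0 := Real.exp_pos (-(2 * θ t * m))
  have hE1 := Real.exp_pos (-(2 * θ t * y.1))
  set A := Real.exp (-(2 * θ t * x.1))
  set B := Real.exp (-(2 * θ t * y.1))
  set E := Real.exp (-(2 * θ t * m))
  have hM0 : 0 < M := by linarith
  have hMM : M ^ 2 ≤ M ^ 3 := pow_le_pow_right₀ hM (by norm_num)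
  have hM1 : M ≤ M ^ 3 := le_self_pow₀ hM (by norm_num)
  have hx2' : x.2 ^ 2 ≤ M ^ 2 := by rw [← sq_abs]; gcongr
  have hx3' : |x.2 ^ 3| ≤ M ^ 3 := by rw [abs_pow]; gcongr
  have hs : |x.2 + y.2| ≤ 2 * M := (abs_add_le _ _).trans (by linarith)
  have hq : |x.2 ^ 2 + x.2 * y.2 + y.2 ^ 2| ≤ 3 * M ^ 2 := by
    have h1 : |x.2 * y.2| ≤ M * M := by rw [abs_mul]; gcongr
    have h2 : y.2 ^ 2 ≤ M ^ 2 := by rw [← sq_abs]; gcongr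
    have h3 := abs_le.1 h1
    rw [abs_le]
    constructor <;> nlinarith [sq_nonneg x.2, sq_nonneg y.2]
  rw [Prod.norm_def]
  refine max_le ?_ ?_
  · have e : (field ℓ ψ u θ t x - field ℓ ψ u θ t y).1 = -(weight ℓ ψ u t *
        ((A - B) * x.2 ^ 2 + B * ((x.2 + y.2) * (x.2 - y.2)))) := by
      simp only [field, Prod.fst_sub]
      ring
    rw [e, norm_neg, Real.norm_eq_abs, abs_mul, abs_of_nonneg hw]
    have h1 : |(A - B) * x.2 ^ 2 + B * ((x.2 + y.2) * (x.2 - y.2))| ≤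
        2 * θ t * E * ‖x - y‖ * M ^ 2 + E * (2 * M * ‖x - y‖) := by
      refine (abs_add_le _ _).trans ?_
      rw [abs_mul, abs_mul, abs_mul, abs_of_nonneg (sq_nonneg x.2), abs_of_pos hE1]
      gcongr
      exact hEE.trans (by gcongr)
    calc weight ℓ ψ u t * |(A - B) * x.2 ^ 2 + B * ((x.2 + y.2) * (x.2 - y.2))|
        ≤ weight ℓ ψ u t * (2 * θ t * E * ‖x - y‖ * M ^ 2 + E * (2 * M * ‖x - y‖)) := by gcongr
      _ = weight ℓ ψ u t * E * ‖x - y‖ * (2 * θ t * M ^ 2 + 2 * M) := by ring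
      _ ≤ weight ℓ ψ u t * E * ‖x - y‖ * ((1 + θ t) ^ 2 * (5 * M ^ 3)) := by
          gcongr
          nlinarith [mul_nonneg hθ (pow_nonneg hM0.le 3), pow_pos hM0 3,
            mul_nonneg (sq_nonneg (θ t)) (pow_nonneg hM0.le 3), mul_le_mul_of_nonneg_left hMM hθ]
      _ = _ := by ring
  · have e : (field ℓ ψ u θ t x - field ℓ ψ u θ t y).2 = -(θ t * weight ℓ ψ u t *
        ((A - B) * x.2 ^ 3 + B * ((x.2 ^ 2 + x.2 * y.2 + y.2 ^ 2) * (x.2 - y.2)))) := by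
      simp only [field, Prod.snd_sub]
      ring
    rw [e, norm_neg, Real.norm_eq_abs, abs_mul, abs_of_nonneg (mul_nonneg hθ hw)]
    have h1 : |(A - B) * x.2 ^ 3 + B * ((x.2 ^ 2 + x.2 * y.2 + y.2 ^ 2) * (x.2 - y.2))| ≤
        2 * θ t * E * ‖x - y‖ * M ^ 3 + E * (3 * M ^ 2 * ‖x - y‖) := by
      refine (abs_add_le _ _).trans ?_
      rw [abs_mul, abs_mul, abs_mul, abs_of_pos hE1]
      gcongr
      exact hEE.trans (by gcongr)
    calc θ t * weight ℓ ψ u t *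
          |(A - B) * x.2 ^ 3 + B * ((x.2 ^ 2 + x.2 * y.2 + y.2 ^ 2) * (x.2 - y.2))|
        ≤ θ t * weight ℓ ψ u t *
          (2 * θ t * E * ‖x - y‖ * M ^ 3 + E * (3 * M ^ 2 * ‖x - y‖)) := by gcongr
      _ = weight ℓ ψ u t * E * ‖x - y‖ * (2 * θ t ^ 2 * M ^ 3 + 3 * θ t * M ^ 2) := by ring
      _ ≤ weight ℓ ψ u t * E * ‖x - y‖ * ((1 + θ t) ^ 2 * (5 * M ^ 3)) := by
          gcongr
          nlinarith [mul_nonneg hθ (pow_nonneg hM0.le 3), pow_pos hM0 3,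
            mul_nonneg (sq_nonneg (θ t)) (pow_nonneg hM0.le 3), mul_le_mul_of_nonneg_left hMM hθ]
      _ = _ := by ring

theorem continuous_field (hI : IsIntegratingFactors p ℓ a b ψ u θ) (x : ℝ × ℝ) :
    Continuous fun t => field ℓ ψ u θ t x := by
  have h1 := hI.smooth_weight.continuous
  have h2 := hI.smooth_θ.continuous
  unfold field
  fun_prop

theorem smooth_field (hI : IsIntegratingFactors p ℓ a b ψ u θ) :
    ContDiff ℝ ∞ (Function.uncurry (field ℓ ψ u θ)) := by
  have h1 := hI.smooth_weight
  have h2 := hI.smooth_θ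
  unfold field Function.uncurry
  refine ContDiff.prodMk ?_ ?_ <;> fun_prop

theorem field_neg (hI : IsIntegratingFactors p ℓ a b ψ u θ) (t : ℝ) (x : ℝ × ℝ) :
    field ℓ ψ u θ (-t) x = -field ℓ ψ u θ t x := by
  have h1 : weight ℓ ψ u (-t) = -weight ℓ ψ u t := by
    unfold weight
    rw [hI.even_ψ t, hI.even_u t]
    ring
  simp only [field, h1, hI.even_θ t]
  refine Prod.ext ?_ ?_
  · simp only [Prod.fst_neg]; ring
  · simp only [Prod.snd_neg]; ring

theorem clampedField_eq {m M : ℝ} {x : ℝ × ℝ} (h1 : x.1 ∈ Icc m M) (h2 : |x.2| ≤ M) (t : ℝ) :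
    clampedField ℓ ψ u θ m M t x = field ℓ ψ u θ t x := by
  rw [clampedField, clamp_of_mem h1, clamp_of_mem (abs_le.1 h2)]

/-- The flow from infinity of the clamped field, whose Lipschitz constants are integrable because
its first argument stays above `m > ℓ⁻¹`. -/
theorem exists_clamped_flow (hI : IsIntegratingFactors p ℓ a b ψ u θ) {m M : ℝ} (hm : ℓ⁻¹ < m)
    (hM : 1 ≤ M) :
    ∃ (c : NNReal) (Ψ : (ℝ × ℝ) ≃ₜ (ℝ × ℝ)) (X : ℝ × ℝ → ℝ → ℝ × ℝ), (∀ e, X e 0 = Ψ e) ∧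
      (∀ e t, 0 ≤ t →
        HasDerivWithinAt (X e) (clampedField ℓ ψ u θ m M t (X e t)) (Ici 0) t) ∧
      (∀ e, Tendsto (X e) atTop (𝓝 e)) ∧
      (∀ e e' t, 0 ≤ t → dist (X e t) (X e' t) ≤ dist e e' * Real.exp c) ∧
      ∀ S, 0 ≤ S → ∀ (e : ℝ × ℝ) (Y : ℝ → ℝ × ℝ),
        (∀ t, S < t → HasDerivAt Y (clampedField ℓ ψ u θ m M t (Y t)) t) →
        Tendsto Y atTop (𝓝 e) → EqOn Y (X e) (Ioi S) := by
  obtain ⟨B, hB, hw⟩ := hI.exists_weight_le hm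
  have hMM : -M ≤ M := by linarith
  have hc2 : ∀ x : ℝ, |clamp (-M) M x| ≤ M := fun x => abs_le.2 ⟨le_clamp _ _ _, clamp_le hMM _⟩
  obtain ⟨c, hc⟩ : ∃ c : NNReal, (c : ℝ) = B * (5 * M ^ 3) := ⟨⟨_, by positivity⟩, rfl⟩
  refine ⟨c, exists_flow_from_infinity
    (V := clampedField ℓ ψ u θ m M) (fun x => (hI.continuous_field _).continuousOn)
    (fun t ht x => ?_) (fun t ht x y => ?_)⟩
  · refine (hI.norm_field_le hM ht (le_clamp _ _ _) (hc2 _)).trans ?_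
    calc _ ≤ B / (1 + t) ^ 3 * (5 * M ^ 3) := by gcongr; exact hw t ht
      _ = _ := by rw [hc]; ring
  · refine (hI.norm_field_sub_field_le hM ht (le_clamp _ _ _) (hc2 _) (le_clamp _ _ _)
      (hc2 _)).trans ?_
    have h1 : ‖((clamp m M x.1, clamp (-M) M x.2) : ℝ × ℝ) -
        (clamp m M y.1, clamp (-M) M y.2)‖ ≤ ‖x - y‖ := by
      rw [Prod.norm_def, Prod.norm_def]
      exact max_le_max (abs_clamp_sub_clamp_le _ _ _ _) (abs_clamp_sub_clamp_le _ _ _ _)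
    calc _ ≤ B / (1 + t) ^ 3 * (5 * M ^ 3) * ‖x - y‖ := by gcongr; exact hw t ht
      _ = _ := by rw [hc]; ring

/-- A solution is determined by its limit at infinity: on `[t₀, ∞)` with `t₀ > S` monotonicity
confines it to a box, where the field agrees with a clamped one. -/
theorem eqOn_of_tendsto (hI : IsIntegratingFactors p ℓ a b ψ u θ) {S : ℝ} (hS : 0 ≤ S)
    {X Y : ℝ → ℝ × ℝ} (hX : ∀ t, S < t → HasDerivAt X (field ℓ ψ u θ t (X t)) t)
    (hY : ∀ t, S < t → HasDerivAt Y (field ℓ ψ u θ t (Y t)) t) {e : ℝ × ℝ}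
    (hXe : Tendsto X atTop (𝓝 e)) (hYe : Tendsto Y atTop (𝓝 e)) (he : ℓ⁻¹ < e.1) :
    EqOn X Y (Ioi S) := by
  intro t ht
  have ht' : S < t := ht
  set S' := (S + t) / 2 with hS'
  have hSS' : S < S' := by linarith
  have hS't : S' < t := by linarith
  set M := 1 + |(X S').1| + |(X S').2| + |(Y S').1| + |(Y S').2| with hM
  have a1 := abs_nonneg (X S').1
  have a2 := abs_nonneg (X S').2
  have a3 := abs_nonneg (Y S').1
  have a4 := abs_nonneg (Y S').2
  obtain ⟨c, Ψ, Z, -, -, -, -, hu⟩ := hI.exists_clamped_flow he (show 1 ≤ M by linarith)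
  have key : ∀ {W : ℝ → ℝ × ℝ}, (∀ t, S < t → HasDerivAt W (field ℓ ψ u θ t (W t)) t) →
      Tendsto W atTop (𝓝 e) → |(W S').1| ≤ M → |(W S').2| ≤ M → W t = Z e t := by
    intro W hW hWe h1 h2
    refine hu S' (hS.trans hSS'.le) e W (fun s hs => ?_) hWe hS't
    have hs' : S < s := hSS'.trans hs
    rw [clampedField_eq]
    · exact hW s hs'
    · exact ⟨hI.le_fst hS hW hWe.fst_nhds hs',
        (hI.antitoneOn_fst hS hW hSS' hs' hs.le).trans ((le_abs_self _).trans h1)⟩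
    · exact (sq_le_sq.1 (hI.antitoneOn_snd_sq hS hW hSS' hs' hs.le)).trans h2
  rw [key hX hXe (by linarith) (by linarith), key hY hYe (by linarith) (by linarith)]

/-- A solution which is regular at `0` closes smoothly over the singular orbit. -/
theorem closesSmoothly_of_hasDerivWithinAt (hI : IsIntegratingFactors p ℓ a b ψ u θ)
    {X : ℝ → ℝ × ℝ}
    (hX : ∀ t, 0 ≤ t → HasDerivWithinAt X (field ℓ ψ u θ t (X t)) (Ici 0) t) :
    ClosesSmoothly (ψ 0 * Real.exp (-(θ 0 * (X 0).1)) * (X 0).2, (X 0).1 / (2 * ℓ))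
      (fOf ψ θ X) (gOf ℓ u X) := by
  have hs := contDiff_comp_abs_of_hasDerivWithinAt hI.smooth_field hI.field_neg hX
  have hs1 : ContDiff ℝ ∞ fun t => (X |t|).1 := hs.fst
  have hs2 : ContDiff ℝ ∞ fun t => (X |t|).2 := hs.snd
  have hψ := hI.smooth_ψ
  have hθ := hI.smooth_θ
  have hu := hI.smooth_u
  have hderiv : ∀ {q : ℝ → ℝ}, ContDiff ℝ ∞ q → deriv (fun t => t * q t) 0 = q 0 := by
    intro q hq
    have h := (hasDerivAt_id (0 : ℝ)).fun_mul (hq.differentiable (by simp) 0).hasDerivAt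
    simpa using h.deriv
  constructor
  · have hq : ContDiff ℝ ∞ fun t => ψ t * Real.exp (-(θ t * (X |t|).1)) * (X |t|).2 := by fun_prop
    refine ⟨fun t => t * (ψ t * Real.exp (-(θ t * (X |t|).1)) * (X |t|).2),
      contDiff_id.mul hq, fun t => ?_, ?_, ?_⟩
    · simp only [abs_neg, hI.even_ψ t, hI.even_θ t]
      ring
    · rw [hderiv hq, abs_zero]
    · filter_upwards [self_mem_nhdsWithin] with t ht
      have ht0 : 0 < t := ht
      rw [abs_of_pos ht0, fOf]
      ring
  · have hq : ContDiff ℝ ∞ fun t => u t * (X |t|).1 / ℓ := by fun_prop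
    refine ⟨fun t => t * (u t * (X |t|).1 / ℓ), contDiff_id.mul hq, fun t => ?_, ?_, ?_⟩
    · simp only [abs_neg, hI.even_u t]
      ring
    · rw [hderiv hq, abs_zero, hI.u_zero]
      have := hI.ℓ_pos
      field_simp
    · filter_upwards [self_mem_nhdsWithin] with t ht
      have ht0 : 0 < t := ht
      rw [abs_of_pos ht0, gOf]
      ring

end IsIntegratingFactors

theorem IsSmoothOddAtZero.tendsto_div {f : ℝ → ℝ} {f₁ : ℝ} (h : IsSmoothOddAtZero f f₁) :
    Tendsto (fun t => f t / t) (𝓝[>] 0) (𝓝 f₁) := by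
  obtain ⟨φ, hφ, hodd, hd, heq⟩ := h
  have h1 : HasDerivAt φ f₁ 0 := by
    rw [← hd]; exact (hφ.differentiable (by simp) 0).hasDerivAt
  have h2 := hasDerivAt_iff_tendsto_slope.1 h1
  refine (h2.mono_left (nhdsWithin_mono _ fun t ht => ne_of_gt ht)).congr' ?_
  filter_upwards [heq] with t ht
  rw [slope_def_field, hodd.map_zero, ht, sub_zero, sub_zero]

namespace IsIntegratingFactors

variable {p ℓ : ℝ} {a b ψ u θ : ℝ → ℝ}

/-- The normalised variables of an instanton that closes smoothly converge at `0`. -/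
theorem tendsto_stateOf_zero (hI : IsIntegratingFactors p ℓ a b ψ u θ) {x : ℝ × ℝ}
    {f g : ℝ → ℝ} (h : ClosesSmoothly x f g) :
    Tendsto (stateOf ℓ ψ u θ f g) (𝓝[>] 0)
      (𝓝 (2 * ℓ * x.2, x.1 * Real.exp (θ 0 * (2 * ℓ * x.2)) / ψ 0)) := by
  have hψ : Tendsto ψ (𝓝[>] 0) (𝓝 (ψ 0)) :=
    hI.smooth_ψ.continuous.continuousAt.tendsto.mono_left nhdsWithin_le_nhds
  have hθ : Tendsto θ (𝓝[>] 0) (𝓝 (θ 0)) :=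
    hI.smooth_θ.continuous.continuousAt.tendsto.mono_left nhdsWithin_le_nhds
  have hu : Tendsto u (𝓝[>] 0) (𝓝 (u 0)) :=
    hI.smooth_u.continuous.continuousAt.tendsto.mono_left nhdsWithin_le_nhds
  have h1 := (h.2.tendsto_div.const_mul ℓ).div hu (hI.u_pos 0).ne'
  have e1 : ℓ * x.2 / u 0 = 2 * ℓ * x.2 := by rw [hI.u_zero]; ring
  rw [e1] at h1
  have h2 : Tendsto (fun t => ℓ * g t / (t * u t)) (𝓝[>] 0) (𝓝 (2 * ℓ * x.2)) := by
    refine h1.congr' ?_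
    filter_upwards [self_mem_nhdsWithin] with t ht
    have ht0 : 0 < t := ht
    have := hI.u_pos t
    simp only [Pi.div_apply]
    field_simp
  have h3 := (h.1.tendsto_div.mul (hθ.mul h2).rexp).div hψ (hI.ψ_pos 0).ne'
  refine h2.prodMk_nhds (h3.congr' ?_)
  filter_upwards [self_mem_nhdsWithin] with t ht
  have ht0 : 0 < t := ht
  have := hI.ψ_pos t
  simp only [Pi.div_apply]
  field_simp

end IsIntegratingFactors

/-- The change from the normalised variables `(h, κ)` at `t = 0` to the initial data
`(f₁, g₁)`. -/
noncomputable def initialDataHomeomorph {ℓ ψ₀ : ℝ} (hℓ : 0 < ℓ) (hψ₀ : 0 < ψ₀) (θ₀ : ℝ) :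
    (ℝ × ℝ) ≃ₜ (ℝ × ℝ) where
  toFun x := (ψ₀ * Real.exp (-(θ₀ * x.1)) * x.2, x.1 / (2 * ℓ))
  invFun y := (2 * ℓ * y.2, y.1 * Real.exp (θ₀ * (2 * ℓ * y.2)) / ψ₀)
  left_inv x := by
    have e : 2 * ℓ * (x.1 / (2 * ℓ)) = x.1 := by field_simp
    simp only [e, Real.exp_neg]
    refine Prod.ext rfl ?_
    have := Real.exp_pos (θ₀ * x.1)
    simp only
    field_simp
  right_inv y := by
    simp only [Real.exp_neg]
    have := Real.exp_pos (θ₀ * (2 * ℓ * y.2))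
    refine Prod.ext ?_ ?_
    · simp only
      field_simp
    · simp only
      field_simp
  continuous_toFun := by fun_prop
  continuous_invFun := by fun_prop

end B7

/-! ### The local homeomorphism between end data and initial data -/

namespace B7

namespace IsIntegratingFactors

variable {p ℓ : ℝ} {a b ψ u θ : ℝ → ℝ}

theorem isCompleteSolution_of_hasDerivWithinAt (hI : IsIntegratingFactors p ℓ a b ψ u θ)
    {X : ℝ → ℝ × ℝ}
    (hX : ∀ t, 0 ≤ t → HasDerivWithinAt X (field ℓ ψ u θ t (X t)) (Ici 0) t) {e : ℝ × ℝ}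
    (he : Tendsto X atTop (𝓝 e)) (heℓ : ℓ⁻¹ < e.1) :
    IsCompleteSolution p ℓ a b (initialDataHomeomorph hI.ℓ_pos (hI.ψ_pos 0) (θ 0) (X 0)) e
      (fOf ψ θ X) (gOf ℓ u X) := by
  have hX' : ∀ t, 0 < t → HasDerivAt X (field ℓ ψ u θ t (X t)) t := fun t ht =>
    (hX t ht.le).hasDerivAt (Ici_mem_nhds ht)
  exact ⟨hI.solvesOn_of_hasDerivAt hX', hI.closesSmoothly_of_hasDerivWithinAt hX,
    hI.hasEndData_of_tendsto hX' he heℓ⟩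

/-- Near the end data of a complete solution, the flow from `t = ∞` to `t = 0` of the normalised
equations stays in a fixed box, so that it is the flow of a Lipschitz field with integrable
Lipschitz constant, hence a homeomorphism. -/
theorem exists_openPartialHomeomorph (hI : IsIntegratingFactors p ℓ a b ψ u θ) {x₀ e₀ : ℝ × ℝ}
    {f₀ g₀ : ℝ → ℝ} (h : IsCompleteSolution p ℓ a b x₀ e₀ f₀ g₀) (he : ℓ⁻¹ < e₀.1) :
    ∃ Φ : OpenPartialHomeomorph (ℝ × ℝ) (ℝ × ℝ), e₀ ∈ Φ.source ∧ Φ e₀ = x₀ ∧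
      ∀ e ∈ Φ.source, ℓ⁻¹ < e.1 ∧
        (∃ F H : ℝ → ℝ, IsCompleteSolution p ℓ a b (Φ e) e F H) ∧
        ∀ (S : ℝ) (v w : ℝ → ℝ), IsEndSolution p ℓ a b e S v w →
          ∃ F H : ℝ → ℝ, IsCompleteSolution p ℓ a b (Φ e) e F H ∧
            EqOn F v (Ioi S) ∧ EqOn H w (Ioi S) := by
  set D := initialDataHomeomorph hI.ℓ_pos (hI.ψ_pos 0) (θ 0) with hD
  set Y := stateOf ℓ ψ u θ f₀ g₀ with hYdef
  have hY : ∀ t, 0 < t → HasDerivAt Y (field ℓ ψ u θ t (Y t)) t := fun t ht =>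
    hI.hasDerivAt_stateOf le_rfl h.solves ht
  have hYe : Tendsto Y atTop (𝓝 e₀) := hI.tendsto_stateOf le_rfl h.solves h.endData he
  set y₀ := D.symm x₀ with hy₀
  have hY0 : Tendsto Y (𝓝[>] 0) (𝓝 y₀) := hI.tendsto_stateOf_zero h.closes
  -- the given solution stays in a smaller box
  have hY1 : ∀ t, 0 < t → e₀.1 ≤ (Y t).1 := fun t ht => hI.le_fst le_rfl hY hYe.fst_nhds ht
  have hev : ∀ t : ℝ, 0 < t → ∀ᶠ s in 𝓝[>] (0 : ℝ), 0 < s ∧ s ≤ t := fun t ht => by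
    filter_upwards [Ioc_mem_nhdsGT ht] with s hs using hs
  have hY2 : ∀ t, 0 < t → (Y t).1 ≤ y₀.1 := fun t ht =>
    ge_of_tendsto hY0.fst_nhds ((hev t ht).mono fun s hs =>
      hI.antitoneOn_fst le_rfl hY hs.1 ht hs.2)
  have hY3 : ∀ t, 0 < t → |(Y t).2| ≤ |y₀.2| := fun t ht => sq_le_sq.1
    (ge_of_tendsto (hY0.snd_nhds.pow 2) ((hev t ht).mono fun s hs =>
      hI.antitoneOn_snd_sq le_rfl hY hs.1 ht hs.2))
  set m := (ℓ⁻¹ + e₀.1) / 2 with hm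
  have hmℓ : ℓ⁻¹ < m := by linarith
  have hme : m < e₀.1 := by linarith
  set M := 1 + |y₀.1| + |y₀.2| with hM
  have hM1 := abs_nonneg y₀.1
  have hM2 := abs_nonneg y₀.2
  have hM3 := le_abs_self y₀.1
  obtain ⟨c, Ψ, X, hX0, hXd, hXe, hXdist, hXu⟩ :=
    hI.exists_clamped_flow hmℓ (show 1 ≤ M by linarith)
  have hYX : EqOn Y (X e₀) (Ioi 0) := by
    refine hXu 0 le_rfl e₀ Y (fun t ht => ?_) hYe
    rw [clampedField_eq]
    · exact hY t ht
    · exact ⟨hme.le.trans (hY1 t ht), (hY2 t ht).trans (by linarith)⟩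
    · exact (hY3 t ht).trans (by linarith)
  have hX0e : X e₀ 0 = y₀ := by
    have h1 : Tendsto (X e₀) (𝓝[>] 0) (𝓝 (X e₀ 0)) :=
      (hXd e₀ 0 le_rfl).continuousWithinAt.mono Ioi_subset_Ici_self
    refine tendsto_nhds_unique h1 (hY0.congr' ?_)
    filter_upwards [self_mem_nhdsWithin] with t ht using hYX ht
  have hbox : ∀ t, 0 ≤ t → e₀.1 ≤ (X e₀ t).1 ∧ (X e₀ t).1 ≤ y₀.1 ∧ |(X e₀ t).2| ≤ |y₀.2| := by
    intro t ht
    rcases ht.eq_or_lt with rfl | ht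
    · rw [hX0e]
      exact ⟨ge_of_tendsto hY0.fst_nhds ((hev 1 one_pos).mono fun s hs => hY1 s hs.1),
        le_rfl, le_rfl⟩
    · rw [← hYX ht]
      exact ⟨hY1 t ht, hY2 t ht, hY3 t ht⟩
  -- solutions with nearby end data stay within distance `ε` of the given one
  set ε := min (e₀.1 - m) 1 with hε
  have hε0 : 0 < ε := lt_min (by linarith) one_pos
  have hε1 : ε ≤ e₀.1 - m := min_le_left _ _
  have hε2 : ε ≤ 1 := min_le_right _ _
  set η := ε * Real.exp (-c) with hη
  have hη0 : 0 < η := by positivity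
  have hnear : ∀ e ∈ Metric.ball e₀ η, ∀ t, 0 ≤ t →
      (X e t).1 ∈ Icc m M ∧ |(X e t).2| ≤ M := by
    intro e hee t ht
    have h1 : dist (X e t) (X e₀ t) ≤ ε := by
      refine (hXdist e e₀ t ht).trans ?_
      have h2 : dist e e₀ ≤ η := (Metric.mem_ball.1 hee).le
      calc dist e e₀ * Real.exp c ≤ η * Real.exp c := by gcongr
        _ = ε := by rw [hη, mul_assoc, ← Real.exp_add, neg_add_cancel, Real.exp_zero, mul_one]
    obtain ⟨b1, b2, b3⟩ := hbox t ht
    rw [Prod.dist_eq, Real.dist_eq, Real.dist_eq] at h1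
    have d1 := abs_le.1 ((le_max_left _ _).trans h1)
    have d2 := abs_sub_abs_le_abs_sub (X e t).2 (X e₀ t).2
    have d3 := (le_max_right _ _).trans h1
    exact ⟨⟨by linarith, by linarith⟩, by linarith⟩
  have hXfield : ∀ e ∈ Metric.ball e₀ η, ∀ t, 0 ≤ t →
      HasDerivWithinAt (X e) (field ℓ ψ u θ t (X e t)) (Ici 0) t := by
    intro e hee t ht
    obtain ⟨h1, h2⟩ := hnear e hee t ht
    have := hXd e t ht
    rwa [clampedField_eq h1 h2] at this
  have hℓe : ∀ e ∈ Metric.ball e₀ η, ℓ⁻¹ < e.1 := fun e hee =>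
    hmℓ.trans_le (ge_of_tendsto (hXe e).fst_nhds
      ((eventually_ge_atTop 0).mono fun t ht => (hnear e hee t ht).1.1))
  have hcomplete : ∀ e ∈ Metric.ball e₀ η,
      IsCompleteSolution p ℓ a b (D (Ψ e)) e (fOf ψ θ (X e)) (gOf ℓ u (X e)) := by
    intro e hee
    rw [← hX0 e]
    exact hI.isCompleteSolution_of_hasDerivWithinAt (hXfield e hee) (hXe e) (hℓe e hee)
  refine ⟨(Ψ.trans D).toOpenPartialHomeomorph.restrOpen _ (Metric.isOpen_ball (x := e₀) (ε := η)),
    ⟨mem_univ _, Metric.mem_ball_self hη0⟩, ?_, ?_⟩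
  · change D (Ψ e₀) = x₀
    rw [← hX0, hX0e, hy₀, Homeomorph.apply_symm_apply]
  · rintro e ⟨-, hee⟩
    refine ⟨hℓe e hee, ⟨_, _, hcomplete e hee⟩, fun S v w hvw => ⟨_, _, hcomplete e hee, ?_⟩⟩
    have hS := hvw.T_nonneg
    have heq := hI.eqOn_of_tendsto hS
      (fun t ht => (hXfield e hee t (hS.trans ht.le)).hasDerivAt (Ici_mem_nhds (hS.trans_lt ht)))
      (fun t ht => hI.hasDerivAt_stateOf hS hvw.solves ht) (hXe e)
      (hI.tendsto_stateOf hS hvw.solves hvw.endData (hℓe e hee)) (hℓe e hee)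
    constructor
    · intro t ht
      rw [← hI.fOf_stateOf (f := v) (g := w) (hS.trans_lt ht), fOf, fOf, heq ht]
    · intro t ht
      rw [← hI.gOf_stateOf (f := v) (g := w) (hS.trans_lt ht), gOf, gOf, heq ht]

/-- The abelian solution has constant normalised variables `(h, κ) = (G, 0)`. -/
theorem isCompleteSolution_abelian (hI : IsIntegratingFactors p ℓ a b ψ u θ) {G : ℝ}
    (hG : ℓ⁻¹ < G) :
    IsCompleteSolution p ℓ a b (0, G / (2 * ℓ)) (G, 0) (fun _ => 0)
      (fun t => G / ℓ * A₃ p a b t) := by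
  have h := hI.isCompleteSolution_of_hasDerivWithinAt (X := fun _ => (G, 0)) (e := (G, 0))
    (fun t _ => by
      have e : field ℓ ψ u θ t (G, 0) = 0 := by simp [field]
      rw [e]
      exact hasDerivWithinAt_const _ _ _) tendsto_const_nhds hG
  have h1 : fOf ψ θ (fun _ => (G, 0)) = fun _ => 0 := by
    funext t
    simp [fOf]
  have h2 : gOf ℓ u (fun _ => (G, 0)) = fun t => G / ℓ * A₃ p a b t := by
    funext t
    rw [gOf, hI.A₃_eq]
    ring
  rw [h1, h2] at h
  simpa [initialDataHomeomorph] using h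

/-- A complete solution with `κ(∞) ≠ 0` has no zero of `f`, since `κ²` does not increase. -/
theorem fst_ne_zero (hI : IsIntegratingFactors p ℓ a b ψ u θ) {x e : ℝ × ℝ} {f g : ℝ → ℝ}
    (h : IsCompleteSolution p ℓ a b x e f g) (he : ℓ⁻¹ < e.1) (he2 : e.2 ≠ 0) {t : ℝ}
    (ht : 0 < t) : f t ≠ 0 := by
  intro hft
  refine he2 ?_
  have h1 := hI.tendsto_stateOf le_rfl h.solves h.endData he
  refine (tendsto_nhds_unique (h1.snd_nhds) (tendsto_const_nhds.congr' ?_))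
  filter_upwards [eventually_ge_atTop t] with s hs
  have h2 : (stateOf ℓ ψ u θ f g s).2 ^ 2 ≤ (stateOf ℓ ψ u θ f g t).2 ^ 2 :=
    hI.antitoneOn_snd_sq le_rfl (fun t ht => hI.hasDerivAt_stateOf le_rfl h.solves ht)
      (mem_Ioi.2 ht) (mem_Ioi.2 (ht.trans_le hs)) hs
  have h3 : (stateOf ℓ ψ u θ f g t).2 = 0 := by simp [stateOf, hft]
  rw [h3] at h2
  have h4 : (stateOf ℓ ψ u θ f g s).2 ^ 2 = 0 := le_antisymm (by simpa using h2) (sq_nonneg _)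
  exact (pow_eq_zero_iff two_ne_zero |>.1 h4).symm

end IsIntegratingFactors

/-! ### Boundedness of complete solutions -/

theorem exists_bound_of_tendsto {f : ℝ → ℝ} (hf : ContinuousOn f (Ioi 0)) {A B : ℝ}
    (h0 : Tendsto f (𝓝[>] 0) (𝓝 A)) (h1 : Tendsto f atTop (𝓝 B)) :
    ∃ C, ∀ t, 0 < t → |f t| ≤ C := by
  have e0 := h0.abs.eventually_le_const (lt_add_one |A|)
  have e1 := h1.abs.eventually_le_const (lt_add_one |B|)
  obtain ⟨δ, hδ, hδ'⟩ := (mem_nhdsGT_iff_exists_Ioo_subset (α := ℝ)).1 e0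
  obtain ⟨T, hT⟩ := eventually_atTop.1 e1
  have hδ0 : 0 < δ := hδ
  obtain ⟨C, hC⟩ := (isCompact_Icc (a := δ) (b := T)).exists_bound_of_continuousOn
    (hf.mono fun t ht => hδ0.trans_le ht.1)
  refine ⟨max C (max (|A| + 1) (|B| + 1)), fun t ht => ?_⟩
  rcases lt_or_ge t δ with h | h
  · exact le_max_of_le_right (le_max_of_le_left (hδ' ⟨ht, h⟩))
  rcases le_total T t with h' | h'
  · exact le_max_of_le_right (le_max_of_le_right (hT t h'))
  · exact le_max_of_le_left (hC t ⟨h, h'⟩)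

theorem IsSmoothOddAtZero.tendsto {f : ℝ → ℝ} {f₁ : ℝ} (h : IsSmoothOddAtZero f f₁) :
    Tendsto f (𝓝[>] 0) (𝓝 0) := by
  obtain ⟨φ, hφ, hodd, -, heq⟩ := h
  have h1 : Tendsto φ (𝓝 0) (𝓝 (φ 0)) := hφ.continuous.continuousAt
  rw [hodd.map_zero] at h1
  exact (h1.mono_left nhdsWithin_le_nhds).congr' heq.symm

theorem HasEndData.tendsto_fst {ℓ : ℝ} {e : ℝ × ℝ} {f g : ℝ → ℝ} (h : HasEndData ℓ e f g)
    (he : ℓ⁻¹ < e.1) : Tendsto f atTop (𝓝 0) := by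
  have hexp : Tendsto (fun t : ℝ => Real.exp ((ℓ⁻¹ - e.1) * t)) atTop (𝓝 0) :=
    Real.tendsto_exp_atBot.comp (tendsto_id.const_mul_atTop_of_neg (by linarith))
  have h5 : Tendsto (fun t : ℝ => t ^ (-(5 : ℝ) / 2)) atTop (𝓝 0) := by
    rw [neg_div]; exact tendsto_rpow_neg_atTop (by norm_num)
  have h7 : Tendsto (fun t : ℝ => t ^ (-(7 : ℝ) / 2)) atTop (𝓝 0) := by
    rw [neg_div]; exact tendsto_rpow_neg_atTop (by norm_num)
  have hE : Tendsto (fun t : ℝ => Real.exp ((ℓ⁻¹ - e.1) * t) * t ^ (-(7 : ℝ) / 2)) atTop (𝓝 0) := by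
    simpa using hexp.mul h7
  have h1 : Tendsto (fun t : ℝ => Real.exp ((ℓ⁻¹ - e.1) * t) * (e.2 * t ^ (-(5 : ℝ) / 2))) atTop
      (𝓝 0) := by
    simpa using hexp.mul (h5.const_mul e.2)
  simpa using (h.2.trans_tendsto hE).add h1

theorem IsCompleteSolution.exists_bound {p ℓ : ℝ} {a b : ℝ → ℝ} {x e : ℝ × ℝ} {f g : ℝ → ℝ}
    (h : IsCompleteSolution p ℓ a b x e f g) (he : ℓ⁻¹ < e.1) :
    ∃ C, ∀ t, 0 < t → |f t| ≤ C ∧ |g t| ≤ C := by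
  obtain ⟨C₁, h₁⟩ := exists_bound_of_tendsto
    (fun t ht => (h.solves t ht).1.continuousAt.continuousWithinAt) h.closes.1.tendsto
    (h.endData.tendsto_fst he)
  obtain ⟨C₂, h₂⟩ := exists_bound_of_tendsto
    (fun t ht => (h.solves t ht).2.continuousAt.continuousWithinAt) h.closes.2.tendsto
    h.endData.1
  exact ⟨max C₁ C₂, fun t ht => ⟨le_max_of_le_left (h₁ t ht), le_max_of_le_right (h₂ t ht)⟩⟩

/-! ### Complete instantons -/

namespace IsIntegratingFactors

variable {p ℓ : ℝ} {a b ψ u θ : ℝ → ℝ}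

theorem isOpen_completeInitialData (hI : IsIntegratingFactors p ℓ a b ψ u θ) :
    IsOpen (completeInitialData p ℓ a b) := by
  rw [isOpen_iff_mem_nhds]
  rintro x ⟨f, g, hs, hc, -, G, hG, hgG⟩
  obtain ⟨lam, hend, -⟩ := hI.exists_hasEndData le_rfl hs hgG hG
  obtain ⟨Φ, h1, rfl, h2⟩ := hI.exists_openPartialHomeomorph ⟨hs, hc, hend⟩ hG
  filter_upwards [Φ.open_target.mem_nhds (Φ.map_source h1)] with y hy
  obtain ⟨h3, ⟨F, H, h4⟩, -⟩ := h2 _ (Φ.map_target hy)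
  rw [Φ.right_inv hy] at h4
  exact ⟨F, H, h4.solves, h4.closes, h4.exists_bound h3, _, h3, h4.endData.1⟩

theorem isOpen_completeEndData (hI : IsIntegratingFactors p ℓ a b ψ u θ) :
    IsOpen (completeEndData p ℓ a b) := by
  rw [isOpen_iff_mem_nhds]
  rintro e ⟨he, x, f, g, h⟩
  obtain ⟨Φ, h1, -, h2⟩ := hI.exists_openPartialHomeomorph h he
  filter_upwards [Φ.open_source.mem_nhds h1] with e' he'
  obtain ⟨h3, ⟨F, H, h4⟩, -⟩ := h2 e' he'
  exact ⟨h3, _, F, H, h4⟩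

theorem exists_deformation_abelian (hI : IsIntegratingFactors p ℓ a b ψ u θ) {G : ℝ}
    (hG : ℓ⁻¹ < G) :
    ∃ ε : ℝ, 0 < ε ∧ ∃ γ : ℝ → ℝ × ℝ,
      ContinuousOn γ (Ioo (-ε) ε) ∧ InjOn γ (Ioo (-ε) ε) ∧ γ 0 = (0, G / (2 * ℓ)) ∧
      ∀ lam ∈ Ioo (-ε) ε, ∃ f g : ℝ → ℝ, IsCompleteSolution p ℓ a b (γ lam) (G, lam) f g ∧
        (lam ≠ 0 → ∀ t, 0 < t → f t ≠ 0) := by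
  obtain ⟨Φ, h1, h2, h3⟩ :=
    hI.exists_openPartialHomeomorph (hI.isCompleteSolution_abelian hG) hG
  obtain ⟨ε, hε, hball⟩ := Metric.isOpen_iff.1 Φ.open_source _ h1
  have hmem : MapsTo (fun lam : ℝ => (G, lam)) (Ioo (-ε) ε) Φ.source := fun lam hlam => by
    refine hball (Metric.mem_ball.2 ?_)
    rw [Prod.dist_eq, dist_self, Real.dist_eq, sub_zero]
    exact max_lt hε (abs_lt.2 hlam)
  refine ⟨ε, hε, fun lam => Φ (G, lam), ?_, ?_, h2, fun lam hlam => ?_⟩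
  · exact Φ.continuousOn.comp (by fun_prop) hmem
  · intro x hx y hy hxy
    exact congrArg Prod.snd (Φ.injOn (hmem hx) (hmem hy) hxy)
  · obtain ⟨h4, ⟨F, H, h5⟩, -⟩ := h3 _ (hmem hlam)
    exact ⟨F, H, h5, fun hne t ht => hI.fst_ne_zero h5 h4 hne ht⟩

end IsIntegratingFactors

end B7

theorem mainTheorem5 {r₀ abar bbar ℓ : ℝ} {a b : ℝ → ℝ}
    (hM : B7.IsB7Member r₀ abar bbar a b) (hℓ : B7.IsCircleLength a b ℓ) :
    -- local homeomorphism between end data and initial data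
    (∀ (G lam f₁ g₁ T : ℝ) (f g : ℝ → ℝ), ℓ⁻¹ < G →
      B7.IsEndSolution (r₀ ^ 3) ℓ a b (G, lam) T f g →
      (∃ F H : ℝ → ℝ, B7.SolvesOn (r₀ ^ 3) a b (Ioi 0) F H ∧
        EqOn F f (Ioi T) ∧ EqOn H g (Ioi T) ∧ B7.ClosesSmoothly (f₁, g₁) F H) →
      ∃ Φ : OpenPartialHomeomorph (ℝ × ℝ) (ℝ × ℝ),
        (G, lam) ∈ Φ.source ∧ Φ (G, lam) = (f₁, g₁) ∧
        ∀ e ∈ Φ.source, ℓ⁻¹ < e.1 ∧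
          (∃ F H : ℝ → ℝ, B7.IsCompleteSolution (r₀ ^ 3) ℓ a b (Φ e) e F H) ∧
          ∀ (S : ℝ) (u v : ℝ → ℝ), B7.IsEndSolution (r₀ ^ 3) ℓ a b e S u v →
            ∃ F H : ℝ → ℝ, B7.IsCompleteSolution (r₀ ^ 3) ℓ a b (Φ e) e F H ∧
              EqOn F u (Ioi S) ∧ EqOn H v (Ioi S)) ∧
    -- openness of the set of complete solutions, in either parameter space
    IsOpen (B7.completeInitialData (r₀ ^ 3) ℓ a b) ∧
    IsOpen (B7.completeEndData (r₀ ^ 3) ℓ a b) ∧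
    -- deformation of the abelian solutions with fixed limit
    (∀ G : ℝ, ℓ⁻¹ < G →
      B7.IsCompleteSolution (r₀ ^ 3) ℓ a b (0, G / (2 * ℓ)) (G, 0)
        (fun _ => 0) (fun t => G / ℓ * B7.A₃ (r₀ ^ 3) a b t) ∧
      ∃ ε : ℝ, 0 < ε ∧ ∃ γ : ℝ → ℝ × ℝ,
        ContinuousOn γ (Ioo (-ε) ε) ∧ InjOn γ (Ioo (-ε) ε) ∧ γ 0 = (0, G / (2 * ℓ)) ∧
        ∀ lam ∈ Ioo (-ε) ε, ∃ f g : ℝ → ℝ,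
          B7.IsCompleteSolution (r₀ ^ 3) ℓ a b (γ lam) (G, lam) f g ∧
          (lam ≠ 0 → ∀ t, 0 < t → f t ≠ 0)) := by
  obtain ⟨ψ, u, θ, hI⟩ := hM.exists_integratingFactors hℓ
  refine ⟨?_, hI.isOpen_completeInitialData, hI.isOpen_completeEndData, fun G hG =>
    ⟨hI.isCompleteSolution_abelian hG, hI.exists_deformation_abelian hG⟩⟩
  rintro G lam f₁ g₁ T f g hG hend ⟨F, H, hs, hF, hH, hc⟩
  refine hI.exists_openPartialHomeomorph ⟨hs, hc, hend.endData.congr ?_ ?_⟩ hG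
  · filter_upwards [eventually_gt_atTop T] with t ht using (hF ht).symm
  · filter_upwards [eventually_gt_atTop T] with t ht using (hH ht).symm
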